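/- Let $M$ be a smooth (Hausdorff, second countable, non-empty, boundaryless) Riemannian manifold of dimension $d\ge 2$ with finite volume, let $m$ be its normalized Riemannian volume, and let $1\le r\le\infty$. Let $\mathrm{Diff}^r_m(M)$ be the set of $C^r$-diffeomorphisms of $M$ preserving $m$, with the $C^r$ topology (uniform convergence on compact sets, in charts, of all derivatives of order at most $r$; of every finite order if $r=\infty$). Let $\mathscr{B}$ be the set of measurable maps $P$ assigning to each $x\in M$ a linear isomorphism $P(x):T_xM\to\mathbb{R}^d$, let $\mathscr{O}\subset\mathscr{B}$ be the set of those for which every $P(x)$ is an isometry (for the Riemannian inner product on $T_xM$ and the Euclidean one on $\mathbb{R}^d$), and let $\mathscr{S}$ be the set of all $P\in\mathscr{B}$ of the form $P(x)=R(x)Q(x)$ with $Q\in\mathscr{O}$ and $R:M\to \mathrm{SL}^{\pm}(d)=\{A\in \mathrm{GL}(d):\det A=\pm1\}$ measurable. For $P\in\mathscr{B}$ and $f\in\mathrm{Diff}^r_m(M)$ put $$J_Pf(x)=P(f(x))\circ Df(x)\circ P(x)^{-1}\in \mathrm{GL}(d),\qquad x\in M.$$ The cocycle $(f,J_Pf)$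 acts on $M\times\mathbb{P}(\mathbb{R}^d)$ by $(x,z)\mapsto (f(x),J_Pf(x)z)$. Then, for every $P\in\mathscr{S}$, the set $\mathcal{R}_P$ of all $f\in\mathrm{Diff}^r_m(M)$ for which there is no Borel probability measure $\nu$ on $\mathbb{P}(\mathbb{R}^d)$ such that $m\times\nu$ is invariant under this action of $(f,J_Pf)$ is open and dense in $\mathrm{Diff}^r_m(M)$. -/

import Mathlib

open Set MeasureTheory Bundle
open scoped Manifold ContDiff ENNReal LinearAlgebra.Projectivization

noncomputable section

/-! # Projective space with its quotient topology and Borel `σ`-algebra -/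

instance projectivizationTopologicalSpace (V : Type*) [NormedAddCommGroup V] [NormedSpace ℝ V] :
    TopologicalSpace (ℙ ℝ V) :=
  inferInstanceAs (TopologicalSpace (Quotient (projectivizationSetoid ℝ V)))

instance projectivizationMeasurableSpace (V : Type*) [NormedAddCommGroup V] [NormedSpace ℝ V] :
    MeasurableSpace (ℙ ℝ V) :=
  borel (ℙ ℝ V)

/-! # The normalized Riemannian volume -/

section Volume

variable {d : ℕ} {M : Type*} [TopologicalSpace M] [ChartedSpace (EuclideanSpace ℝ (Fin d)) M]
  [IsManifold (𝓡 d) ∞ M]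

/-- Smooth Riemannian metrics on the `d`-dimensional manifold `M`. -/
abbrev SmoothRiemannianMetric (d : ℕ) (M : Type*) [TopologicalSpace M]
    [ChartedSpace (EuclideanSpace ℝ (Fin d)) M] [IsManifold (𝓡 d) ∞ M] :=
  ContMDiffRiemannianMetric (𝓡 d) ∞ (EuclideanSpace ℝ (Fin d))
    (fun x : M => TangentSpace (𝓡 d) x)

/-- The `i`-th coordinate vector field `∂ᵢ` of the chart `φ` at `x₀`, at the point with
coordinates `y`, i.e. at `φ⁻¹ y`. -/
def coordVector (x₀ : M) (y : EuclideanSpace ℝ (Fin d)) (i : Fin d) :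
    TangentSpace (𝓡 d) ((chartAt (EuclideanSpace ℝ (Fin d)) x₀).symm y) :=
  mfderiv (𝓡 d) (𝓡 d) (chartAt (EuclideanSpace ℝ (Fin d)) x₀).symm y
    (EuclideanSpace.single i (1 : ℝ))

/-- The matrix `gᵢⱼ = g(∂ᵢ, ∂ⱼ)` of the metric in the chart at `x₀`. -/
def gramMatrix (g : SmoothRiemannianMetric d M) (x₀ : M) (y : EuclideanSpace ℝ (Fin d)) :
    Matrix (Fin d) (Fin d) ℝ :=
  Matrix.of fun i j => g.inner _ (coordVector x₀ y i) (coordVector x₀ y j)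

variable [MeasurableSpace M]

/-- The Riemannian volume of the domain of the chart `φ` at `x₀`, extended by zero to `M`: the image
under `φ⁻¹` of the measure `√(det gᵢⱼ(y)) dy` on the range of `φ`. -/
def chartVolume (g : SmoothRiemannianMetric d M) (x₀ : M) : Measure M :=
  (((volume : Measure (EuclideanSpace ℝ (Fin d))).restrict
      (chartAt (EuclideanSpace ℝ (Fin d)) x₀).target).withDensity
        fun y => ENNReal.ofReal (Real.sqrt (gramMatrix g x₀ y).det)).map
          (chartAt (EuclideanSpace ℝ (Fin d)) x₀).symm

/-- The Riemannian volume of `M`. Any two of the measures `chartVolume g x₀` agree on the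
intersection of the chart domains, so their supremum (in the lattice of measures) is the measure
that restricts to `chartVolume g x₀` on every chart domain. -/
def riemannianVolume (g : SmoothRiemannianMetric d M) : Measure M :=
  ⨆ x₀ : M, chartVolume g x₀

/-- The normalized Riemannian volume `m` (a probability measure if the volume is finite and `M` is
non-empty). -/
def normalizedVolume (g : SmoothRiemannianMetric d M) : Measure M :=
  (riemannianVolume g univ)⁻¹ • riemannianVolume g

end Volume

/-! # Conservative diffeomorphisms and the `C^r` topology -/

section Diffeo

variable {d : ℕ} {M : Type*} [TopologicalSpace M] [ChartedSpace (EuclideanSpace ℝ (Fin d)) M]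
  [IsManifold (𝓡 d) ∞ M] [MeasurableSpace M]

/-- `Diff^r_m(M)`: the `C^r` diffeomorphisms of `M` preserving the normalized volume. -/
def ConservativeDiffeo (r : ℕ∞) (g : SmoothRiemannianMetric d M) : Type _ :=
  {f : M ≃ₘ^(r : WithTop ℕ∞)⟮𝓡 d, 𝓡 d⟯ M //
    MeasurePreserving f (normalizedVolume g) (normalizedVolume g)}

/-- The expression `ψ ∘ f ∘ φ⁻¹` of a map `f` in the charts `φ` at `x` and `ψ` at `y`. -/
def chartExpr (x y : M) (f : M → M) : EuclideanSpace ℝ (Fin d) → EuclideanSpace ℝ (Fin d) :=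
  chartAt (EuclideanSpace ℝ (Fin d)) y ∘ f ∘ (chartAt (EuclideanSpace ℝ (Fin d)) x).symm

/-- The set of all `h` that map `K` into the domain of the chart `ψ` at `y` and whose expression
in the charts `φ` at `x` and `ψ` is `ε`-close to that of `f` on `φ(K)`, with all derivatives of
order at most `k`. -/
def crSubbasic {r : ℕ∞} {g : SmoothRiemannianMetric d M} (f : ConservativeDiffeo r g)
    (x y : M) (K : Set M) (k : ℕ) (ε : ℝ) : Set (ConservativeDiffeo r g) :=
  {h | MapsTo h.1 K (chartAt (EuclideanSpace ℝ (Fin d)) y).source ∧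
    ∀ p ∈ K, ∀ j ≤ k,
      ‖iteratedFDeriv ℝ j (chartExpr x y h.1) (chartAt (EuclideanSpace ℝ (Fin d)) x p) -
        iteratedFDeriv ℝ j (chartExpr x y f.1) (chartAt (EuclideanSpace ℝ (Fin d)) x p)‖ < ε}

/-- The `C^r` topology: uniform convergence on compact sets, in charts, of all derivatives of
order at most `r` (of every finite order if `r = ∞`). -/
instance conservativeDiffeoTopology (r : ℕ∞) (g : SmoothRiemannianMetric d M) :
    TopologicalSpace (ConservativeDiffeo r g) :=
  TopologicalSpace.generateFrom
    {U | ∃ (f : ConservativeDiffeo r g) (x y : M) (K : Set M) (k : ℕ) (ε : ℝ),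
      IsCompact K ∧ K ⊆ (chartAt (EuclideanSpace ℝ (Fin d)) x).source ∧
      MapsTo f.1 K (chartAt (EuclideanSpace ℝ (Fin d)) y).source ∧
      (k : ℕ∞) ≤ r ∧ 0 < ε ∧ U = crSubbasic f x y K k ε}

end Diffeo

/-! # Frame fields and the derivative cocycle read in a frame field -/

section Frames

variable {d : ℕ} {M : Type*} [TopologicalSpace M] [ChartedSpace (EuclideanSpace ℝ (Fin d)) M]
  [IsManifold (𝓡 d) ∞ M]

/-- A (not necessarily measurable) frame field: a linear isomorphism `P x : T_x M → ℝ^d` for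
every `x`. -/
abbrev FrameField (d : ℕ) (M : Type*) [TopologicalSpace M]
    [ChartedSpace (EuclideanSpace ℝ (Fin d)) M] [IsManifold (𝓡 d) ∞ M] :=
  (x : M) → TangentSpace (𝓡 d) x ≃L[ℝ] EuclideanSpace ℝ (Fin d)

/-- The class `𝓑`: frame fields that are Borel measurable as maps `T M → ℝ^d`. -/
def measurableFrames (d : ℕ) (M : Type*) [TopologicalSpace M]
    [ChartedSpace (EuclideanSpace ℝ (Fin d)) M] [IsManifold (𝓡 d) ∞ M] :
    Set (FrameField d M) :=
  {P | @Measurable _ _ (borel (TangentBundle (𝓡 d) M)) _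
    fun v : TangentBundle (𝓡 d) M => P v.proj v.snd}

/-- The class `𝓞`: measurable frame fields that are isometries on every tangent space. -/
def orthonormalFrames (g : SmoothRiemannianMetric d M) : Set (FrameField d M) :=
  {P | P ∈ measurableFrames d M ∧
    ∀ (x : M) (v w : TangentSpace (𝓡 d) x), inner ℝ (P x v) (P x w) = g.inner x v w}

/-- The class `𝓢`: measurable frame fields of the form `P = R Q` with `Q ∈ 𝓞` and a measurable map
`R` from `M` to the group `SL^±(d)` of linear maps of determinant `±1`. -/
def specialFrames [MeasurableSpace M] (g : SmoothRiemannianMetric d M) : Set (FrameField d M) :=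
  {P | P ∈ measurableFrames d M ∧
    ∃ R : M → EuclideanSpace ℝ (Fin d) →L[ℝ] EuclideanSpace ℝ (Fin d),
      Measurable R ∧ (∀ x, (R x).det = 1 ∨ (R x).det = -1) ∧
      ∃ Q ∈ orthonormalFrames g,
        ∀ (x : M) (v : TangentSpace (𝓡 d) x), P x v = R x (Q x v)}

/-- `J_P f (x) = P(f x) ∘ Df(x) ∘ P(x)⁻¹`, an element of `GL(d)`. -/
def frameJacobian {r : ℕ∞} (hr : 1 ≤ r) (P : FrameField d M)
    (f : M ≃ₘ^(r : WithTop ℕ∞)⟮𝓡 d, 𝓡 d⟯ M) (x : M) :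
    EuclideanSpace ℝ (Fin d) ≃L[ℝ] EuclideanSpace ℝ (Fin d) :=
  ((P x).symm.trans (f.mfderivToContinuousLinearEquiv
    (by exact_mod_cast (one_pos.trans_le hr).ne') x)).trans (P (f x))

/-- The skew product `(x, z) ↦ (f x, A(x) z)` on `M × ℙ(ℝ^d)` defined by the cocycle `(f, A)`. -/
def projectiveSkewProduct (f : M → M)
    (A : M → EuclideanSpace ℝ (Fin d) ≃L[ℝ] EuclideanSpace ℝ (Fin d)) :
    M × ℙ ℝ (EuclideanSpace ℝ (Fin d)) → M × ℙ ℝ (EuclideanSpace ℝ (Fin d)) :=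
  fun p => (f p.1, Projectivization.map
    (A p.1 : EuclideanSpace ℝ (Fin d) →ₗ[ℝ] EuclideanSpace ℝ (Fin d)) (A p.1).injective p.2)

/-- The set `𝓡_P` of the `f` in `Diff^r_m(M)` such that the cocycle `(f, J_P f)` has no invariant
measure of the form `m × ν` with `ν` a probability measure on `ℙ(ℝ^d)`. -/
def noProductInvariantMeasure [MeasurableSpace M] {r : ℕ∞} (hr : 1 ≤ r)
    (g : SmoothRiemannianMetric d M) (P : FrameField d M) : Set (ConservativeDiffeo r g) :=
  {f | ¬ ∃ ν : Measure (ℙ ℝ (EuclideanSpace ℝ (Fin d))), IsProbabilityMeasure ν ∧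
    MeasurePreserving (projectiveSkewProduct f.1 (frameJacobian hr P f.1))
      ((normalizedVolume g).prod ν) ((normalizedVolume g).prod ν)}

end Frames

end

/-!
Write `J` for the cocycle `J_P f`. By `notMem_noProductInvariantMeasure_iff`, a diffeomorphism `f`
fails to lie in the set in question exactly if some probability measure `ν` on projective space is
fixed by `J x` for almost every `x`. Everything below is about this condition, and only the
measurability of the frame field `P` matters for it.

*Openness* (`isOpen_noProductInvariantMeasure`). Let `h n → f` in the `C¹` topology, and let `ν n`
be fixed by almost all values of the cocycle of `h n`. By compactness `ν n` converges weakly to some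
`ν` along a subsequence. The frame field is only measurable, but since the maps `h n` preserve the
volume, `P ∘ h n` converges to `P ∘ f` almost everywhere along a further subsequence
(`exists_subseq_ae_tendsto_comp`: approximate `P` by continuous maps). Hence the cocycles converge
almost everywhere, and `ν` is fixed by almost all values of the cocycle of `f`
(`fixesMeasure_of_tendsto`).

*Density* (`dense_noProductInvariantMeasure`). The linear part is a finite game, `Wins`: an opponent
presents invertible maps `g`, one after the other, each of them is composed with an arbitrarily
small rotation in a plane of one's choice, and the aim is that no probability measure on projective space
is fixed by all the resulting maps. The game is won (`wins_univ`). As long as the maps obtained so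
far, normalized to determinant `±1`, preserve a nonzero quadratic form in common, a small rotation
destroys this form. When there is none left, the maps generate an unbounded group, since averaging
over the Haar measure of a compact group gives an invariant form (`exists_invariant_form`).
Furstenberg's argument then shows that all common invariant measures are carried by two proper
subspaces (`exists_carriedBy_of_unbounded`). Finally, small rotations move a finite family of proper
subspaces into general position, so that invariance forces the measures into intersections of lower
and lower dimension, until nothing is left (`wins_carriedBy`).

The moves of the game are realized on the manifold by composing with a rotation that is localized in
a small ball (`exists_twist_family`), in a chart in which the Riemannian volume is Lebesgue measure
(`exists_volume_chart`), so that the composition is conservative; it is `C^r`-close to the original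
diffeomorphism if the angle is small (`tendsto_comp_family`). The derivative is rotated as wanted
only at the centre of the ball, which is a null set, but if the centre is a point of approximate
continuity of the frame and of the cocycle, then a measure fixed by almost all values of the new
cocycle is also fixed by its value at the centre, formally a limit along the filter
`densityFilter` (`fixesMeasure_of_ae_fixesMeasure`). Later moves are made away from the centres of
the earlier ones, and so a won game gives an arbitrarily small perturbation without invariant
product measure (`exists_mem_noProductInvariantMeasure_of_wins`).
-/

noncomputable section

set_option linter.unusedSectionVars false

/-! ### Projective space as a compact metrizable space, and the action of linear maps on it -/

section ProjectiveSpace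

open Filter Topology Function

variable {V : Type*} [NormedAddCommGroup V] [InnerProductSpace ℝ V] [FiniteDimensional ℝ V]

lemma tendsto_clm_comp {ι : Type*} {l : Filter ι} {A B : ι → V →L[ℝ] V} {A₀ B₀ : V →L[ℝ] V}
    (hA : Tendsto A l (𝓝 A₀)) (hB : Tendsto B l (𝓝 B₀)) :
    Tendsto (fun i => A i ∘L B i) l (𝓝 (A₀ ∘L B₀)) := by
  have hc : Continuous (fun q : (V →L[ℝ] V) × (V →L[ℝ] V) => q.1 ∘L q.2) := by fun_prop
  exact (hc.tendsto (A₀, B₀)).comp (hA.prodMk_nhds hB)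

/-- The orthogonal projection onto the line spanned by `u`. -/
def lineProj (u : V) : V →L[ℝ] V := (‖u‖ ^ 2)⁻¹ • (innerSL ℝ u).smulRight u

lemma lineProj_apply (u w : V) : lineProj u w = ((‖u‖ ^ 2)⁻¹ * inner ℝ u w) • u := by
  simp [lineProj, mul_smul]

lemma lineProj_smul {a : ℝ} (ha : a ≠ 0) (u : V) : lineProj (a • u) = lineProj u := by
  ext w
  rw [lineProj_apply, lineProj_apply, smul_smul]
  congr 1
  rw [norm_smul, inner_smul_left]
  rcases eq_or_ne u 0 with rfl | hu
  · simp
  have : ‖u‖ ≠ 0 := norm_ne_zero_iff.2 hu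
  have h3 : ‖a‖ ^ 2 = a ^ 2 := by simp
  simp only [RCLike.conj_to_real, mul_pow, h3]
  field_simp

lemma lineProj_self {u : V} (hu : u ≠ 0) : lineProj u u = u := by
  have : ‖u‖ ≠ 0 := norm_ne_zero_iff.2 hu
  rw [lineProj_apply, real_inner_self_eq_norm_sq, inv_mul_cancel₀ (by positivity), one_smul]

/-- The embedding of projective space into the space of operators, sending a line to the orthogonal
projection onto it. -/
def projEmb (z : ℙ ℝ V) : V →L[ℝ] V := lineProj z.rep

lemma projEmb_mk (u : V) (hu : u ≠ 0) : projEmb (Projectivization.mk ℝ u hu) = lineProj u := by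
  obtain ⟨a, ha⟩ := Projectivization.exists_smul_eq_mk_rep ℝ u hu
  rw [projEmb, ← ha]
  exact lineProj_smul a.ne_zero u

lemma projEmb_injective : Injective (projEmb : ℙ ℝ V → V →L[ℝ] V) := by
  intro z w h
  rw [← z.mk_rep, ← w.mk_rep, Projectivization.mk_eq_mk_iff']
  refine ⟨(‖w.rep‖ ^ 2)⁻¹ * inner ℝ w.rep z.rep, ?_⟩
  rw [← lineProj_apply]
  change projEmb w z.rep = z.rep
  rw [← h]
  exact lineProj_self z.rep_nonzero

lemma continuous_projMk :
    Continuous (fun v : {v : V // v ≠ 0} => Projectivization.mk ℝ v.1 v.2) :=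
  continuous_quotient_mk'

lemma isQuotientMap_projMk :
    IsQuotientMap (fun v : {v : V // v ≠ 0} => Projectivization.mk ℝ v.1 v.2) :=
  isQuotientMap_quotient_mk'

lemma continuous_lineProj : Continuous (fun v : {v : V // v ≠ 0} => lineProj v.1) := by
  have h1 : Continuous (fun v : {v : V // v ≠ 0} => (‖v.1‖ ^ 2)⁻¹) := by
    refine Continuous.inv₀ (by fun_prop) fun v => ?_
    have : ‖v.1‖ ≠ 0 := norm_ne_zero_iff.2 v.2
    positivity
  refine h1.smul ?_
  have h2 : Continuous (fun v : {v : V // v ≠ 0} => innerSL ℝ v.1) :=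
    (innerSL ℝ (E := V)).continuous.comp continuous_subtype_val
  exact ((ContinuousLinearMap.smulRightL ℝ V V).continuous₂).comp
    (h2.prodMk continuous_subtype_val)

lemma continuous_projEmb : Continuous (projEmb : ℙ ℝ V → V →L[ℝ] V) := by
  rw [isQuotientMap_projMk.continuous_iff]
  convert! continuous_lineProj (V := V) using 1
  ext1 v
  exact projEmb_mk v.1 v.2

instance projectivizationT2Space : T2Space (ℙ ℝ V) :=
  T2Space.of_injective_continuous projEmb_injective continuous_projEmb

instance projectivizationCompactSpace : CompactSpace (ℙ ℝ V) := by
  have hS : CompactSpace (Metric.sphere (0 : V) 1) :=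
    isCompact_iff_compactSpace.1 (isCompact_sphere 0 1)
  have hne : ∀ v : Metric.sphere (0 : V) 1, v.1 ≠ 0 := fun v => by
    intro h
    have := v.2
    rw [h] at this
    simp at this
  let q : Metric.sphere (0 : V) 1 → ℙ ℝ V := fun v => Projectivization.mk ℝ v.1 (hne v)
  have hq : Continuous q :=
    continuous_projMk.comp (Continuous.subtype_mk continuous_subtype_val hne)
  have hsurj : Surjective q := by
    intro z
    have hz : ‖z.rep‖ ≠ 0 := norm_ne_zero_iff.2 z.rep_nonzero
    refine ⟨⟨‖z.rep‖⁻¹ • z.rep, ?_⟩, ?_⟩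
    · simp [norm_smul, hz]
    · change Projectivization.mk ℝ _ _ = z
      conv_rhs => rw [← z.mk_rep]
      rw [Projectivization.mk_eq_mk_iff']
      exact ⟨_, rfl⟩
  exact ⟨by rw [← hsurj.range_eq]; exact isCompact_range hq⟩

lemma isClosedEmbedding_projEmb : IsClosedEmbedding (projEmb : ℙ ℝ V → V →L[ℝ] V) :=
  continuous_projEmb.isClosedEmbedding projEmb_injective

instance projectivizationSecondCountable : SecondCountableTopology (ℙ ℝ V) :=
  have : SecondCountableTopology (V →L[ℝ] V) := inferInstance
  isClosedEmbedding_projEmb.isEmbedding.secondCountableTopology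

instance projectivizationMetrizable : TopologicalSpace.MetrizableSpace (ℙ ℝ V) :=
  isClosedEmbedding_projEmb.isEmbedding.metrizableSpace

instance projectivizationBorelSpace : BorelSpace (ℙ ℝ V) := ⟨rfl⟩

/-- The map of projective space induced by a linear map; by convention it is the identity if the
linear map is not injective. -/
def projAct (A : V →L[ℝ] V) (z : ℙ ℝ V) : ℙ ℝ V :=
  open Classical in
  if h : Injective A then Projectivization.map (A : V →ₗ[ℝ] V) h z else z

lemma projAct_mk {A : V →L[ℝ] V} (hA : Injective A) (u : V) (hu : u ≠ 0) :
    projAct A (Projectivization.mk ℝ u hu) =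
      Projectivization.mk ℝ (A u) (by simpa using hA.ne hu) := by
  simp [projAct, hA, Projectivization.map_mk]

lemma projAct_comp {A B : V →L[ℝ] V} (hA : Injective A) (hB : Injective B) (z : ℙ ℝ V) :
    projAct (A ∘L B) z = projAct A (projAct B z) := by
  induction z using Projectivization.ind with
  | h u hu =>
    have hAB : Injective (A ∘L B) := by rw [ContinuousLinearMap.coe_comp]; exact hA.comp hB
    rw [projAct_mk hB, projAct_mk hA, projAct_mk hAB]; rfl

lemma projAct_id (z : ℙ ℝ V) : projAct (ContinuousLinearMap.id ℝ V) z = z := by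
  induction z using Projectivization.ind with
  | h u hu => rw [projAct_mk injective_id]; rfl

lemma projAct_smul {A : V →L[ℝ] V} (hA : Injective A) {c : ℝ} (hc : c ≠ 0) (z : ℙ ℝ V) :
    projAct (c • A) z = projAct A z := by
  have h2 : Injective (c • A) := (smul_right_injective V hc).comp hA
  induction z using Projectivization.ind with
  | h u hu =>
    rw [projAct_mk hA, projAct_mk h2, Projectivization.mk_eq_mk_iff']
    exact ⟨c, rfl⟩

lemma norm_comp_lineProj (A : V →L[ℝ] V) {u : V} (hu : u ≠ 0) :
    ‖A ∘L lineProj u‖ = ‖A u‖ / ‖u‖ := by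
  have h : A ∘L lineProj u = (‖u‖ ^ 2)⁻¹ • (innerSL ℝ u).smulRight (A u) := by
    ext w; simp [lineProj]
  have h0 : ‖u‖ ≠ 0 := norm_ne_zero_iff.2 hu
  rw [h, norm_smul, ContinuousLinearMap.norm_smulRight_apply, innerSL_apply_norm, norm_inv,
    norm_pow, norm_norm]
  field_simp

lemma projEmb_projAct {A : V →L[ℝ] V} (hA : Injective A) (z : ℙ ℝ V) :
    projEmb (projAct A z) =
      (‖A ∘L projEmb z‖ ^ 2)⁻¹ • (A ∘L projEmb z ∘L ContinuousLinearMap.adjoint A) := by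
  induction z using Projectivization.ind with
  | h u hu =>
    rw [projAct_mk hA, projEmb_mk, projEmb_mk, norm_comp_lineProj A hu]
    have h0 : ‖u‖ ≠ 0 := norm_ne_zero_iff.2 hu
    ext1 w
    simp only [lineProj_apply, smul_apply, ContinuousLinearMap.comp_apply,
      map_smul, smul_smul, ContinuousLinearMap.adjoint_inner_right]
    congr 1
    field_simp

lemma comp_projEmb_ne_zero {A : V →L[ℝ] V} (hA : Injective A) (z : ℙ ℝ V) :
    ‖A ∘L projEmb z‖ ^ 2 ≠ 0 := by
  have h : A z.rep ≠ 0 := by simpa using hA.ne z.rep_nonzero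
  have := norm_comp_lineProj A z.rep_nonzero
  rw [projEmb, this]
  have h1 : ‖z.rep‖ ≠ 0 := norm_ne_zero_iff.2 z.rep_nonzero
  have h2 : ‖A z.rep‖ ≠ 0 := norm_ne_zero_iff.2 h
  positivity

lemma isOpen_injective : IsOpen {A : V →L[ℝ] V | Injective A} :=
  ContinuousLinearMap.isOpen_injective

/-- The action on projective space is jointly continuous at the injective linear maps. -/
lemma tendsto_projAct {ι : Type*} {l : Filter ι} {A : ι → V →L[ℝ] V} {A₀ : V →L[ℝ] V}
    {z : ι → ℙ ℝ V} {z₀ : ℙ ℝ V} (hA₀ : Injective A₀) (hA : Tendsto A l (𝓝 A₀))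
    (hz : Tendsto z l (𝓝 z₀)) :
    Tendsto (fun i => projAct (A i) (z i)) l (𝓝 (projAct A₀ z₀)) := by
  rw [isClosedEmbedding_projEmb.isEmbedding.tendsto_nhds_iff]
  have hev : ∀ᶠ i in l, Injective (A i) := hA.eventually (isOpen_injective.mem_nhds hA₀)
  have hz' : Tendsto (fun i => projEmb (z i)) l (𝓝 (projEmb z₀)) :=
    (continuous_projEmb.tendsto z₀).comp hz
  have hcomp : Tendsto (fun i => A i ∘L projEmb (z i)) l (𝓝 (A₀ ∘L projEmb z₀)) :=
    tendsto_clm_comp hA hz'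
  have hadj : Tendsto (fun i => ContinuousLinearMap.adjoint (A i)) l
      (𝓝 (ContinuousLinearMap.adjoint A₀)) :=
    ((ContinuousLinearMap.adjoint (𝕜 := ℝ) (E := V) (F := V)).continuous.tendsto A₀).comp hA
  have h := ((hcomp.norm.pow 2).inv₀ (comp_projEmb_ne_zero hA₀ z₀)).smul
    (tendsto_clm_comp hA (tendsto_clm_comp hz' hadj))
  rw [← projEmb_projAct hA₀] at h
  refine h.congr' ?_
  filter_upwards [hev] with i hi
  exact (projEmb_projAct hi _).symm

lemma continuous_projAct (A : V →L[ℝ] V) : Continuous (projAct A) := by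
  by_cases hA : Injective A
  · exact continuous_iff_continuousAt.2 fun z => tendsto_projAct hA tendsto_const_nhds tendsto_id
  · have : projAct A = id := by ext1 z; simp [projAct, hA]
    rw [this]; exact continuous_id

lemma measurable_projAct (A : V →L[ℝ] V) : Measurable (projAct A) :=
  (continuous_projAct A).measurable

/-- Joint measurability of the action for a measurable family of injective linear maps. -/
lemma measurable_projAct_prod {X : Type*} [MeasurableSpace X] {A : X → V →L[ℝ] V}
    (hA : Measurable A) (hinj : ∀ x, Injective (A x)) :
    Measurable (fun p : X × ℙ ℝ V => projAct (A p.1) p.2) := by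
  rw [← isClosedEmbedding_projEmb.measurableEmbedding.measurable_comp_iff]
  have h1 : Measurable (fun p : X × ℙ ℝ V => A p.1) := hA.comp measurable_fst
  have h2 : Measurable (fun p : X × ℙ ℝ V => projEmb p.2) :=
    continuous_projEmb.measurable.comp measurable_snd
  have hc : Continuous (fun q : (V →L[ℝ] V) × (V →L[ℝ] V) => q.1 ∘L q.2) := by fun_prop
  have hc' : Continuous (fun q : (V →L[ℝ] V) × (V →L[ℝ] V) =>
      q.1 ∘L q.2 ∘L ContinuousLinearMap.adjoint q.1) := by
    have := (ContinuousLinearMap.adjoint (𝕜 := ℝ) (E := V) (F := V)).continuous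
    fun_prop
  have h3 := hc.measurable.comp (h1.prodMk h2)
  have h4 := hc'.measurable.comp (h1.prodMk h2)
  have h5 : Measurable (fun p : X × ℙ ℝ V => (‖A p.1 ∘L projEmb p.2‖ ^ 2)⁻¹ •
      (A p.1 ∘L projEmb p.2 ∘L ContinuousLinearMap.adjoint (A p.1))) :=
    ((h3.norm.pow_const 2).inv).smul h4
  convert! h5 using 1
  ext1 p
  exact projEmb_projAct (hinj p.1) p.2

/-! ### Measures on projective space fixed by a linear map -/

/-- The measure `ν` on projective space is invariant under the action of `A`. -/
def FixesMeasure (A : V →L[ℝ] V) (ν : Measure (ℙ ℝ V)) : Prop := ν.map (projAct A) = ν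

lemma FixesMeasure.integral_eq {A : V →L[ℝ] V} {ν : Measure (ℙ ℝ V)} (h : FixesMeasure A ν)
    {φ : ℙ ℝ V → ℝ} (hφ : Continuous φ) : ∫ z, φ (projAct A z) ∂ν = ∫ z, φ z ∂ν := by
  conv_rhs => rw [← h]
  rw [integral_map (measurable_projAct A).aemeasurable hφ.aestronglyMeasurable]

lemma fixesMeasure_of_forall_integral {A : V →L[ℝ] V} {ν : Measure (ℙ ℝ V)} [IsFiniteMeasure ν]
    (h : ∀ φ : C(ℙ ℝ V, ℝ), ∫ z, φ (projAct A z) ∂ν = ∫ z, φ z ∂ν) : FixesMeasure A ν := by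
  refine ext_of_forall_integral_eq_of_IsFiniteMeasure fun φ => ?_
  rw [integral_map (measurable_projAct A).aemeasurable φ.continuous.aestronglyMeasurable]
  exact h φ.toContinuousMap

/-- If linear maps `A i` fixing `ν i` converge to an injective linear map `A₀`, and the measures
converge weakly to `ν₀`, then `A₀` fixes `ν₀`. -/
lemma fixesMeasure_of_tendsto {ι : Type*} {l : Filter ι} [l.NeBot] {A : ι → V →L[ℝ] V}
    {A₀ : V →L[ℝ] V} (hA₀ : Injective A₀) (hA : Tendsto A l (𝓝 A₀))
    {ν : ι → ProbabilityMeasure (ℙ ℝ V)} {ν₀ : ProbabilityMeasure (ℙ ℝ V)}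
    (hν : Tendsto ν l (𝓝 ν₀)) (hfix : ∀ i, FixesMeasure (A i) (ν i : Measure (ℙ ℝ V))) :
    FixesMeasure A₀ (ν₀ : Measure (ℙ ℝ V)) := by
  refine fixesMeasure_of_forall_integral fun φ => ?_
  have hunif : TendstoUniformly (fun i z => φ (projAct (A i) z)) (fun z => φ (projAct A₀ z)) l := by
    rw [← tendstoLocallyUniformly_iff_tendstoUniformly_of_compactSpace,
      tendstoLocallyUniformly_iff_forall_tendsto]
    intro z
    have h1 : Tendsto (fun p : ι × ℙ ℝ V => projAct (A p.1) p.2) (l ×ˢ 𝓝 z)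
        (𝓝 (projAct A₀ z)) := tendsto_projAct hA₀ (hA.comp tendsto_fst) tendsto_snd
    have h2 : Tendsto (fun p : ι × ℙ ℝ V => projAct A₀ p.2) (l ×ˢ 𝓝 z)
        (𝓝 (projAct A₀ z)) := tendsto_projAct hA₀ tendsto_const_nhds tendsto_snd
    have h3 := ((φ.continuous.tendsto _).comp h2).prodMk_nhds ((φ.continuous.tendsto _).comp h1)
    exact h3.mono_right (nhds_le_uniformity _)
  have hlim : ∀ ψ : C(ℙ ℝ V, ℝ), Tendsto (fun i => ∫ z, ψ z ∂(ν i : Measure (ℙ ℝ V))) l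
      (𝓝 (∫ z, ψ z ∂(ν₀ : Measure (ℙ ℝ V)))) := fun ψ =>
    (ProbabilityMeasure.tendsto_iff_forall_integral_tendsto.1 hν)
      (BoundedContinuousFunction.mkOfCompact ψ)
  have hdiff : Tendsto (fun i => ∫ z, φ (projAct (A i) z) ∂(ν i : Measure (ℙ ℝ V)) -
      ∫ z, φ (projAct A₀ z) ∂(ν i : Measure (ℙ ℝ V))) l (𝓝 0) := by
    rw [Metric.tendsto_nhds]
    intro ε hε
    filter_upwards [Metric.tendstoUniformly_iff.1 hunif (ε / 2) (half_pos hε)] with i hi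
    have hint : ∀ B : V →L[ℝ] V, Integrable (fun z => φ (projAct B z))
        (ν i : Measure (ℙ ℝ V)) := fun B =>
      ((φ.continuous.comp (continuous_projAct B)).integrable_of_hasCompactSupport
        (HasCompactSupport.of_compactSpace _))
    rw [dist_zero_right, ← integral_sub (hint _) (hint _)]
    refine (norm_integral_le_of_norm_le_const (C := ε / 2) ?_).trans_lt ?_
    · refine ae_of_all _ fun z => ?_
      have := (hi z).le
      rwa [dist_comm, dist_eq_norm] at this
    · simp; linarith
  have h1 := hlim φ
  have h2 := hlim ⟨fun z => φ (projAct A₀ z), φ.continuous.comp (continuous_projAct A₀)⟩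
  have h3 := hdiff.add h2
  simp only [ContinuousMap.coe_mk, sub_add_cancel, zero_add] at h3
  refine tendsto_nhds_unique h3 (h1.congr fun i => ?_)
  exact ((hfix i).integral_eq φ.continuous).symm

lemma FixesMeasure.comp {A B : V →L[ℝ] V} {ν : Measure (ℙ ℝ V)} (hA : Injective A)
    (hB : Injective B) (h1 : FixesMeasure A ν) (h2 : FixesMeasure B ν) :
    FixesMeasure (A ∘L B) ν := by
  have : projAct (A ∘L B) = projAct A ∘ projAct B := by ext1 z; exact projAct_comp hA hB z
  rw [FixesMeasure, this, ← Measure.map_map (measurable_projAct A) (measurable_projAct B), h2, h1]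

lemma FixesMeasure.of_comp_eq_id {A B : V →L[ℝ] V} {ν : Measure (ℙ ℝ V)} (hA : Injective A)
    (hB : Injective B) (hAB : B ∘L A = ContinuousLinearMap.id ℝ V) (h1 : FixesMeasure A ν) :
    FixesMeasure B ν := by
  have : projAct B ∘ projAct A = id := by
    ext1 z; rw [comp_apply, ← projAct_comp hB hA, hAB, projAct_id]; rfl
  rw [FixesMeasure]
  conv_lhs => rw [← h1]
  rw [Measure.map_map (measurable_projAct B) (measurable_projAct A), this, Measure.map_id]

end ProjectiveSpace

/-! ### Rotations in a coordinate plane -/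

section PlaneRotation

open Filter Topology Function

variable {d : ℕ}

/-- The infinitesimal rotation `eᵢ ↦ eⱼ`, `eⱼ ↦ -eᵢ` in the `i`-`j` coordinate plane. -/
def planeJ (i j : Fin d) : EuclideanSpace ℝ (Fin d) →L[ℝ] EuclideanSpace ℝ (Fin d) :=
  (EuclideanSpace.proj i : EuclideanSpace ℝ (Fin d) →L[ℝ] ℝ).smulRight
      (EuclideanSpace.single j (1 : ℝ)) -
    (EuclideanSpace.proj j : EuclideanSpace ℝ (Fin d) →L[ℝ] ℝ).smulRight
      (EuclideanSpace.single i (1 : ℝ))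

/-- The orthogonal projection onto the `i`-`j` coordinate plane. -/
def planeProj (i j : Fin d) : EuclideanSpace ℝ (Fin d) →L[ℝ] EuclideanSpace ℝ (Fin d) :=
  (EuclideanSpace.proj i : EuclideanSpace ℝ (Fin d) →L[ℝ] ℝ).smulRight
      (EuclideanSpace.single i (1 : ℝ)) +
    (EuclideanSpace.proj j : EuclideanSpace ℝ (Fin d) →L[ℝ] ℝ).smulRight
      (EuclideanSpace.single j (1 : ℝ))

/-- The rotation by the angle `θ` in the `i`-`j` coordinate plane. -/
def planeRot (i j : Fin d) (θ : ℝ) : EuclideanSpace ℝ (Fin d) →L[ℝ] EuclideanSpace ℝ (Fin d) :=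
  ContinuousLinearMap.id ℝ _ + (Real.cos θ - 1) • planeProj i j + Real.sin θ • planeJ i j

lemma planeJ_apply (i j : Fin d) (u : EuclideanSpace ℝ (Fin d)) :
    planeJ i j u = u i • EuclideanSpace.single j (1 : ℝ) -
      u j • EuclideanSpace.single i (1 : ℝ) := rfl

lemma planeProj_apply (i j : Fin d) (u : EuclideanSpace ℝ (Fin d)) :
    planeProj i j u = u i • EuclideanSpace.single i (1 : ℝ) +
      u j • EuclideanSpace.single j (1 : ℝ) := rfl

lemma planeRot_apply (i j : Fin d) (θ : ℝ) (u : EuclideanSpace ℝ (Fin d)) :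
    planeRot i j θ u = u + (Real.cos θ - 1) • planeProj i j u + Real.sin θ • planeJ i j u := rfl

lemma planeRot_zero (i j : Fin d) : planeRot i j 0 = ContinuousLinearMap.id ℝ _ := by
  ext1 u
  simp [planeRot_apply]

variable {i j : Fin d}

lemma planeJ_planeJ (hij : i ≠ j) (u : EuclideanSpace ℝ (Fin d)) :
    planeJ i j (planeJ i j u) = -planeProj i j u := by
  simp [planeJ_apply, planeProj_apply, hij, hij.symm]
  abel

lemma planeJ_planeProj (hij : i ≠ j) (u : EuclideanSpace ℝ (Fin d)) :
    planeJ i j (planeProj i j u) = planeJ i j u := by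
  simp [planeJ_apply, planeProj_apply, hij, hij.symm]

lemma planeProj_planeJ (hij : i ≠ j) (u : EuclideanSpace ℝ (Fin d)) :
    planeProj i j (planeJ i j u) = planeJ i j u := by
  simp [planeJ_apply, planeProj_apply, hij, hij.symm]
  abel

lemma planeProj_planeProj (hij : i ≠ j) (u : EuclideanSpace ℝ (Fin d)) :
    planeProj i j (planeProj i j u) = planeProj i j u := by
  simp [planeProj_apply, hij, hij.symm]

lemma inner_planeJ_self (u : EuclideanSpace ℝ (Fin d)) : inner ℝ u (planeJ i j u) = 0 := by
  simp [planeJ_apply, inner_sub_right, inner_smul_right, EuclideanSpace.inner_single_right]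
  ring

lemma inner_planeProj_planeJ (hij : i ≠ j) (u : EuclideanSpace ℝ (Fin d)) :
    inner ℝ (planeProj i j u) (planeJ i j u) = 0 := by
  rw [← planeJ_planeProj hij u, inner_planeJ_self]

lemma planeRot_planeRot (hij : i ≠ j) (a b : ℝ) (u : EuclideanSpace ℝ (Fin d)) :
    planeRot i j a (planeRot i j b u) = planeRot i j (a + b) u := by
  simp only [planeRot_apply, map_add, map_smul, planeJ_planeJ hij, planeJ_planeProj hij,
    planeProj_planeJ hij, planeProj_planeProj hij, Real.cos_add, Real.sin_add]
  module

lemma norm_planeRot (hij : i ≠ j) (a : ℝ) (u : EuclideanSpace ℝ (Fin d)) :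
    ‖planeRot i j a u‖ = ‖u‖ := by
  have h1 : inner ℝ u (planeProj i j u) = u i ^ 2 + u j ^ 2 := by
    simp [planeProj_apply, inner_add_right, inner_smul_right, EuclideanSpace.inner_single_right]
    ring
  have h2 : inner ℝ (planeProj i j u) (planeProj i j u) = u i ^ 2 + u j ^ 2 := by
    conv_lhs => rw [planeProj_apply i j u, inner_add_right, inner_smul_right, inner_smul_right,
      EuclideanSpace.inner_single_right, EuclideanSpace.inner_single_right]
    simp [hij, hij.symm]
    ring
  have h3 : inner ℝ (planeJ i j u) (planeJ i j u) = u i ^ 2 + u j ^ 2 := by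
    conv_lhs => rw [planeJ_apply i j u, inner_sub_right, inner_smul_right, inner_smul_right,
      EuclideanSpace.inner_single_right, EuclideanSpace.inner_single_right]
    simp [hij, hij.symm]
    ring
  have h4 := inner_planeJ_self (i := i) (j := j) u
  have h5 := inner_planeProj_planeJ hij u
  have h : inner ℝ (planeRot i j a u) (planeRot i j a u) = inner ℝ u u := by
    rw [planeRot_apply]
    simp only [inner_add_left, inner_add_right, inner_smul_left, inner_smul_right,
      RCLike.conj_to_real, h1, h2, h3, h4, h5, real_inner_comm u (planeProj i j u),
      real_inner_comm u (planeJ i j u), real_inner_comm (planeProj i j u) (planeJ i j u)]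
    have := Real.sin_sq_add_cos_sq a
    linear_combination (u i ^ 2 + u j ^ 2) * this
  rw [real_inner_self_eq_norm_sq, real_inner_self_eq_norm_sq] at h
  exact (sq_eq_sq₀ (norm_nonneg _) (norm_nonneg _)).1 h

/-- The rotation in a coordinate plane as a continuous linear equivalence. -/
def planeRotEquiv (hij : i ≠ j) (a : ℝ) :
    EuclideanSpace ℝ (Fin d) ≃L[ℝ] EuclideanSpace ℝ (Fin d) :=
  ContinuousLinearEquiv.equivOfInverse (planeRot i j a) (planeRot i j (-a))
    (fun u => by rw [planeRot_planeRot hij, neg_add_cancel, planeRot_zero]; rfl)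
    (fun u => by rw [planeRot_planeRot hij, add_neg_cancel, planeRot_zero]; rfl)

lemma abs_det_planeRot (hij : i ≠ j) (a : ℝ) : |(planeRot i j a).det| = 1 := by
  let f : EuclideanSpace ℝ (Fin d) →ₗᵢ[ℝ] EuclideanSpace ℝ (Fin d) :=
    ⟨(planeRot i j a : EuclideanSpace ℝ (Fin d) →ₗ[ℝ] EuclideanSpace ℝ (Fin d)),
      norm_planeRot hij a⟩
  have := LinearMap.normDet_eq_norm_det (planeRot i j a).toLinearMap
  rw [← Real.norm_eq_abs, ContinuousLinearMap.det, ← this]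
  exact LinearIsometry.normDet_eq_one f

/-- The rotation by `t` in the plane spanned by the images of `eᵢ` and `eⱼ` under `S`. -/
def conjRot (hij : i ≠ j) (S : EuclideanSpace ℝ (Fin d) ≃L[ℝ] EuclideanSpace ℝ (Fin d)) (t : ℝ) :
    EuclideanSpace ℝ (Fin d) ≃L[ℝ] EuclideanSpace ℝ (Fin d) :=
  (S.symm.trans (planeRotEquiv hij t)).trans S

lemma conjRot_apply (hij : i ≠ j) (S : EuclideanSpace ℝ (Fin d) ≃L[ℝ] EuclideanSpace ℝ (Fin d))
    (t : ℝ) (u : EuclideanSpace ℝ (Fin d)) :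
    conjRot hij S t u = S (planeRot i j t (S.symm u)) := rfl

lemma conjRot_apply_fst (hij : i ≠ j)
    (S : EuclideanSpace ℝ (Fin d) ≃L[ℝ] EuclideanSpace ℝ (Fin d)) (t : ℝ) :
    conjRot hij S t (S (EuclideanSpace.single i (1 : ℝ))) =
      Real.cos t • S (EuclideanSpace.single i (1 : ℝ)) +
        Real.sin t • S (EuclideanSpace.single j (1 : ℝ)) := by
  rw [conjRot_apply, S.symm_apply_apply, ← map_smul, ← map_smul, ← map_add]
  congr 1
  simp [planeRot_apply, planeProj_apply, planeJ_apply, hij.symm]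
  module

lemma conjRot_zero (hij : i ≠ j) (S : EuclideanSpace ℝ (Fin d) ≃L[ℝ] EuclideanSpace ℝ (Fin d)) :
    conjRot hij S 0 = ContinuousLinearEquiv.refl ℝ _ := by
  refine ContinuousLinearEquiv.ext (funext fun u => ?_)
  rw [conjRot_apply, planeRot_zero]
  simp

lemma abs_det_conjRot (hij : i ≠ j)
    (S : EuclideanSpace ℝ (Fin d) ≃L[ℝ] EuclideanSpace ℝ (Fin d)) (t : ℝ) :
    |(conjRot hij S t : EuclideanSpace ℝ (Fin d) →L[ℝ] EuclideanSpace ℝ (Fin d)).det| = 1 := by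
  have h : ((conjRot hij S t : EuclideanSpace ℝ (Fin d) →L[ℝ] EuclideanSpace ℝ (Fin d)) :
      EuclideanSpace ℝ (Fin d) →ₗ[ℝ] EuclideanSpace ℝ (Fin d)) =
      S.toLinearEquiv.toLinearMap ∘ₗ (planeRot i j t).toLinearMap ∘ₗ
        S.toLinearEquiv.symm.toLinearMap := rfl
  rw [ContinuousLinearMap.det, h, LinearMap.det_conj]
  exact abs_det_planeRot hij t

/-- Two linearly independent vectors are the images of `eᵢ` and `eⱼ` under some invertible linear
map. -/
lemma exists_equiv_map_pair (hij : i ≠ j) {u w : EuclideanSpace ℝ (Fin d)}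
    (huw : LinearIndependent ℝ ![u, w]) :
    ∃ S : EuclideanSpace ℝ (Fin d) ≃L[ℝ] EuclideanSpace ℝ (Fin d),
      S (EuclideanSpace.single i (1 : ℝ)) = u ∧ S (EuclideanSpace.single j (1 : ℝ)) = w := by
  set v : Fin 2 → EuclideanSpace ℝ (Fin d) :=
    ![EuclideanSpace.single i (1 : ℝ), EuclideanSpace.single j (1 : ℝ)] with hv
  have hD : LinearIndependent ℝ v := by
    rw [hv, LinearIndependent.pair_iff]
    intro s t h
    have h1 := congrArg (fun x : EuclideanSpace ℝ (Fin d) => x i) h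
    have h2 := congrArg (fun x : EuclideanSpace ℝ (Fin d) => x j) h
    simp [hij, hij.symm] at h1 h2
    exact ⟨h1, h2⟩
  let f := hD.linearCombinationEquiv.symm ≪≫ₗ huw.linearCombinationEquiv
  obtain ⟨g, hg⟩ := Submodule.exists_linearEquiv_restrict_eq f
  have h0 : hD.linearCombinationEquiv (Finsupp.single 0 1) =
      EuclideanSpace.single i (1 : ℝ) := by simp [hv]
  have h1 : hD.linearCombinationEquiv (Finsupp.single 1 1) =
      EuclideanSpace.single j (1 : ℝ) := by simp [hv]
  refine ⟨g.toContinuousLinearEquiv, ?_, ?_⟩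
  · change g _ = _
    rw [← h0, ← hg]; simp [f]
  · change g _ = _
    rw [← h1, ← hg]; simp [f]

/-- A quadratic form invariant under all small rotations in all planes, for arbitrary Euclidean
structures, vanishes. -/
lemma eq_zero_of_forall_conjRot_invariant (hij : i ≠ j)
    {T : EuclideanSpace ℝ (Fin d) →L[ℝ] EuclideanSpace ℝ (Fin d)}
    (hT : ContinuousLinearMap.adjoint T = T)
    (h : ∀ S : EuclideanSpace ℝ (Fin d) ≃L[ℝ] EuclideanSpace ℝ (Fin d), ∃ ε > 0, ∀ t, |t| < ε →
      ContinuousLinearMap.adjoint (conjRot hij S t : _ →L[ℝ] _) ∘L T ∘L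
        (conjRot hij S t : _ →L[ℝ] _) = T) : T = 0 := by
  have hsymm : ∀ u w, inner ℝ (T u) w = inner ℝ (T w) u := fun u w => by
    rw [real_inner_comm]
    conv_lhs => rw [← hT]
    rw [ContinuousLinearMap.adjoint_inner_right]
  have key : ∀ u w : EuclideanSpace ℝ (Fin d), LinearIndependent ℝ ![u, w] →
      inner ℝ (T u) u = inner ℝ (T w) w := by
    intro u w huw
    obtain ⟨S, hu, hw⟩ := exists_equiv_map_pair hij huw
    obtain ⟨ε, hε, hS⟩ := h S
    have h1 : ∀ t, |t| < ε → inner ℝ (T (Real.cos t • u + Real.sin t • w))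
        (Real.cos t • u + Real.sin t • w) = inner ℝ (T u) u := by
      intro t ht
      have := congrArg (fun A => inner ℝ (A u) u) (hS t ht)
      simp only [ContinuousLinearMap.comp_apply, ContinuousLinearMap.adjoint_inner_left] at this
      rw [← hu, ContinuousLinearEquiv.coe_coe, conjRot_apply_fst, hu, hw] at this
      exact this
    -- the invariance under the rotations by `t` and `-t` eliminates the mixed term `⟪T u, w⟫`
    set t := min (ε / 2) 1 with ht
    have ht0 : 0 < t := by positivity
    have ht1 : t ≤ 1 := min_le_right _ _
    have htε : t < ε := (min_le_left _ _).trans_lt (by linarith)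
    have h2 := h1 t (by rwa [abs_of_pos ht0])
    have h3 := h1 (-t) (by rwa [abs_neg, abs_of_pos ht0])
    simp only [Real.cos_neg, Real.sin_neg, map_add, map_smul, inner_add_left, inner_add_right,
      inner_smul_left, inner_smul_right, RCLike.conj_to_real, hsymm w u] at h2 h3
    have hs : 0 < Real.sin t := Real.sin_pos_of_pos_of_lt_pi ht0 (by linarith [Real.pi_gt_three])
    have h5 := Real.sin_sq_add_cos_sq t
    have : Real.sin t ^ 2 * (inner ℝ (T w) w - inner ℝ (T u) u) = 0 := by
      linear_combination (h2 + h3) / 2 - inner ℝ (T u) u * h5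
    rcases mul_eq_zero.1 this with h6 | h6
    · exact absurd h6 (by positivity)
    · linarith
  have hzero : ∀ u, inner ℝ (T u) u = (0 : ℝ) := by
    intro u
    by_cases hu : u = 0
    · simp [hu]
    have hexi : ∃ w, LinearIndependent ℝ ![u, w] := by
      apply exists_linearIndependent_pair_of_one_lt_finrank _ hu
      have h1 : (1 : ℕ) < d := by
        have := i.2; have := j.2
        have : (i : ℕ) ≠ j := fun h => hij (Fin.ext h)
        omega
      simpa using h1
    obtain ⟨w, hw⟩ := hexi
    -- the form takes the same value at `u`, at `w` and at `2 • w`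
    have h1 := key u w hw
    have h2 : LinearIndependent ℝ ![u, (2 : ℝ) • w] := by
      rw [LinearIndependent.pair_iff] at hw ⊢
      intro s t hst
      have := hw s (t * 2) (by rw [mul_smul]; exact hst)
      exact ⟨this.1, by linarith [this.2]⟩
    have h3 := key u _ h2
    simp only [map_smul, inner_smul_left, inner_smul_right, RCLike.conj_to_real] at h3
    linarith
  ext1 u
  refine ext_inner_right ℝ fun w => ?_
  have h1 := hzero (u + w)
  simp only [map_add, inner_add_left, inner_add_right, hzero, hsymm w u] at h1
  simp only [zero_apply, inner_zero_left]
  linarith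

end PlaneRotation

/-! ### Bounded groups of linear maps preserve a quadratic form -/

section Averaging

open Filter Topology Function

variable {V : Type*} [NormedAddCommGroup V] [InnerProductSpace ℝ V] [FiniteDimensional ℝ V]

/-- The unit group is closed in the product by the equations `a * b = 1` and `b * a = 1`, so that
its closed subsets on which the norms of `u` and of `u⁻¹` are bounded are compact. -/
lemma isClosedEmbedding_embedProduct :
    IsClosedEmbedding (Units.embedProduct (V →L[ℝ] V)) := by
  refine ⟨Units.isEmbedding_embedProduct, ?_⟩
  have : range (Units.embedProduct (V →L[ℝ] V)) =
      {p | p.1 * p.2.unop = 1} ∩ {p | p.2.unop * p.1 = 1} := by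
    ext p
    constructor
    · rintro ⟨u, rfl⟩
      simp
    · rintro ⟨h1, h2⟩
      exact ⟨⟨p.1, p.2.unop, h1, h2⟩, rfl⟩
  rw [this]
  refine IsClosed.inter (isClosed_eq ?_ continuous_const) (isClosed_eq ?_ continuous_const)
  · exact continuous_fst.mul (MulOpposite.continuous_unop.comp continuous_snd)
  · exact (MulOpposite.continuous_unop.comp continuous_snd).mul continuous_fst

/-- The closure of a norm-bounded group of linear maps is compact, and averaging the standard inner
product over it gives an invariant quadratic form. -/
lemma exists_invariant_form [Nontrivial V] (Γ : Subgroup (V →L[ℝ] V)ˣ) (C : ℝ)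
    (hC : ∀ u ∈ Γ, ‖(u : V →L[ℝ] V)‖ ≤ C) :
    ∃ T : V →L[ℝ] V, ContinuousLinearMap.adjoint T = T ∧ T ≠ 0 ∧
      ∀ u ∈ Γ, ContinuousLinearMap.adjoint (u : V →L[ℝ] V) ∘L T ∘L (u : V →L[ℝ] V) = T := by
  set K := Γ.topologicalClosure
  have hKC : ∀ u ∈ K, ‖(u : V →L[ℝ] V)‖ ≤ C := by
    have hcl : IsClosed {u : (V →L[ℝ] V)ˣ | ‖(u : V →L[ℝ] V)‖ ≤ C} :=
      isClosed_le (Units.continuous_val.norm) continuous_const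
    intro u hu
    exact closure_minimal (s := (Γ : Set (V →L[ℝ] V)ˣ)) hC hcl hu
  have hKcomp : IsCompact (K : Set (V →L[ℝ] V)ˣ) := by
    have h1 : IsCompact ((Metric.closedBall (0 : V →L[ℝ] V) C) ×ˢ
        (MulOpposite.op '' Metric.closedBall (0 : V →L[ℝ] V) C)) :=
      (isCompact_closedBall _ _).prod
        ((isCompact_closedBall _ _).image MulOpposite.continuous_op)
    refine (isClosedEmbedding_embedProduct.isCompact_preimage h1).of_isClosed_subset
      Γ.isClosed_topologicalClosure fun u hu => ?_
    refine ⟨by simpa using hKC u hu, ⟨(u⁻¹ : (V →L[ℝ] V)ˣ), ?_, rfl⟩⟩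
    simpa using hKC _ (inv_mem hu)
  have : CompactSpace K := isCompact_iff_compactSpace.1 hKcomp
  let _ : MeasurableSpace K := borel K
  have : BorelSpace K := ⟨rfl⟩
  let μ : Measure K := Measure.haarMeasure ⊤
  have hμ : IsFiniteMeasure μ := CompactSpace.isFiniteMeasure
  have hadj := (ContinuousLinearMap.adjoint (𝕜 := ℝ) (E := V) (F := V)).continuous
  -- the pullback of the standard inner product by `k⁻¹`; its average is invariant because pulling
  -- back by `u` amounts to replacing `k` by `u⁻¹ * k`
  let F : K → V →L[ℝ] V := fun k =>
    ContinuousLinearMap.adjoint ((k⁻¹ : K) : (V →L[ℝ] V)ˣ).1 ∘L ((k⁻¹ : K) : (V →L[ℝ] V)ˣ).1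
  have hval : Continuous (fun k : K => ((k⁻¹ : K) : (V →L[ℝ] V)ˣ).1) :=
    Units.continuous_val.comp (continuous_subtype_val.comp continuous_inv)
  have hFc : Continuous F := by
    have hc : Continuous (fun q : (V →L[ℝ] V) × (V →L[ℝ] V) => q.1 ∘L q.2) := by fun_prop
    exact hc.comp ((hadj.comp hval).prodMk hval)
  have hFi : Integrable F μ := hFc.integrable_of_hasCompactSupport
    (HasCompactSupport.of_compactSpace _)
  refine ⟨∫ k, F k ∂μ, ?_, ?_, ?_⟩
  · have h := ((ContinuousLinearMap.adjoint (𝕜 := ℝ) (E := V) (F := V)).toContinuousLinearEquiv :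
      (V →L[ℝ] V) ≃L[ℝ] (V →L[ℝ] V)).toContinuousLinearMap.integral_comp_comm hFi
    change _ = ContinuousLinearMap.adjoint (∫ k, F k ∂μ) at h
    rw [← h]
    congr 1
    ext1 k
    change ContinuousLinearMap.adjoint (F k) = F k
    simp only [F, ContinuousLinearMap.adjoint_comp, ContinuousLinearMap.adjoint_adjoint]
  · intro h0
    obtain ⟨v, hv⟩ := exists_ne (0 : V)
    let ev : (V →L[ℝ] V) →L[ℝ] ℝ := (innerSL ℝ v) ∘L (ContinuousLinearMap.apply ℝ V v)
    have h1 := ev.integral_comp_comm hFi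
    rw [h0, map_zero] at h1
    have h2 : ∀ k, ev (F k) = ‖((k⁻¹ : K) : (V →L[ℝ] V)ˣ).1 v‖ ^ 2 := fun k => by
      simp only [ev, F, ContinuousLinearMap.comp_apply, ContinuousLinearMap.apply_apply,
        innerSL_apply_apply, ContinuousLinearMap.adjoint_inner_right, real_inner_self_eq_norm_sq]
    have h3 : 0 < ∫ k, ev (F k) ∂μ := by
      refine Continuous.integral_pos_of_hasCompactSupport_nonneg_nonzero (x := 1)
        (ev.continuous.comp hFc) (HasCompactSupport.of_compactSpace _) ?_ ?_
      · intro k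
        simp only [h2, Pi.zero_apply]
        positivity
      · rw [h2]
        simpa using hv
    exact h3.ne' h1
  · intro u hu
    have hu' : u ∈ K := Γ.le_topologicalClosure hu
    let cj : (V →L[ℝ] V) →L[ℝ] (V →L[ℝ] V) :=
      (ContinuousLinearMap.compL ℝ V V V (ContinuousLinearMap.adjoint (u : V →L[ℝ] V))) ∘L
        ((ContinuousLinearMap.compL ℝ V V V).flip (u : V →L[ℝ] V))
    have h1 := cj.integral_comp_comm hFi
    change _ = ContinuousLinearMap.adjoint (u : V →L[ℝ] V) ∘L (∫ k, F k ∂μ) ∘L _ at h1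
    rw [← h1]
    have h2 : ∀ k, cj (F k) = F ((⟨u, hu'⟩ : K)⁻¹ * k) := fun k => by
      ext1 w
      simp only [cj, F, ContinuousLinearMap.comp_apply, ContinuousLinearMap.compL_apply,
        ContinuousLinearMap.flip_apply, mul_inv_rev, inv_inv, Subgroup.coe_mul, Units.val_mul]
      rw [ContinuousLinearMap.mul_def, ContinuousLinearMap.adjoint_comp]
      rfl
    simp only [h2]
    exact integral_mul_left_eq_self F _

end Averaging

/-! ### Measures carried by finitely many projective subspaces -/

section Carried

open Filter Topology Function

variable {V : Type*} [NormedAddCommGroup V] [InnerProductSpace ℝ V] [FiniteDimensional ℝ V]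

/-- The projective subspace of all lines contained in `W`. -/
def projSubspace (W : Submodule ℝ V) : Set (ℙ ℝ V) := {z | z.rep ∈ W}

lemma mk_mem_projSubspace {W : Submodule ℝ V} {u : V} {hu : u ≠ 0} :
    Projectivization.mk ℝ u hu ∈ projSubspace W ↔ u ∈ W := by
  obtain ⟨a, ha⟩ := Projectivization.exists_smul_eq_mk_rep ℝ u hu
  change (Projectivization.mk ℝ u hu).rep ∈ W ↔ _
  rw [← ha]
  exact W.smul_mem_iff' a

/-- The sine of the angle between the line `z` and the subspace `W`. -/
def projDist (W : Submodule ℝ V) (z : ℙ ℝ V) : ℝ :=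
  ‖(ContinuousLinearMap.id ℝ V - W.starProjection) ∘L projEmb z‖

lemma continuous_projDist (W : Submodule ℝ V) : Continuous (projDist W) := by
  have hc : Continuous (fun q : (V →L[ℝ] V) =>
      (ContinuousLinearMap.id ℝ V - W.starProjection) ∘L q) := by fun_prop
  exact (hc.comp continuous_projEmb).norm

lemma projDist_mk (W : Submodule ℝ V) {u : V} (hu : u ≠ 0) :
    projDist W (Projectivization.mk ℝ u hu) = ‖u - W.starProjection u‖ / ‖u‖ := by
  rw [projDist, projEmb_mk, norm_comp_lineProj _ hu]
  rfl

lemma projDist_nonneg (W : Submodule ℝ V) (z : ℙ ℝ V) : 0 ≤ projDist W z := norm_nonneg _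

lemma projDist_le_one (W : Submodule ℝ V) (z : ℙ ℝ V) : projDist W z ≤ 1 := by
  induction z using Projectivization.ind with
  | h u hu =>
    rw [projDist_mk, div_le_one (norm_pos_iff.2 hu), ← Submodule.starProjection_orthogonal_val]
    exact Submodule.norm_starProjection_apply_le _ u

lemma projDist_eq_zero_iff (W : Submodule ℝ V) (z : ℙ ℝ V) :
    projDist W z = 0 ↔ z ∈ projSubspace W := by
  induction z using Projectivization.ind with
  | h u hu =>
    rw [projDist_mk, mk_mem_projSubspace, div_eq_zero_iff, norm_eq_zero, norm_eq_zero,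
      or_iff_left hu, sub_eq_zero, eq_comm, Submodule.starProjection_eq_self_iff]

lemma isClosed_projSubspace (W : Submodule ℝ V) : IsClosed (projSubspace W) := by
  have : projSubspace W = projDist W ⁻¹' {0} := by ext z; simp [projDist_eq_zero_iff]
  rw [this]
  exact isClosed_singleton.preimage (continuous_projDist W)

lemma projAct_mem_projSubspace_iff {A : V →L[ℝ] V} (hA : Injective A) (W : Submodule ℝ V)
    (z : ℙ ℝ V) :
    projAct A z ∈ projSubspace (W.map (A : V →ₗ[ℝ] V)) ↔ z ∈ projSubspace W := by
  induction z using Projectivization.ind with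
  | h u hu =>
    rw [projAct_mk hA, mk_mem_projSubspace, mk_mem_projSubspace]
    exact hA.mem_set_image (s := (W : Set V))

/-- The measure `ν` is carried by the union of the projective subspaces in `𝒱`. -/
def CarriedBy (𝒱 : Finset (Submodule ℝ V)) (ν : Measure (ℙ ℝ V)) : Prop :=
  ∀ᵐ z ∂ν, ∃ W ∈ 𝒱, z ∈ projSubspace W

open Classical in
lemma CarriedBy.map {𝒱 : Finset (Submodule ℝ V)} {ν : Measure (ℙ ℝ V)} (h : CarriedBy 𝒱 ν)
    {A : V →L[ℝ] V} (hA : Injective A) (hfix : FixesMeasure A ν) :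
    CarriedBy (𝒱.image fun W => W.map (A : V →ₗ[ℝ] V)) ν := by
  have hms : MeasurableSet {z | ∃ W ∈ 𝒱.image fun W => W.map (A : V →ₗ[ℝ] V),
      z ∈ projSubspace W} := by
    have : {z | ∃ W ∈ 𝒱.image fun W => W.map (A : V →ₗ[ℝ] V), z ∈ projSubspace W} =
        ⋃ W ∈ 𝒱.image fun W => W.map (A : V →ₗ[ℝ] V), projSubspace W := by ext; simp
    rw [this]
    exact Finset.measurableSet_biUnion _ fun W _ => (isClosed_projSubspace W).measurableSet
  rw [CarriedBy, ← hfix, ae_map_iff (measurable_projAct A).aemeasurable hms]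
  filter_upwards [h] with z hz
  obtain ⟨W, hW, hzW⟩ := hz
  exact ⟨_, Finset.mem_image_of_mem _ hW, (projAct_mem_projSubspace_iff hA W z).2 hzW⟩

open Classical in
lemma CarriedBy.inf {𝒱 𝒲 : Finset (Submodule ℝ V)} {ν : Measure (ℙ ℝ V)} (h : CarriedBy 𝒱 ν)
    (h' : CarriedBy 𝒲 ν) : CarriedBy (Finset.image₂ (· ⊓ ·) 𝒱 𝒲) ν := by
  filter_upwards [h, h'] with z ⟨W, hW, hzW⟩ ⟨W', hW', hzW'⟩
  exact ⟨W ⊓ W', Finset.mem_image₂_of_mem hW hW', hzW, hzW'⟩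

open Classical in
/-- If a sequence of linear maps of determinant `±1` goes to infinity, then the measures fixed by
all of them are carried by two proper subspaces: the range of a limit `A` of the normalized
sequence, and a limit of the images of the kernel of `A`. -/
lemma exists_carriedBy_of_unbounded (u : ℕ → (V →L[ℝ] V)ˣ) (hdet : ∀ n, |(u n).1.det| = 1)
    (hu : ∀ n : ℕ, (n : ℝ) + 1 ≤ ‖(u n).1‖) (hV : Module.finrank ℝ V ≠ 0) :
    ∃ W₁ W₂ : Submodule ℝ V, W₁ ≠ ⊤ ∧ W₂ ≠ ⊤ ∧ ∀ ν : Measure (ℙ ℝ V), IsProbabilityMeasure ν →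
      (∀ n, FixesMeasure (u n).1 ν) → CarriedBy {W₁, W₂} ν := by
  have hpos : ∀ n, 0 < ‖(u n).1‖ := fun n => lt_of_lt_of_le (by positivity) (hu n)
  have hinj : ∀ n, Injective (u n).1 := fun n =>
    (ContinuousLinearEquiv.ofUnit (u n)).injective
  -- the normalized maps subconverge to some `A` of norm one, which is singular because the
  -- determinants of the normalized maps tend to zero
  let B : ℕ → V →L[ℝ] V := fun n => ‖(u n).1‖⁻¹ • (u n).1
  have hB1 : ∀ n, ‖B n‖ = 1 := fun n => by
    simp only [B, norm_smul, norm_inv, norm_norm]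
    exact inv_mul_cancel₀ (hpos n).ne'
  have hball := isCompact_closedBall (0 : V →L[ℝ] V) 1
  obtain ⟨A, -, φ, hφ, hA⟩ := hball.tendsto_subseq (x := B) fun n => by
    rw [mem_closedBall_zero_iff]; exact (hB1 n).le
  have hnormA : ‖A‖ = 1 := by
    refine tendsto_nhds_unique hA.norm ?_
    simp [hB1]
  have hnorm_top : Tendsto (fun n => ‖(u n).1‖) atTop atTop :=
    tendsto_atTop_mono hu (tendsto_atTop_add_const_right _ _ tendsto_natCast_atTop_atTop)
  have hdetA : A.det = 0 := by
    have h1 : Tendsto (fun n => (B (φ n)).det) atTop (𝓝 A.det) :=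
      (ContinuousLinearMap.continuous_det.tendsto A).comp hA
    have h2 : Tendsto (fun n => |(B (φ n)).det|) atTop (𝓝 0) := by
      have h3 : ∀ n, |(B n).det| = (‖(u n).1‖⁻¹) ^ Module.finrank ℝ V := fun n => by
        have : (B n).det = (‖(u n).1‖⁻¹) ^ Module.finrank ℝ V * (u n).1.det := by
          simp [B, ContinuousLinearMap.det, LinearMap.det_smul]
        rw [this, abs_mul, hdet, mul_one, abs_of_nonneg (by positivity)]
      simp only [h3]
      have h4 := (tendsto_inv_atTop_zero.comp (hnorm_top.comp hφ.tendsto_atTop)).pow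
        (Module.finrank ℝ V)
      rwa [zero_pow hV] at h4
    exact abs_eq_zero.1 (tendsto_nhds_unique h1.abs h2)
  have range_ne_top : ∀ D : V →L[ℝ] V, D.det = 0 → LinearMap.range (D : V →ₗ[ℝ] V) ≠ ⊤ := by
    intro D hD htop
    have h1 := LinearMap.range_lt_top_of_det_eq_zero (f := (D : V →ₗ[ℝ] V)) hD
    exact h1.ne htop
  set N := LinearMap.ker (A : V →ₗ[ℝ] V) with hN
  have hNtop : N ≠ ⊤ := by
    intro h
    have : A = 0 := by
      ext v
      have : v ∈ N := h ▸ Submodule.mem_top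
      exact this
    rw [this, norm_zero] at hnormA
    exact zero_ne_one hnormA
  -- the limit of the images of `N` is taken in terms of the orthogonal projections onto them
  let W : ℕ → Submodule ℝ V := fun n => N.map ((u (φ n)).1 : V →ₗ[ℝ] V)
  obtain ⟨Q, -, ψ, hψ, hQ⟩ := hball.tendsto_subseq (x := fun n => (W n).starProjection)
    fun n => by rw [mem_closedBall_zero_iff]; exact Submodule.starProjection_norm_le _
  have hdetQ : Q.det = 0 := by
    have h1 : Tendsto (fun n => ((W (ψ n)).starProjection).det) atTop (𝓝 Q.det) :=
      (ContinuousLinearMap.continuous_det.tendsto Q).comp hQ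
    have h2 : ∀ n, ((W n).starProjection).det = 0 := fun n => by
      by_contra hne
      have h3 : Injective ((W n).starProjection) :=
        (LinearMap.equivOfDetNeZero _ hne).injective
      have h4 : LinearMap.range ((W n).starProjection : V →ₗ[ℝ] V) = ⊤ :=
        LinearMap.range_eq_top.2 (LinearMap.injective_iff_surjective.1 h3)
      have h5 : W n = ⊤ := by
        rw [← h4]; exact (Submodule.range_starProjection (W n)).symm
      apply hNtop
      have h6 : N.map ((u (φ n)).1 : V →ₗ[ℝ] V) =
          (⊤ : Submodule ℝ V).map ((u (φ n)).1 : V →ₗ[ℝ] V) := by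
        change W n = _
        rw [h5, Submodule.map_top, eq_comm, LinearMap.range_eq_top]
        exact (ContinuousLinearEquiv.ofUnit (u (φ n))).surjective
      exact Submodule.map_injective_of_injective (hinj (φ n)) h6
    simp only [h2] at h1
    exact (tendsto_nhds_unique h1 tendsto_const_nhds)
  refine ⟨LinearMap.range (A : V →ₗ[ℝ] V), LinearMap.range (Q : V →ₗ[ℝ] V),
    range_ne_top A hdetA, range_ne_top Q hdetQ, fun ν hν hfix => ?_⟩
  set R₁ := LinearMap.range (A : V →ₗ[ℝ] V)
  set R₂ := LinearMap.range (Q : V →ₗ[ℝ] V)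
  -- `Φ` vanishes exactly on the two projective subspaces; its integral against a measure fixed by
  -- all `u n` does not change under `u n`, but tends to zero
  let Φ : ℙ ℝ V → ℝ := fun z => projDist R₁ z * projDist R₂ z
  have hΦc : Continuous Φ := (continuous_projDist _).mul (continuous_projDist _)
  have hΦ0 : ∀ z, 0 ≤ Φ z := fun z => mul_nonneg (projDist_nonneg _ _) (projDist_nonneg _ _)
  have hlim : ∀ z, Tendsto (fun n => Φ (projAct (u (φ (ψ n))).1 z)) atTop (𝓝 0) := by
    intro z
    induction z using Projectivization.ind with
    | h v hv =>
    have hne : ∀ n, (u n).1 v ≠ 0 := fun n => by simpa using (hinj n).ne hv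
    simp only [Φ, projAct_mk (hinj _)]
    by_cases hvN : v ∈ N
    · -- the line lies in the kernel of `A`, so its images approach the range of `Q`
      refine squeeze_zero (g := fun n => ‖(W (ψ n)).starProjection - Q‖) (fun n => hΦ0 _)
        (fun n => ?_) (by simpa using (hQ.sub_const Q).norm)
      refine (mul_le_of_le_one_left (projDist_nonneg _ _) (projDist_le_one _ _)).trans ?_
      rw [projDist_mk, div_le_iff₀ (norm_pos_iff.2 (hne _))]
      set w := (u (φ (ψ n))).1 v with hw
      have hwW : (W (ψ n)).starProjection w = w :=
        Submodule.starProjection_eq_self_iff.2 ⟨v, hvN, rfl⟩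
      have hQw : R₂.starProjection (Q w) = Q w :=
        Submodule.starProjection_eq_self_iff.2 ⟨w, rfl⟩
      have h1 : w - R₂.starProjection w =
          R₂ᗮ.starProjection (((W (ψ n)).starProjection - Q) w) := by
        rw [Submodule.starProjection_orthogonal_val, sub_apply, hwW, map_sub, hQw]
        abel
      rw [h1]
      exact (Submodule.norm_starProjection_apply_le _ _).trans (ContinuousLinearMap.le_opNorm _ _)
    · -- otherwise its images approach the range of `A`
      have hAv : A v ≠ 0 := hvN
      have h1 : Tendsto (fun n => projDist R₁ (Projectivization.mk ℝ _ (hne (φ (ψ n))))) atTop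
          (𝓝 0) := by
        have h2 : ∀ n, projDist R₁ (Projectivization.mk ℝ _ (hne n)) =
            ‖B n v - R₁.starProjection (B n v)‖ / ‖B n v‖ := fun n => by
          have h3 := (hpos n).ne'
          rw [projDist_mk]
          simp only [B, smul_apply, map_smul, ← smul_sub, norm_smul]
          rw [mul_div_mul_left]
          simpa using h3
        simp only [h2]
        have h4 : Tendsto (fun n => B (φ (ψ n)) v) atTop (𝓝 (A v)) :=
          ((ContinuousLinearMap.apply ℝ V v).continuous.tendsto A).comp
            (hA.comp hψ.tendsto_atTop)
        have h5 : Tendsto (fun n => R₁.starProjection (B (φ (ψ n)) v)) atTop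
            (𝓝 (R₁.starProjection (A v))) := (R₁.starProjection.continuous.tendsto _).comp h4
        have h6 : R₁.starProjection (A v) = A v :=
          Submodule.starProjection_eq_self_iff.2 ⟨v, rfl⟩
        have h7 := ((h4.sub h5).norm).div h4.norm (norm_ne_zero_iff.2 hAv)
        rwa [h6, sub_self, norm_zero, zero_div] at h7
      refine squeeze_zero (fun n => hΦ0 _) (fun n => ?_) h1
      exact mul_le_of_le_one_right (projDist_nonneg _ _) (projDist_le_one _ _)
  have hint : ∫ z, Φ z ∂ν = 0 := by
    have h1 : Tendsto (fun n => ∫ z, Φ (projAct (u (φ (ψ n))).1 z) ∂ν) atTop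
        (𝓝 (∫ _, (0 : ℝ) ∂ν)) := by
      refine tendsto_integral_of_dominated_convergence (fun _ => 1) (fun n => ?_)
        (integrable_const _) (fun n => ae_of_all _ fun z => ?_) (ae_of_all _ hlim)
      · exact (hΦc.comp (continuous_projAct _)).aestronglyMeasurable
      · rw [Real.norm_of_nonneg (hΦ0 _)]
        exact mul_le_one₀ (projDist_le_one _ _) (projDist_nonneg _ _) (projDist_le_one _ _)
    simp only [(hfix _).integral_eq hΦc, integral_zero] at h1
    exact tendsto_nhds_unique tendsto_const_nhds h1
  have hΦi : Integrable Φ ν :=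
    hΦc.integrable_of_hasCompactSupport (HasCompactSupport.of_compactSpace _)
  filter_upwards [(integral_eq_zero_iff_of_nonneg hΦ0 hΦi).1 hint] with z hz
  rcases mul_eq_zero.1 hz with h | h
  · exact ⟨R₁, by simp, (projDist_eq_zero_iff _ _).1 h⟩
  · exact ⟨R₂, by simp, (projDist_eq_zero_iff _ _).1 h⟩

end Carried

/-! ### Eliminating all common invariant measures by successive small rotations -/

section Game

open Filter Topology Function

variable {d : ℕ} {i j : Fin d}

/-- The probability measures on projective space that are fixed by `A`. -/
def fixedBy (A : EuclideanSpace ℝ (Fin d) ≃L[ℝ] EuclideanSpace ℝ (Fin d)) :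
    Set (ProbabilityMeasure (ℙ ℝ (EuclideanSpace ℝ (Fin d)))) :=
  {ν | FixesMeasure (A : EuclideanSpace ℝ (Fin d) →L[ℝ] EuclideanSpace ℝ (Fin d))
    (ν : Measure (ℙ ℝ (EuclideanSpace ℝ (Fin d))))}

/-- The sets `X` of measures that can be emptied in finitely many rounds of the following game. An
opponent gives `g ∈ GL(d)`, one answers with `S ∈ GL(d)`, the opponent gives `ε > 0`, one answers
with an angle `t` such that `|t| < ε`, and `X` is replaced by the set of all measures in `X` that
are fixed by `g ∘ conjRot S t`. -/
inductive Wins (hij : i ≠ j) : Set (ProbabilityMeasure (ℙ ℝ (EuclideanSpace ℝ (Fin d)))) → Prop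
  | empty : Wins hij ∅
  | step (X : Set (ProbabilityMeasure (ℙ ℝ (EuclideanSpace ℝ (Fin d)))))
      (S : (EuclideanSpace ℝ (Fin d) ≃L[ℝ] EuclideanSpace ℝ (Fin d)) →
        (EuclideanSpace ℝ (Fin d) ≃L[ℝ] EuclideanSpace ℝ (Fin d)))
      (t : (EuclideanSpace ℝ (Fin d) ≃L[ℝ] EuclideanSpace ℝ (Fin d)) → ℝ → ℝ)
      (ht : ∀ g ε, 0 < ε → |t g ε| < ε)
      (h : ∀ g ε, 0 < ε → Wins hij (X ∩ fixedBy ((conjRot hij (S g) (t g ε)).trans g))) :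
      Wins hij X

lemma Wins.of_forall_exists (hij : i ≠ j)
    (X : Set (ProbabilityMeasure (ℙ ℝ (EuclideanSpace ℝ (Fin d)))))
    (h : ∀ g : EuclideanSpace ℝ (Fin d) ≃L[ℝ] EuclideanSpace ℝ (Fin d),
      ∃ S : EuclideanSpace ℝ (Fin d) ≃L[ℝ] EuclideanSpace ℝ (Fin d), ∀ ε > 0, ∃ t : ℝ, |t| < ε ∧
        Wins hij (X ∩ fixedBy ((conjRot hij S t).trans g))) :
    Wins hij X := by
  choose S h using h
  have h' : ∀ g ε, ∃ t : ℝ, 0 < ε → (|t| < ε ∧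
      Wins hij (X ∩ fixedBy ((conjRot hij (S g) t).trans g))) := by
    intro g ε
    by_cases hε : 0 < ε
    · obtain ⟨t, ht⟩ := h g ε hε
      exact ⟨t, fun _ => ht⟩
    · exact ⟨0, fun h => absurd h hε⟩
  choose t ht using h'
  exact Wins.step X S t (fun g ε hε => (ht g ε hε).1) (fun g ε hε => (ht g ε hε).2)

lemma Wins.mono {hij : i ≠ j} {X Y : Set (ProbabilityMeasure (ℙ ℝ (EuclideanSpace ℝ (Fin d))))}
    (h : Wins hij Y) (hXY : X ⊆ Y) : Wins hij X := by
  induction h generalizing X with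
  | empty => rw [subset_empty_iff.1 hXY]; exact Wins.empty
  | step Y S t ht _ ih =>
    exact Wins.step X S t ht fun g ε hε => ih g ε hε (inter_subset_inter_left _ hXY)

lemma not_carriedBy_of_forall_eq_bot {𝒱 : Finset (Submodule ℝ (EuclideanSpace ℝ (Fin d)))}
    (h𝒱 : ∀ W ∈ 𝒱, W = ⊥) (ν : ProbabilityMeasure (ℙ ℝ (EuclideanSpace ℝ (Fin d)))) :
    ¬ CarriedBy 𝒱 (ν : Measure _) := by
  intro h
  have : ∀ᵐ z ∂(ν : Measure (ℙ ℝ (EuclideanSpace ℝ (Fin d)))), False := by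
    filter_upwards [h] with z ⟨W, hW, hz⟩
    rw [h𝒱 W hW] at hz
    exact z.rep_nonzero hz
  exact (Filter.eventually_false_iff_eq_bot.1 this ▸
    (inferInstance : (ae (ν : Measure (ℙ ℝ (EuclideanSpace ℝ (Fin d))))).NeBot)).ne rfl

/-- Given finitely many proper subspaces, a nonzero vector can be moved outside of all of them by
an arbitrarily small rotation in a suitable plane. -/
lemma exists_conjRot_notMem (hij : i ≠ j)
    (𝒱 : Finset (Submodule ℝ (EuclideanSpace ℝ (Fin d)))) (h𝒱 : ⊤ ∉ 𝒱)
    {v : EuclideanSpace ℝ (Fin d)} (hv : v ≠ 0) :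
    ∃ S : EuclideanSpace ℝ (Fin d) ≃L[ℝ] EuclideanSpace ℝ (Fin d), ∀ ε > 0, ∃ t : ℝ, |t| < ε ∧
      ∀ W ∈ 𝒱, conjRot hij S t v ∉ W := by
  classical
  have hd : 1 < d := by
    have := i.2; have := j.2
    have : (i : ℕ) ≠ j := fun h => hij (Fin.ext h)
    omega
  have hspan : Submodule.span ℝ {v} ≠ ⊤ := by
    intro h
    have h1 := finrank_span_singleton (K := ℝ) hv
    rw [h, finrank_top, finrank_euclideanSpace_fin] at h1
    omega
  have h1 : ⊤ ∉ insert (Submodule.span ℝ {v}) 𝒱 := by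
    rw [Finset.mem_insert, not_or]
    exact ⟨fun h => hspan h.symm, h𝒱⟩
  obtain ⟨w, hw⟩ : ∃ w, w ∉ ⋃ p ∈ insert (Submodule.span ℝ {v}) 𝒱,
      (p : Set (EuclideanSpace ℝ (Fin d))) := by
    have := Subspace.biUnion_ne_univ_of_top_notMem h1
    rwa [Ne, eq_univ_iff_forall, not_forall] at this
  simp only [mem_iUnion, not_exists, SetLike.mem_coe] at hw
  have hlin : LinearIndependent ℝ ![v, w] := by
    rw [LinearIndependent.pair_iff' hv]
    intro a ha
    exact hw _ (Finset.mem_insert_self _ _) (ha ▸ Submodule.smul_mem _ a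
      (Submodule.mem_span_singleton_self v))
  obtain ⟨S, hS1, hS2⟩ := exists_equiv_map_pair hij hlin
  refine ⟨S, fun ε hε => ?_⟩
  have hform : ∀ t, conjRot hij S t v = Real.cos t • v + Real.sin t • w := fun t => by
    have := conjRot_apply_fst hij S t
    rwa [hS1, hS2] at this
  -- each of the subspaces contains the rotated vector for at most one small angle
  have hbad : ∀ W ∈ 𝒱, {t ∈ Ioo 0 (min ε 1) | conjRot hij S t v ∈ W}.Subsingleton := by
    rintro W hW t ⟨⟨ht0, ht1⟩, ht⟩ s ⟨⟨hs0, hs1⟩, hs⟩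
    by_contra hne
    rw [hform] at ht hs
    have h2 : Real.sin (t - s) • w ∈ W := by
      have h3 := W.sub_mem (W.smul_mem (Real.cos s) ht) (W.smul_mem (Real.cos t) hs)
      have h4 : Real.cos s • (Real.cos t • v + Real.sin t • w) -
          Real.cos t • (Real.cos s • v + Real.sin s • w) = Real.sin (t - s) • w := by
        rw [Real.sin_sub]; module
      rwa [h4] at h3
    have h5 : Real.sin (t - s) ≠ 0 := by
      rw [Ne, Real.sin_eq_zero_iff_of_lt_of_lt]
      · exact sub_ne_zero.2 hne
      · have := min_le_right ε 1; linarith [Real.pi_gt_three]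
      · have := min_le_right ε 1; linarith [Real.pi_gt_three]
    exact hw W (Finset.mem_insert_of_mem hW) ((W.smul_mem_iff h5).1 h2)
  have hfin : (⋃ W ∈ 𝒱, {t ∈ Ioo 0 (min ε 1) | conjRot hij S t v ∈ W}).Finite :=
    𝒱.finite_toSet.biUnion fun W hW => (hbad W hW).finite
  obtain ⟨t, ht, htn⟩ := (Ioo_infinite (show (0 : ℝ) < min ε 1 by positivity)).exists_notMem_finite
    hfin
  refine ⟨t, ?_, fun W hW hmem => htn ?_⟩
  · rw [abs_of_pos ht.1]; exact ht.2.trans_le (min_le_left _ _)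
  · simp only [mem_iUnion]
    exact ⟨W, hW, ht, hmem⟩

open Classical in
/-- The measures carried by a given finite union of proper subspaces can be eliminated: a linear map
`h` in general position replaces the subspaces `W` by the intersections `W ∩ h W'`. The induction is
on the largest dimension `D` that occurs and on the number of subspaces of that dimension. -/
lemma wins_carriedBy (hij : i ≠ j) (D : ℕ) (hD : D < d) (n : ℕ)
    (𝒱 : Finset (Submodule ℝ (EuclideanSpace ℝ (Fin d))))
    (h𝒱 : ∀ W ∈ 𝒱, Module.finrank ℝ W ≤ D)
    (hn : (𝒱.filter fun W : Submodule ℝ (EuclideanSpace ℝ (Fin d)) =>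
      Module.finrank ℝ W = D).card ≤ n) :
    Wins hij {ν | CarriedBy 𝒱 (ν : Measure (ℙ ℝ (EuclideanSpace ℝ (Fin d))))} := by
  induction D generalizing n 𝒱 with
  | zero =>
    refine Wins.empty.mono fun ν hν => ?_
    exact not_carriedBy_of_forall_eq_bot
      (fun W hW => Submodule.finrank_eq_zero.1 (Nat.le_zero.1 (h𝒱 W hW))) ν hν
  | succ D ihD =>
    induction n generalizing 𝒱 with
    | zero =>
      refine ihD (by omega) _ 𝒱 (fun W hW => ?_) le_rfl
      have h1 : W ∉ 𝒱.filter fun W : Submodule ℝ (EuclideanSpace ℝ (Fin d)) =>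
          Module.finrank ℝ W = D + 1 := by
        rw [Finset.card_eq_zero.1 (Nat.le_zero.1 hn)]; exact Finset.notMem_empty W
      rw [Finset.mem_filter, not_and] at h1
      have := h𝒱 W hW
      have := h1 hW
      omega
    | succ n ihn =>
      by_cases hemp : (𝒱.filter fun W : Submodule ℝ (EuclideanSpace ℝ (Fin d)) =>
          Module.finrank ℝ W = D + 1) = ∅
      · exact ihn 𝒱 h𝒱 (by rw [hemp]; simp)
      obtain ⟨V₀, hV₀⟩ := Finset.nonempty_iff_ne_empty.2 hemp
      have hV₀D : Module.finrank ℝ V₀ = D + 1 := (Finset.mem_filter.1 hV₀).2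
      have hV₀bot : V₀ ≠ ⊥ := by
        intro h
        rw [h, finrank_bot] at hV₀D
        omega
      obtain ⟨v, hvV, hv⟩ := Submodule.exists_mem_ne_zero_of_ne_bot hV₀bot
      refine Wins.of_forall_exists hij _ fun g => ?_
      set ℱ := 𝒱.filter fun W : Submodule ℝ (EuclideanSpace ℝ (Fin d)) =>
        Module.finrank ℝ W = D + 1 with hℱ
      let 𝒲 := ℱ.image fun W =>
        W.map (g.symm : EuclideanSpace ℝ (Fin d) →ₗ[ℝ] EuclideanSpace ℝ (Fin d))
      have h𝒲 : ⊤ ∉ 𝒲 := by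
        intro h
        obtain ⟨W, hW, hWt⟩ := Finset.mem_image.1 h
        have h1 := LinearEquiv.finrank_map_eq g.symm.toLinearEquiv W
        have h2 : W.map (g.symm.toLinearEquiv :
            EuclideanSpace ℝ (Fin d) →ₗ[ℝ] EuclideanSpace ℝ (Fin d)) = ⊤ := hWt
        rw [h2, finrank_top, finrank_euclideanSpace_fin, (Finset.mem_filter.1 hW).2] at h1
        omega
      obtain ⟨S, hS⟩ := exists_conjRot_notMem hij 𝒲 h𝒲 hv
      refine ⟨S, fun ε hε => ?_⟩
      obtain ⟨t, ht, htW⟩ := hS ε hε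
      refine ⟨t, ht, ?_⟩
      set A := (conjRot hij S t).trans g with hA
      have hAinj : Injective (A : EuclideanSpace ℝ (Fin d) →L[ℝ] EuclideanSpace ℝ (Fin d)) :=
        A.injective
      let im : Submodule ℝ (EuclideanSpace ℝ (Fin d)) → Submodule ℝ (EuclideanSpace ℝ (Fin d)) :=
        fun W => W.map ((A : EuclideanSpace ℝ (Fin d) →L[ℝ] EuclideanSpace ℝ (Fin d)) :
          EuclideanSpace ℝ (Fin d) →ₗ[ℝ] EuclideanSpace ℝ (Fin d))
      have him : ∀ W, Module.finrank ℝ (im W) = Module.finrank ℝ W := fun W =>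
        LinearEquiv.finrank_map_eq A.toLinearEquiv W
      have himinj : Injective im := Submodule.map_injective_of_injective hAinj
      -- the intersections of dimension `D + 1` are common elements of `ℱ` and of its image, and
      -- `im V₀` is not among them, which makes their number drop
      have hV₀im : im V₀ ∉ ℱ := by
        intro h
        refine htW _ (Finset.mem_image_of_mem _ h) ?_
        refine ⟨A v, ⟨v, hvV, rfl⟩, ?_⟩
        change g.symm (g (conjRot hij S t v)) = _
        rw [g.symm_apply_apply]
      refine (ihn (Finset.image₂ (· ⊓ ·) 𝒱 (𝒱.image im)) ?_ ?_).mono ?_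
      · intro W hW
        obtain ⟨W₁, hW₁, W₂, -, rfl⟩ := Finset.mem_image₂.1 hW
        exact (Submodule.finrank_mono inf_le_left).trans (h𝒱 W₁ hW₁)
      · have hsub : ((Finset.image₂ (· ⊓ ·) 𝒱 (𝒱.image im)).filter
            fun W : Submodule ℝ (EuclideanSpace ℝ (Fin d)) => Module.finrank ℝ W = D + 1) ⊆
              (ℱ.image im).erase (im V₀) := by
          intro W hW
          obtain ⟨hW, hWD⟩ := Finset.mem_filter.1 hW
          obtain ⟨W₁, hW₁, W₂, hW₂, rfl⟩ := Finset.mem_image₂.1 hW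
          obtain ⟨W₃, hW₃, rfl⟩ := Finset.mem_image.1 hW₂
          have h1 : W₁ ⊓ im W₃ = W₁ := Submodule.eq_of_le_of_finrank_le inf_le_left
            (by rw [hWD]; exact h𝒱 W₁ hW₁)
          have h2 : W₁ ⊓ im W₃ = im W₃ := Submodule.eq_of_le_of_finrank_le inf_le_right
            (by rw [hWD, him]; exact h𝒱 W₃ hW₃)
          have h3 : im W₃ = W₁ := h2.symm.trans h1
          rw [h2] at hWD ⊢
          refine Finset.mem_erase.2 ⟨?_, Finset.mem_image_of_mem _ (Finset.mem_filter.2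
            ⟨hW₃, by rw [← him]; exact hWD⟩)⟩
          rintro heq
          apply hV₀im
          rw [← heq, h3]
          exact Finset.mem_filter.2 ⟨hW₁, by rw [← h3]; exact hWD⟩
        refine (Finset.card_le_card hsub).trans ?_
        rw [Finset.card_erase_of_mem (Finset.mem_image_of_mem _ hV₀),
          Finset.card_image_of_injective _ himinj]
        omega
      · rintro ν ⟨hν, hfix⟩
        exact hν.inf (hν.map hAinj hfix)

/-- The linear space of quadratic forms preserved by all elements of `H`. -/
def formSpace (H : Set (EuclideanSpace ℝ (Fin d) →L[ℝ] EuclideanSpace ℝ (Fin d))ˣ) :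
    Submodule ℝ (EuclideanSpace ℝ (Fin d) →L[ℝ] EuclideanSpace ℝ (Fin d)) where
  carrier := {T | ContinuousLinearMap.adjoint T = T ∧
    ∀ u ∈ H, ContinuousLinearMap.adjoint u.1 ∘L T ∘L u.1 = T}
  add_mem' := fun {T T'} hT hT' => ⟨by rw [map_add, hT.1, hT'.1], fun u hu => by
    rw [ContinuousLinearMap.add_comp, ContinuousLinearMap.comp_add, hT.2 u hu, hT'.2 u hu]⟩
  zero_mem' := ⟨map_zero _, fun u _ => by simp⟩
  smul_mem' := fun c T hT => ⟨by rw [map_smulₛₗ, hT.1]; rfl, fun u hu => by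
    rw [ContinuousLinearMap.smul_comp, ContinuousLinearMap.comp_smul, hT.2 u hu]⟩

/-- Rescaling an invertible linear map to determinant `±1`. -/
lemma exists_unit_normalization (hd : d ≠ 0)
    (A : EuclideanSpace ℝ (Fin d) ≃L[ℝ] EuclideanSpace ℝ (Fin d)) :
    ∃ (c : ℝ) (u : (EuclideanSpace ℝ (Fin d) →L[ℝ] EuclideanSpace ℝ (Fin d))ˣ),
      c ≠ 0 ∧ u.1 = c • (A : EuclideanSpace ℝ (Fin d) →L[ℝ] EuclideanSpace ℝ (Fin d)) ∧
      |u.1.det| = 1 := by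
  have hdet : (A : EuclideanSpace ℝ (Fin d) →L[ℝ] EuclideanSpace ℝ (Fin d)).det ≠ 0 :=
    (LinearEquiv.isUnit_det' A.toLinearEquiv).ne_zero
  set D := |(A : EuclideanSpace ℝ (Fin d) →L[ℝ] EuclideanSpace ℝ (Fin d)).det| with hD
  have hDpos : 0 < D := abs_pos.2 hdet
  set c := (D ^ ((d : ℝ)⁻¹))⁻¹ with hc
  have hcpos : 0 < c := inv_pos.2 (Real.rpow_pos_of_pos hDpos _)
  refine ⟨c, ⟨c • (A : _ →L[ℝ] _), c⁻¹ • (A.symm : _ →L[ℝ] _), ?_, ?_⟩, hcpos.ne', rfl, ?_⟩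
  · ext1 v
    simp [hcpos.ne', smul_smul]
  · ext1 v
    simp [hcpos.ne', smul_smul]
  · have h1 : (c • (A : EuclideanSpace ℝ (Fin d) →L[ℝ] EuclideanSpace ℝ (Fin d))).det =
        c ^ d * (A : EuclideanSpace ℝ (Fin d) →L[ℝ] EuclideanSpace ℝ (Fin d)).det := by
      simp [ContinuousLinearMap.det, LinearMap.det_smul]
    change |(c • (A : EuclideanSpace ℝ (Fin d) →L[ℝ] EuclideanSpace ℝ (Fin d))).det| = 1
    rw [h1, abs_mul, ← hD, abs_of_pos (pow_pos hcpos d), hc, inv_pow,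
      Real.rpow_inv_natCast_pow hDpos.le hd, inv_mul_cancel₀ hDpos.ne']

/-- Linear maps preserving no common quadratic form generate an unbounded group, so that their
common invariant measures are carried by two proper subspaces. -/
lemma wins_of_formSpace_eq_bot (hij : i ≠ j)
    (H : Set (EuclideanSpace ℝ (Fin d) →L[ℝ] EuclideanSpace ℝ (Fin d))ˣ)
    (hdet : ∀ u ∈ H, |u.1.det| = 1) (hH : formSpace H = ⊥) :
    Wins hij {ν | ∀ u ∈ H, FixesMeasure u.1 (ν : Measure (ℙ ℝ (EuclideanSpace ℝ (Fin d))))} := by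
  classical
  have hd : d ≠ 0 := by rintro rfl; exact i.elim0
  have : Nontrivial (EuclideanSpace ℝ (Fin d)) := by
    apply Module.nontrivial_of_finrank_pos (R := ℝ)
    rw [finrank_euclideanSpace_fin]; omega
  set Γ := Subgroup.closure H
  have hdetΓ : ∀ u ∈ Γ, |u.1.det| = 1 := by
    have hmul : ∀ u v : (EuclideanSpace ℝ (Fin d) →L[ℝ] EuclideanSpace ℝ (Fin d))ˣ,
        |(u * v).1.det| = |u.1.det| * |v.1.det| := fun u v => by
      rw [← abs_mul, Units.val_mul]
      congr 1
      exact LinearMap.det_comp _ _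
    have hone : |(1 : (EuclideanSpace ℝ (Fin d) →L[ℝ] EuclideanSpace ℝ (Fin d))ˣ).1.det| = 1 := by
      rw [Units.val_one]
      have : (1 : EuclideanSpace ℝ (Fin d) →L[ℝ] EuclideanSpace ℝ (Fin d)).det = 1 :=
        LinearMap.det_id
      rw [this, abs_one]
    intro u hu
    induction hu using Subgroup.closure_induction with
    | mem u hu => exact hdet u hu
    | one => exact hone
    | mul u v _ _ h1 h2 => rw [hmul, h1, h2, one_mul]
    | inv u _ h1 =>
      have := hmul u u⁻¹
      rwa [mul_inv_cancel, hone, h1, one_mul, eq_comm] at this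
  have hunb : ∀ n : ℕ, ∃ u ∈ Γ, (n : ℝ) + 1 ≤ ‖u.1‖ := by
    intro n
    by_contra! hcon
    obtain ⟨T, hTs, hT0, hT⟩ := exists_invariant_form Γ (n + 1) fun u hu => (hcon u hu).le
    refine hT0 ((Submodule.mem_bot ℝ).1 (hH ▸ ?_))
    exact ⟨hTs, fun u hu => hT u (Subgroup.subset_closure hu)⟩
  choose u huΓ hun using hunb
  obtain ⟨W₁, W₂, hW₁, hW₂, hcar⟩ := exists_carriedBy_of_unbounded u
    (fun n => hdetΓ _ (huΓ n)) hun (by rwa [finrank_euclideanSpace_fin])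
  have hlt : ∀ W ∈ ({W₁, W₂} : Finset (Submodule ℝ (EuclideanSpace ℝ (Fin d)))),
      Module.finrank ℝ W ≤ d - 1 := by
    intro W hW
    have hW' : W ≠ ⊤ := by
      rcases Finset.mem_insert.1 hW with h | h
      · rwa [h]
      · rwa [Finset.mem_singleton.1 h]
    have := Submodule.finrank_lt hW'
    rw [finrank_euclideanSpace_fin] at this
    omega
  refine (wins_carriedBy hij (d - 1) (by omega) _ {W₁, W₂} hlt le_rfl).mono fun ν hν => ?_
  refine hcar ν inferInstance fun n => ?_
  have hfixΓ : ∀ v ∈ Γ, FixesMeasure v.1 (ν : Measure (ℙ ℝ (EuclideanSpace ℝ (Fin d)))) := by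
    have hinj : ∀ v : (EuclideanSpace ℝ (Fin d) →L[ℝ] EuclideanSpace ℝ (Fin d))ˣ,
        Injective v.1 := fun v => (ContinuousLinearEquiv.ofUnit v).injective
    intro v hv
    induction hv using Subgroup.closure_induction with
    | mem v hv => exact hν v hv
    | one =>
      have : projAct (1 : EuclideanSpace ℝ (Fin d) →L[ℝ] EuclideanSpace ℝ (Fin d)) = id :=
        funext projAct_id
      rw [FixesMeasure, Units.val_one, this, Measure.map_id]
    | mul v w _ _ h1 h2 => exact h1.comp (hinj v) (hinj w) h2
    | inv v _ h1 => exact h1.of_comp_eq_id (hinj v) (hinj v⁻¹) (Units.inv_mul v)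
  exact hfixΓ _ (huΓ n)

/-- Each round can be used to destroy one of the quadratic forms preserved so far, whence the
induction on the dimension of the space of these forms. -/
lemma wins_of_finrank_formSpace_le (hij : i ≠ j) (n : ℕ)
    (H : Set (EuclideanSpace ℝ (Fin d) →L[ℝ] EuclideanSpace ℝ (Fin d))ˣ)
    (hdet : ∀ u ∈ H, |u.1.det| = 1) (hn : Module.finrank ℝ (formSpace H) ≤ n) :
    Wins hij {ν | ∀ u ∈ H, FixesMeasure u.1 (ν : Measure (ℙ ℝ (EuclideanSpace ℝ (Fin d))))} := by
  have hd : d ≠ 0 := by rintro rfl; exact i.elim0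
  induction n generalizing H with
  | zero =>
    exact wins_of_formSpace_eq_bot hij H hdet (Submodule.finrank_eq_zero.1 (Nat.le_zero.1 hn))
  | succ n ih =>
    by_cases hH : formSpace H = ⊥
    · exact wins_of_formSpace_eq_bot hij H hdet hH
    obtain ⟨T, hT, hT0⟩ := Submodule.exists_mem_ne_zero_of_ne_bot hH
    refine Wins.of_forall_exists hij _ fun g => ?_
    obtain ⟨c, u, hc, hu, hudet⟩ := exists_unit_normalization hd g
    have hex : ∃ S : EuclideanSpace ℝ (Fin d) ≃L[ℝ] EuclideanSpace ℝ (Fin d), ∀ ε > 0, ∃ t : ℝ,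
        |t| < ε ∧ ContinuousLinearMap.adjoint (u.1 ∘L (conjRot hij S t : _ →L[ℝ] _)) ∘L T ∘L
          (u.1 ∘L (conjRot hij S t : _ →L[ℝ] _)) ≠ T := by
      by_contra! hcon
      -- otherwise `u` itself preserves the form, and therefore so do all small rotations
      have hid : ContinuousLinearMap.adjoint u.1 ∘L T ∘L u.1 = T := by
        obtain ⟨ε, hε, h⟩ := hcon (ContinuousLinearEquiv.refl ℝ _)
        have := h 0 (by simpa using hε)
        rw [conjRot_zero] at this
        exact this
      refine hT0 (eq_zero_of_forall_conjRot_invariant hij hT.1 fun S => ?_)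
      obtain ⟨ε, hε, h⟩ := hcon S
      refine ⟨ε, hε, fun t ht => ?_⟩
      have h1 := h t ht
      rw [ContinuousLinearMap.adjoint_comp] at h1
      conv_lhs => rw [← hid]
      exact h1
    obtain ⟨S, hS⟩ := hex
    refine ⟨S, fun ε hε => ?_⟩
    obtain ⟨t, ht, hne⟩ := hS ε hε
    refine ⟨t, ht, ?_⟩
    let w : (EuclideanSpace ℝ (Fin d) →L[ℝ] EuclideanSpace ℝ (Fin d))ˣ :=
      u * (conjRot hij S t).toUnit
    have hw : w.1 = u.1 ∘L (conjRot hij S t : _ →L[ℝ] _) := rfl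
    have hwdet : |w.1.det| = 1 := by
      have : w.1.det = u.1.det *
          (conjRot hij S t : EuclideanSpace ℝ (Fin d) →L[ℝ] EuclideanSpace ℝ (Fin d)).det :=
        LinearMap.det_comp _ _
      rw [this, abs_mul, hudet, abs_det_conjRot, one_mul]
    have hlt : formSpace (insert w H) < formSpace H := by
      refine lt_of_le_of_ne (fun T' hT' => ⟨hT'.1, fun v hv => hT'.2 v (mem_insert_of_mem _ hv)⟩)
        fun heq => ?_
      rw [← heq] at hT
      exact hne (hT.2 w (mem_insert _ _))
    refine (ih (insert w H) ?_ ?_).mono ?_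
    · rintro v (rfl | hv)
      · exact hwdet
      · exact hdet v hv
    · have := Submodule.finrank_lt_finrank_of_lt hlt
      omega
    · rintro ν ⟨hν, hfix⟩ v (rfl | hv)
      · have hwc : w.1 = c • (((conjRot hij S t).trans g : _ ≃L[ℝ] _) :
            EuclideanSpace ℝ (Fin d) →L[ℝ] EuclideanSpace ℝ (Fin d)) := by
          rw [hw, hu]; rfl
        have hact : projAct w.1 = projAct (((conjRot hij S t).trans g : _ ≃L[ℝ] _) :
            EuclideanSpace ℝ (Fin d) →L[ℝ] EuclideanSpace ℝ (Fin d)) := by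
          rw [hwc]
          exact funext fun z => projAct_smul ((conjRot hij S t).trans g).injective hc z
        rw [FixesMeasure, hact]
        exact hfix
      · exact hν v hv

/-- Finitely many invertible maps can be perturbed one by one, by arbitrarily small rotations, so
that in the end they fix no common probability measure on projective space. -/
theorem wins_univ (hij : i ≠ j) :
    Wins hij (univ : Set (ProbabilityMeasure (ℙ ℝ (EuclideanSpace ℝ (Fin d))))) := by
  refine (wins_of_finrank_formSpace_le hij _ ∅ (by simp) le_rfl).mono ?_
  intro ν _ u hu
  exact absurd hu (notMem_empty u)

end Game

/-! ### Invariance of product measures under projective skew products -/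

section ProductInvariance

open Filter Topology Function

variable {V : Type*} [NormedAddCommGroup V] [InnerProductSpace ℝ V] [FiniteDimensional ℝ V]
  {X : Type*} [MeasurableSpace X]

/-- Invariance under a map may be checked on the finite intersections of a countable generating
family of sets. -/
lemma exists_countable_test_sets : ∃ S : ℕ → Set (ℙ ℝ V), (∀ n, MeasurableSet (S n)) ∧
    ∀ (A : V →L[ℝ] V) (ν : Measure (ℙ ℝ V)), IsProbabilityMeasure ν →
      (∀ n, ν (projAct A ⁻¹' S n) = ν (S n)) → FixesMeasure A ν := by
  obtain ⟨e, he⟩ := exists_surjective_nat (Finset ℕ)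
  let T : ℕ → Set (ℙ ℝ V) := MeasurableSpace.natGeneratingSequence (ℙ ℝ V)
  let S : ℕ → Set (ℙ ℝ V) := fun n => ⋂ k ∈ e n, T k
  have hT : ∀ k, MeasurableSet (T k) := MeasurableSpace.measurableSet_natGeneratingSequence
  have hS : ∀ n, MeasurableSet (S n) := fun n =>
    Finset.measurableSet_biInter _ fun k _ => hT k
  refine ⟨S, hS, fun A ν hν h => ?_⟩
  have : IsProbabilityMeasure (ν.map (projAct A)) :=
    Measure.isProbabilityMeasure_map (measurable_projAct A).aemeasurable
  refine ext_of_generate_finite (range S) ?_ ?_ ?_ (by simp)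
  · refine le_antisymm ?_ (MeasurableSpace.generateFrom_le (by rintro _ ⟨n, rfl⟩; exact hS n))
    rw [← MeasurableSpace.generateFrom_natGeneratingSequence (ℙ ℝ V)]
    refine MeasurableSpace.generateFrom_le ?_
    rintro _ ⟨k, rfl⟩
    obtain ⟨n, hn⟩ := he {k}
    refine MeasurableSpace.measurableSet_generateFrom ⟨n, ?_⟩
    simp [S, hn, T]
  · rintro _ ⟨n, rfl⟩ _ ⟨k, rfl⟩ -
    classical
    obtain ⟨l, hl⟩ := he (e n ∪ e k)
    refine ⟨l, ?_⟩
    simp only [S, hl, Finset.set_biInter_inter]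
  · rintro _ ⟨n, rfl⟩
    rw [Measure.map_apply (measurable_projAct A) (hS n)]
    exact h n

/-- If `m × ν` is invariant under the skew product of an invertible map preserving `m`, then
almost all fibre maps fix `ν`. -/
lemma ae_fixesMeasure_of_measurePreserving {m : Measure X} [IsFiniteMeasure m] (f : X ≃ᵐ X)
    (hf : MeasurePreserving f m m) {A : X → V →L[ℝ] V} {ν : Measure (ℙ ℝ V)}
    [IsProbabilityMeasure ν]
    (h : MeasurePreserving (fun p : X × ℙ ℝ V => (f p.1, projAct (A p.1) p.2))
      (m.prod ν) (m.prod ν)) : ∀ᵐ x ∂m, FixesMeasure (A x) ν := by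
  obtain ⟨S, hS, hfix⟩ := exists_countable_test_sets (V := V)
  have key : ∀ n, ∀ᵐ x ∂m, ν (projAct (A x) ⁻¹' S n) = ν (S n) := by
    intro n
    have hm2 : Measurable (fun p : X × ℙ ℝ V => projAct (A p.1) p.2) :=
      measurable_snd.comp h.measurable
    have hmeas : Measurable (fun x => ν (projAct (A x) ⁻¹' S n)) :=
      measurable_measure_prodMk_left (hm2 (hS n))
    refine ae_eq_of_forall_setLIntegral_eq_of_sigmaFinite hmeas measurable_const fun B hB _ => ?_
    have hC : MeasurableSet (f.symm ⁻¹' B) := f.symm.measurable hB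
    have h1 := h.measure_preimage (hC.prod (hS n)).nullMeasurableSet
    have h2 : (fun p : X × ℙ ℝ V => (f p.1, projAct (A p.1) p.2)) ⁻¹' ((f.symm ⁻¹' B) ×ˢ S n) =
        (B ×ˢ univ) ∩ (fun p : X × ℙ ℝ V => projAct (A p.1) p.2) ⁻¹' (S n) := by
      ext p; simp
    have h3 : m (f.symm ⁻¹' B) = m B := by
      rw [← hf.measure_preimage hC.nullMeasurableSet]
      congr 1
      ext x; simp
    rw [h2, Measure.prod_prod, h3,
      Measure.prod_apply ((hB.prod MeasurableSet.univ).inter (hm2 (hS n)))] at h1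
    rw [setLIntegral_const, mul_comm, ← h1, ← lintegral_indicator hB]
    refine lintegral_congr fun x => ?_
    by_cases hx : x ∈ B
    · rw [indicator_of_mem hx]
      congr 1
      ext z; simp [hx]
    · rw [indicator_of_notMem hx]
      symm
      convert! measure_empty (μ := ν)
      ext z; simp [hx]
  filter_upwards [ae_all_iff.2 key] with x hx
  exact hfix _ ν inferInstance hx

lemma measurePreserving_of_ae_fixesMeasure {m : Measure X} [IsFiniteMeasure m] {f : X → X}
    (hf : MeasurePreserving f m m) {A : X → V →L[ℝ] V} (hA : Measurable A)
    (hinj : ∀ x, Injective (A x)) {ν : Measure (ℙ ℝ V)} [IsProbabilityMeasure ν]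
    (h : ∀ᵐ x ∂m, FixesMeasure (A x) ν) :
    MeasurePreserving (fun p : X × ℙ ℝ V => (f p.1, projAct (A p.1) p.2))
      (m.prod ν) (m.prod ν) :=
  hf.skew_product (measurable_projAct_prod hA hinj) h

end ProductInvariance

/-! ### Composition with a convergent sequence of measure preserving maps -/

section Composition

open Filter Topology Function

variable {X : Type*} [TopologicalSpace X] [MeasurableSpace X] [BorelSpace X] [NormalSpace X]
  {Y : Type*} [NormedAddCommGroup Y] [NormedSpace ℝ Y] [FiniteDimensional ℝ Y]
  [MeasurableSpace Y] [BorelSpace Y]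

/-- If measure preserving maps `h n` converge pointwise to `f` on `K`, then `G ∘ h n` converges
to `G ∘ f` almost everywhere on `K` along a subsequence, for any measurable `G`. -/
lemma exists_subseq_ae_tendsto_comp {m : Measure X} [IsFiniteMeasure m] [m.WeaklyRegular]
    {h : ℕ → X → X} {f : X → X} (hh : ∀ n, MeasurePreserving (h n) m m)
    (hf : MeasurePreserving f m m) {K : Set X} (hK : MeasurableSet K)
    (hlim : ∀ x ∈ K, Tendsto (fun n => h n x) atTop (𝓝 (f x)))
    {G : X → Y} (hG : Measurable G) :
    ∃ φ : ℕ → ℕ, StrictMono φ ∧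
      ∀ᵐ x ∂m, x ∈ K → Tendsto (fun n => G (h (φ n) x)) atTop (𝓝 (G (f x))) := by
  let L : Y ≃L[ℝ] EuclideanSpace ℝ (Fin (Module.finrank ℝ Y)) := toEuclidean
  let U : EuclideanSpace ℝ (Fin (Module.finrank ℝ Y)) ≃ₜ
    Metric.ball (0 : EuclideanSpace ℝ (Fin (Module.finrank ℝ Y))) 1 := Homeomorph.unitBall
  -- reduce to a bounded function by a homeomorphism onto the unit ball
  let G' : X → EuclideanSpace ℝ (Fin (Module.finrank ℝ Y)) := fun x => (U (L (G x))).1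
  have hcont : Continuous (fun y : Y => (U (L y)).1) := by fun_prop
  have hG' : Measurable G' := hcont.measurable.comp hG
  have hback : ∀ (y : ℕ → Y) (y₀ : Y), Tendsto (fun n => (U (L (y n))).1) atTop
      (𝓝 (U (L y₀)).1) → Tendsto y atTop (𝓝 y₀) := by
    intro y y₀ hy
    have h1 : Tendsto (fun n => U (L (y n))) atTop (𝓝 (U (L y₀))) := tendsto_subtype_rng.2 hy
    have h2 := ((L.symm.continuous.comp U.symm.continuous).tendsto _).comp h1
    simpa [comp_def] using h2
  have hG'i : Integrable G' m := by
    refine Integrable.of_bound hG'.aestronglyMeasurable 1 (ae_of_all _ fun x => ?_)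
    have := (U (L (G x))).2
    rw [mem_ball_zero_iff] at this
    exact this.le
  have hL1 : Tendsto (fun n => ∫⁻ x in K, ‖G' (h n x) - G' (f x)‖ₑ ∂m) atTop (𝓝 0) := by
    rw [ENNReal.tendsto_nhds_zero]
    intro ε hε
    -- approximate `G'` by a continuous `g`; as `h n` and `f` preserve `m`, the error is the same
    -- after composition with any of them
    obtain ⟨g, hg, hgi⟩ := hG'i.exists_boundedContinuous_lintegral_sub_le
      (ε := ε / 3) (ENNReal.div_pos hε.ne' (by simp)).ne'
    have hpres : ∀ k : X → X, MeasurePreserving k m m →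
        ∫⁻ x in K, ‖G' (k x) - g (k x)‖ₑ ∂m ≤ ε / 3 := by
      intro k hk
      refine (setLIntegral_le_lintegral _ _).trans ?_
      refine le_trans (le_of_eq ?_) hg
      exact hk.lintegral_comp (f := fun y => ‖G' y - g y‖ₑ)
        (hG'.sub g.continuous.measurable).enorm
    have hmid : Tendsto (fun n => ∫⁻ x in K, ‖g (h n x) - g (f x)‖ₑ ∂m) atTop (𝓝 0) := by
      have h0 : ∫⁻ x in K, (0 : ℝ≥0∞) ∂m = 0 := by simp
      rw [← h0]
      refine tendsto_lintegral_of_dominated_convergence (fun _ => ENNReal.ofReal (2 * ‖g‖))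
        (fun n => ?_) (fun n => ae_of_all _ fun x => ?_) ?_ ?_
      · exact ((g.continuous.measurable.comp (hh n).measurable).sub
          (g.continuous.measurable.comp hf.measurable)).enorm
      · change ‖g (h n x) - g (f x)‖ₑ ≤ _
        rw [← ofReal_norm]
        refine ENNReal.ofReal_le_ofReal ?_
        have h1 := g.norm_coe_le_norm (h n x)
        have h2 := g.norm_coe_le_norm (f x)
        have h3 := norm_sub_le (g (h n x)) (g (f x))
        linarith
      · simp [ENNReal.mul_eq_top]
      · refine (ae_restrict_iff' hK).2 (ae_of_all _ fun x hx => ?_)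
        have h1 := ((g.continuous.tendsto (f x)).comp (hlim x hx)).sub_const (g (f x))
        rw [sub_self] at h1
        have h2 := h1.enorm
        rwa [enorm_zero] at h2
    filter_upwards [(ENNReal.tendsto_nhds_zero.1 hmid) (ε / 3)
      (ENNReal.div_pos hε.ne' (by simp))] with n hn
    have hsplit : ∀ x, ‖G' (h n x) - G' (f x)‖ₑ ≤ ‖G' (h n x) - g (h n x)‖ₑ +
        (‖g (h n x) - g (f x)‖ₑ + ‖G' (f x) - g (f x)‖ₑ) := by
      intro x
      have h1 : G' (h n x) - G' (f x) = (G' (h n x) - g (h n x)) +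
          ((g (h n x) - g (f x)) + -(G' (f x) - g (f x))) := by abel
      rw [h1]
      refine (enorm_add_le _ _).trans (add_le_add le_rfl ((enorm_add_le _ _).trans ?_))
      rw [enorm_neg]
    refine (lintegral_mono hsplit).trans ?_
    rw [lintegral_add_left, lintegral_add_left]
    · calc _ ≤ ε / 3 + (ε / 3 + ε / 3) :=
          add_le_add (hpres _ (hh n)) (add_le_add hn (hpres _ hf))
        _ = ε := by rw [← add_assoc, ENNReal.add_thirds]
    · exact ((g.continuous.measurable.comp (hh n).measurable).sub
          (g.continuous.measurable.comp hf.measurable)).enorm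
    · exact ((hG'.comp (hh n).measurable).sub
          (g.continuous.measurable.comp (hh n).measurable)).enorm
  have hmeasure : TendstoInMeasure (m.restrict K) (fun n x => G' (h n x)) atTop
      (fun x => G' (f x)) := by
    refine tendstoInMeasure_of_tendsto_eLpNorm (p := 1) one_ne_zero
      (fun n => (hG'.comp (hh n).measurable).aestronglyMeasurable)
      (hG'.comp hf.measurable).aestronglyMeasurable ?_
    simp only [eLpNorm_one_eq_lintegral_enorm]
    exact hL1
  obtain ⟨φ, hφ, hae⟩ := hmeasure.exists_seq_tendsto_ae
  refine ⟨φ, hφ, ?_⟩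
  filter_upwards [(ae_restrict_iff' hK).1 hae] with x hx hxK
  exact hback _ _ (hx hxK)

end Composition

/-! ### Frame fields read in charts -/

section FramesInCharts

open Filter Topology Function

variable {d : ℕ} {M : Type*} [TopologicalSpace M] [ChartedSpace (EuclideanSpace ℝ (Fin d)) M]
  [IsManifold (𝓡 d) ∞ M]

lemma chartAt_mem_maximalAtlas (x : M) :
    chartAt (EuclideanSpace ℝ (Fin d)) x ∈ IsManifold.maximalAtlas (𝓡 d) ∞ M :=
  IsManifold.chart_mem_maximalAtlas x

lemma mdifferentiable_of_mem_maximalAtlas {e : OpenPartialHomeomorph M (EuclideanSpace ℝ (Fin d))}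
    (he : e ∈ IsManifold.maximalAtlas (𝓡 d) ∞ M) : e.MDifferentiable (𝓡 d) (𝓡 d) :=
  ⟨(contMDiffOn_of_mem_maximalAtlas he).mdifferentiableOn (by simp),
    (contMDiffOn_symm_of_mem_maximalAtlas he).mdifferentiableOn (by simp)⟩

/-- The derivative of a chart at a point, as a continuous linear map on the tangent space. -/
def chartDeriv (e : OpenPartialHomeomorph M (EuclideanSpace ℝ (Fin d))) (z : M) :
    TangentSpace (𝓡 d) z →L[ℝ] EuclideanSpace ℝ (Fin d) :=
  mfderiv (𝓡 d) (𝓡 d) e z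

lemma chartDeriv_isInvertible {e : OpenPartialHomeomorph M (EuclideanSpace ℝ (Fin d))}
    (he : e ∈ IsManifold.maximalAtlas (𝓡 d) ∞ M) {z : M} (hz : z ∈ e.source) :
    (chartDeriv e z).IsInvertible :=
  ⟨(mdifferentiable_of_mem_maximalAtlas he).mfderiv hz, rfl⟩

/-- The frame `P z` read in the chart `e`: the matrix of `P z` with respect to the coordinate vector
fields of `e`. -/
def frameAt (P : FrameField d M) (e : OpenPartialHomeomorph M (EuclideanSpace ℝ (Fin d))) (z : M) :
    EuclideanSpace ℝ (Fin d) →L[ℝ] EuclideanSpace ℝ (Fin d) :=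
  (P z : TangentSpace (𝓡 d) z →L[ℝ] EuclideanSpace ℝ (Fin d)) ∘L (chartDeriv e z).inverse

lemma frameAt_isInvertible (P : FrameField d M)
    {e : OpenPartialHomeomorph M (EuclideanSpace ℝ (Fin d))}
    (he : e ∈ IsManifold.maximalAtlas (𝓡 d) ∞ M) {z : M} (hz : z ∈ e.source) :
    (frameAt P e z).IsInvertible := by
  obtain ⟨L, hL⟩ := chartDeriv_isInvertible he hz
  rw [frameAt, ← hL, ContinuousLinearMap.inverse_equiv]
  exact ⟨L.symm.trans (P z), rfl⟩

/-- The chain rule for the derivative of a map read in two charts. -/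
lemma chartDeriv_comp_mfderiv {e e' : OpenPartialHomeomorph M (EuclideanSpace ℝ (Fin d))}
    (he : e ∈ IsManifold.maximalAtlas (𝓡 d) ∞ M) (he' : e' ∈ IsManifold.maximalAtlas (𝓡 d) ∞ M)
    {f : M → M} {z : M} (hz : z ∈ e.source) (hfz : f z ∈ e'.source)
    (hf : MDifferentiableAt (𝓡 d) (𝓡 d) f z) :
    (chartDeriv e' (f z)) ∘L (mfderiv (𝓡 d) (𝓡 d) f z) =
      (fderiv ℝ (e' ∘ f ∘ e.symm) (e z)) ∘L (chartDeriv e z) := by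
  have hE := mdifferentiable_of_mem_maximalAtlas he
  have hE' := mdifferentiable_of_mem_maximalAtlas he'
  have h1 : mfderiv (𝓡 d) (𝓡 d) (e' ∘ f) z =
      (mfderiv (𝓡 d) (𝓡 d) e' (f z)).comp (mfderiv (𝓡 d) (𝓡 d) f z) :=
    mfderiv_comp z (hE'.mdifferentiableAt hfz) hf
  have hsymm : e.symm (e z) = z := e.left_inv hz
  have hF : MDifferentiableAt (𝓡 d) (𝓡 d) (e' ∘ f ∘ e.symm) (e z) := by
    refine MDifferentiableAt.comp (I' := 𝓡 d) (e z) ?_ ?_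
    · rw [comp_apply, hsymm]; exact hE'.mdifferentiableAt hfz
    · refine MDifferentiableAt.comp (I' := 𝓡 d) (e z) ?_
        (hE.mdifferentiableAt_symm (e.map_source hz))
      rwa [hsymm]
  have h2 : mfderiv (𝓡 d) (𝓡 d) ((e' ∘ f ∘ e.symm) ∘ e) z =
      (mfderiv (𝓡 d) (𝓡 d) (e' ∘ f ∘ e.symm) (e z)).comp (mfderiv (𝓡 d) (𝓡 d) e z) :=
    mfderiv_comp z hF (hE.mdifferentiableAt hz)
  have h3 : (e' ∘ f ∘ e.symm) ∘ e =ᶠ[𝓝 z] e' ∘ f := by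
    filter_upwards [e.open_source.mem_nhds hz] with w hw
    simp [e.left_inv hw]
  rw [h3.mfderiv_eq, h1, mfderiv_eq_fderiv] at h2
  exact h2

variable {r : ℕ∞}

/-- The cocycle `J_P f` as a map into the space of continuous linear maps. -/
def jac (hr : 1 ≤ r) (P : FrameField d M) (f : M ≃ₘ^(r : WithTop ℕ∞)⟮𝓡 d, 𝓡 d⟯ M) (x : M) :
    EuclideanSpace ℝ (Fin d) →L[ℝ] EuclideanSpace ℝ (Fin d) :=
  (frameJacobian hr P f x : EuclideanSpace ℝ (Fin d) →L[ℝ] EuclideanSpace ℝ (Fin d))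

lemma jac_injective (hr : 1 ≤ r) (P : FrameField d M)
    (f : M ≃ₘ^(r : WithTop ℕ∞)⟮𝓡 d, 𝓡 d⟯ M) (x : M) : Injective (jac hr P f x) :=
  (frameJacobian hr P f x).injective

lemma diffeo_mdifferentiableAt (hr : 1 ≤ r) (f : M ≃ₘ^(r : WithTop ℕ∞)⟮𝓡 d, 𝓡 d⟯ M) (x : M) :
    MDifferentiableAt (𝓡 d) (𝓡 d) f x :=
  f.mdifferentiable (by exact_mod_cast (one_pos.trans_le hr).ne') x

lemma jac_eq (hr : 1 ≤ r) (P : FrameField d M) (f : M ≃ₘ^(r : WithTop ℕ∞)⟮𝓡 d, 𝓡 d⟯ M) (x : M) :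
    jac hr P f x = (P (f x) : _ →L[ℝ] _) ∘L (mfderiv (𝓡 d) (𝓡 d) f x) ∘L
      ((P x).symm : _ →L[ℝ] _) := rfl

lemma jac_comp_frameAt (hr : 1 ≤ r) (P : FrameField d M)
    {e e' : OpenPartialHomeomorph M (EuclideanSpace ℝ (Fin d))}
    (he : e ∈ IsManifold.maximalAtlas (𝓡 d) ∞ M) (he' : e' ∈ IsManifold.maximalAtlas (𝓡 d) ∞ M)
    (f : M ≃ₘ^(r : WithTop ℕ∞)⟮𝓡 d, 𝓡 d⟯ M) {z : M} (hz : z ∈ e.source) (hfz : f z ∈ e'.source) :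
    jac hr P f z ∘L frameAt P e z =
      frameAt P e' (f z) ∘L (fderiv ℝ (e' ∘ f ∘ e.symm) (e z)) := by
  obtain ⟨L, hL⟩ := chartDeriv_isInvertible he hz
  obtain ⟨L', hL'⟩ := chartDeriv_isInvertible he' hfz
  have h := chartDeriv_comp_mfderiv he he' hz hfz (diffeo_mdifferentiableAt hr f z)
  rw [jac_eq, frameAt, frameAt, ← hL, ← hL', ContinuousLinearMap.inverse_equiv,
    ContinuousLinearMap.inverse_equiv]
  rw [← hL, ← hL'] at h
  ext1 v
  have h1 := congrArg (fun A => A (L.symm v)) h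
  simp only [ContinuousLinearMap.comp_apply, ContinuousLinearEquiv.coe_coe,
    ContinuousLinearEquiv.symm_apply_apply, ContinuousLinearEquiv.apply_symm_apply] at h1 ⊢
  rw [← h1, ContinuousLinearEquiv.symm_apply_apply]

/-- The cocycle in terms of the derivative of `f` read in charts; as these expressions depend
continuously on the derivative and measurably on the point, all analysis of the cocycle goes through
this formula. -/
lemma jac_eq_chart (hr : 1 ≤ r) (P : FrameField d M)
    {e e' : OpenPartialHomeomorph M (EuclideanSpace ℝ (Fin d))}
    (he : e ∈ IsManifold.maximalAtlas (𝓡 d) ∞ M) (he' : e' ∈ IsManifold.maximalAtlas (𝓡 d) ∞ M)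
    (f : M ≃ₘ^(r : WithTop ℕ∞)⟮𝓡 d, 𝓡 d⟯ M) {z : M} (hz : z ∈ e.source) (hfz : f z ∈ e'.source) :
    jac hr P f z = frameAt P e' (f z) ∘L (fderiv ℝ (e' ∘ f ∘ e.symm) (e z)) ∘L
      (frameAt P e z).inverse := by
  have h := jac_comp_frameAt hr P he he' f hz hfz
  obtain ⟨L, hL⟩ := frameAt_isInvertible P he hz
  rw [← ContinuousLinearMap.comp_assoc, ← h, ← hL, ContinuousLinearMap.inverse_equiv]
  ext1 v
  simp

lemma measurable_clm_of_forall_apply {X : Type*} [MeasurableSpace X]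
    {A : X → EuclideanSpace ℝ (Fin d) →L[ℝ] EuclideanSpace ℝ (Fin d)}
    (h : ∀ v, Measurable fun x => A x v) : Measurable A := by
  have h1 : A = fun x => ∑ i, (EuclideanSpace.proj i : EuclideanSpace ℝ (Fin d) →L[ℝ] ℝ).smulRight
      (A x (EuclideanSpace.single i (1 : ℝ))) := by
    ext1 x
    ext1 v
    conv_lhs => rw [← (EuclideanSpace.basisFun (Fin d) ℝ).sum_repr v]
    simp
  rw [h1]
  refine Finset.measurable_sum _ fun i _ => ?_
  have h2 : Continuous (fun w : EuclideanSpace ℝ (Fin d) =>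
      (EuclideanSpace.proj i : EuclideanSpace ℝ (Fin d) →L[ℝ] ℝ).smulRight w) :=
    ((ContinuousLinearMap.smulRightL ℝ (EuclideanSpace ℝ (Fin d)) (EuclideanSpace ℝ (Fin d)))
      (EuclideanSpace.proj i)).continuous
  exact h2.measurable.comp (h _)

lemma measurable_clm_inverse : Measurable
    (ContinuousLinearMap.inverse : (EuclideanSpace ℝ (Fin d) →L[ℝ] EuclideanSpace ℝ (Fin d)) →
      (EuclideanSpace ℝ (Fin d) →L[ℝ] EuclideanSpace ℝ (Fin d))) := by
  classical
  have hopen : IsOpen (range ((↑) : (EuclideanSpace ℝ (Fin d) ≃L[ℝ] EuclideanSpace ℝ (Fin d)) →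
      (EuclideanSpace ℝ (Fin d) →L[ℝ] EuclideanSpace ℝ (Fin d)))) :=
    ContinuousLinearEquiv.isOpen
  set s := range ((↑) : (EuclideanSpace ℝ (Fin d) ≃L[ℝ] EuclideanSpace ℝ (Fin d)) →
      (EuclideanSpace ℝ (Fin d) →L[ℝ] EuclideanSpace ℝ (Fin d))) with hs
  have h1 : ContinuousOn ContinuousLinearMap.inverse s := by
    rintro _ ⟨L, rfl⟩
    exact (contDiffAt_map_inverse (n := 0) L).continuousAt.continuousWithinAt
  have h2 : Measurable (s.piecewise ContinuousLinearMap.inverse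
      (0 : (EuclideanSpace ℝ (Fin d) →L[ℝ] EuclideanSpace ℝ (Fin d)) →
      (EuclideanSpace ℝ (Fin d) →L[ℝ] EuclideanSpace ℝ (Fin d)))) :=
    h1.measurable_piecewise continuousOn_const hopen.measurableSet
  convert! h2 using 1
  ext1 A
  by_cases hA : A ∈ s
  · rw [piecewise_eq_of_mem _ _ _ hA]
  · rw [piecewise_eq_of_notMem _ _ _ hA, ContinuousLinearMap.inverse_of_not_isInvertible]
    · rfl
    · rintro ⟨L, rfl⟩; exact hA ⟨L, rfl⟩

variable [MeasurableSpace M] [BorelSpace M]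

lemma measurable_frameAt {P : FrameField d M} (hP : P ∈ measurableFrames d M)
    {e : OpenPartialHomeomorph M (EuclideanSpace ℝ (Fin d))}
    (he : e ∈ IsManifold.maximalAtlas (𝓡 d) ∞ M) :
    Measurable (e.source.indicator (frameAt P e)) := by
  classical
  refine measurable_clm_of_forall_apply fun v => ?_
  have hE := mdifferentiable_of_mem_maximalAtlas he
  let _ : MeasurableSpace (TangentBundle (𝓡 d) M) := borel _
  have : BorelSpace (TangentBundle (𝓡 d) M) := ⟨rfl⟩
  let σ : e.source → TangentBundle (𝓡 d) M := fun z =>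
    ⟨z.1, (chartDeriv e z.1).inverse v⟩
  have hσ : Continuous σ := by
    have h1 := (contMDiffOn_symm_of_mem_maximalAtlas he).continuousOn_tangentMapWithin
      (by simp) e.open_target.uniqueMDiffOn
    have h2 : Continuous (fun z : e.source =>
        (⟨e z.1, v⟩ : TangentBundle (𝓡 d) (EuclideanSpace ℝ (Fin d)))) := by
      have h3 : Continuous (fun z : e.source => e z.1) :=
        e.continuousOn.comp_continuous continuous_subtype_val fun z => z.2
      exact (tangentBundleModelSpaceHomeomorph (𝓡 d)).symm.continuous.comp
        (h3.prodMk continuous_const)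
    have h4 := h1.comp_continuous h2 fun z => e.map_source z.2
    convert! h4 using 1
    ext1 z
    have hz := e.map_source z.2
    have hmf : mfderivWithin (𝓡 d) (𝓡 d) e.symm e.target (e z.1) =
        mfderiv (𝓡 d) (𝓡 d) e.symm (e z.1) :=
      mfderivWithin_of_isOpen e.open_target hz
    obtain ⟨L, hL⟩ := chartDeriv_isInvertible he z.2
    have key : (chartDeriv e z.1).inverse v = mfderiv (𝓡 d) (𝓡 d) e.symm (e z.1) v := by
      have h5 := hE.comp_symm_deriv hz
      rw [e.left_inv z.2] at h5
      have h6 := congrArg (fun A => A v) h5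
      change chartDeriv e z.1 (mfderiv (𝓡 d) (𝓡 d) e.symm (e z.1) v) = v at h6
      rw [← hL, ContinuousLinearMap.inverse_equiv]
      rw [← hL] at h6
      exact (L.symm_apply_eq).2 h6.symm
    simp only [σ]
    refine Bundle.TotalSpace.ext (e.left_inv z.2).symm ?_
    refine heq_of_eq (key.trans ?_)
    exact congrArg (fun A => A v) hmf.symm
  have hPm : Measurable (fun w : TangentBundle (𝓡 d) M => P w.proj w.snd) := hP
  have h7 : Measurable (fun z : e.source => frameAt P e z.1 v) := hPm.comp hσ.measurable
  have h8 : (fun x => e.source.indicator (frameAt P e) x v) =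
      e.source.indicator fun x => frameAt P e x v := by
    ext1 x
    by_cases hx : x ∈ e.source <;> simp [hx]
  rw [h8]
  refine measurable_of_restrict_of_restrict_compl e.open_source.measurableSet ?_ ?_
  · convert! h7 using 1
    ext1 z
    simp
  · convert! (measurable_const : Measurable fun _ : ↥(e.sourceᶜ) =>
      (0 : EuclideanSpace ℝ (Fin d))) using 1
    ext1 z
    exact indicator_of_notMem z.2 _

lemma measurable_fderiv_chart {e e' : OpenPartialHomeomorph M (EuclideanSpace ℝ (Fin d))}
    (f : M → M) : Measurable (e.source.indicator
      fun z => fderiv ℝ (e' ∘ f ∘ e.symm) (e z)) := by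
  have h1 : Measurable (fun z : e.source => fderiv ℝ (e' ∘ f ∘ e.symm) (e z)) :=
    (measurable_fderiv ℝ _).comp (e.continuousOn.comp_continuous continuous_subtype_val
      fun z => z.2).measurable
  classical
  refine measurable_of_restrict_of_restrict_compl e.open_source.measurableSet ?_ ?_
  · convert! h1 using 1
    ext1 z
    simp
  · convert! (measurable_const : Measurable fun _ : ↥(e.sourceᶜ) =>
      (0 : EuclideanSpace ℝ (Fin d) →L[ℝ] EuclideanSpace ℝ (Fin d))) using 1
    ext1 z
    exact indicator_of_notMem z.2 _

lemma measurable_jac [SecondCountableTopology M] (hr : 1 ≤ r) {P : FrameField d M}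
    (hP : P ∈ measurableFrames d M) (f : M ≃ₘ^(r : WithTop ℕ∞)⟮𝓡 d, 𝓡 d⟯ M) :
    Measurable (jac hr P f) := by
  classical
  let U : M → Set M := fun x => (chartAt (EuclideanSpace ℝ (Fin d)) x).source ∩
    f ⁻¹' (chartAt (EuclideanSpace ℝ (Fin d)) (f x)).source
  have hUo : ∀ x, IsOpen (U x) := fun x =>
    (chartAt _ x).open_source.inter ((chartAt _ (f x)).open_source.preimage f.continuous)
  obtain ⟨T, hT, hTU⟩ := TopologicalSpace.isOpen_iUnion_countable U hUo
  have hcover : ⋃ x ∈ T, U x = univ := by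
    rw [hTU, eq_univ_iff_forall]
    exact fun x => mem_iUnion.2 ⟨x, mem_chart_source _ x, mem_chart_source _ (f x)⟩
  have hloc : ∀ x, Measurable ((U x).domRestrict (jac hr P f)) := by
    intro x
    have hA := measurable_frameAt hP (chartAt_mem_maximalAtlas x)
    have hB := (measurable_frameAt hP (chartAt_mem_maximalAtlas (f x))).comp f.continuous.measurable
    have hC := measurable_fderiv_chart (e := chartAt (EuclideanSpace ℝ (Fin d)) x)
      (e' := chartAt (EuclideanSpace ℝ (Fin d)) (f x)) f
    have hc : Continuous (fun q : (EuclideanSpace ℝ (Fin d) →L[ℝ] EuclideanSpace ℝ (Fin d)) ×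
        (EuclideanSpace ℝ (Fin d) →L[ℝ] EuclideanSpace ℝ (Fin d)) => q.1 ∘L q.2) := by fun_prop
    have h1 := hc.measurable.comp (hB.prodMk
      (hc.measurable.comp (hC.prodMk (measurable_clm_inverse.comp hA))))
    convert! h1.comp (measurable_subtype_coe (p := (· ∈ U x))) using 1
    ext1 z
    have hz1 := z.2.1
    have hz2 : f z.1 ∈ (chartAt (EuclideanSpace ℝ (Fin d)) (f x)).source := z.2.2
    rw [domRestrict_apply, jac_eq_chart hr P (chartAt_mem_maximalAtlas x)
      (chartAt_mem_maximalAtlas (f x)) f hz1 hz2]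
    simp [hz1, hz2]
  intro s hs
  have h2 : jac hr P f ⁻¹' s = ⋃ x ∈ T, Subtype.val '' ((U x).domRestrict (jac hr P f) ⁻¹' s) := by
    ext z
    simp only [mem_preimage, mem_iUnion, mem_image, Subtype.exists, domRestrict_apply,
      exists_and_right, exists_eq_right]
    constructor
    · intro hz
      have : z ∈ ⋃ x ∈ T, U x := by rw [hcover]; trivial
      obtain ⟨x, hx, hzx⟩ := mem_iUnion₂.1 this
      exact ⟨x, hx, hzx, hz⟩
    · rintro ⟨x, hx, hzx, hz⟩
      exact hz
  rw [h2]
  exact MeasurableSet.biUnion hT fun x _ =>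
    MeasurableSet.subtype_image (hUo x).measurableSet (hloc x hs)

lemma isFiniteMeasure_normalizedVolume (g : SmoothRiemannianMetric d M) :
    IsFiniteMeasure (normalizedVolume g) := by
  refine ⟨?_⟩
  rw [normalizedVolume, Measure.smul_apply, smul_eq_mul]
  exact (ENNReal.inv_mul_le_one _).trans_lt ENNReal.one_lt_top

/-- The diffeomorphisms outside of `𝓡_P` are those whose fibre maps almost all fix a common
measure. -/
lemma notMem_noProductInvariantMeasure_iff [SecondCountableTopology M] (hr : 1 ≤ r)
    {g : SmoothRiemannianMetric d M} {P : FrameField d M} (hP : P ∈ measurableFrames d M)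
    (f : ConservativeDiffeo r g) :
    f ∉ noProductInvariantMeasure hr g P ↔
      ∃ ν : ProbabilityMeasure (ℙ ℝ (EuclideanSpace ℝ (Fin d))), ∀ᵐ x ∂normalizedVolume g,
        FixesMeasure (jac hr P f.1 x) (ν : Measure (ℙ ℝ (EuclideanSpace ℝ (Fin d)))) := by
  have := isFiniteMeasure_normalizedVolume g
  have hskew : projectiveSkewProduct f.1 (frameJacobian hr P f.1) =
      fun p => (f.1 p.1, projAct (jac hr P f.1 p.1) p.2) := by
    ext1 p
    rw [projAct, dif_pos (jac_injective hr P f.1 p.1)]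
    rfl
  rw [noProductInvariantMeasure, mem_ofPred_eq, not_not, hskew]
  constructor
  · rintro ⟨ν, hν, h⟩
    have key := ae_fixesMeasure_of_measurePreserving f.1.toHomeomorph.toMeasurableEquiv f.2 h
    exact ⟨⟨ν, hν⟩, key⟩
  · rintro ⟨ν, h⟩
    exact ⟨ν, inferInstance, measurePreserving_of_ae_fixesMeasure f.2 (measurable_jac hr hP f.1)
      (jac_injective hr P f.1) h⟩

end FramesInCharts

/-! ### Openness -/

section Openness

open Filter Topology Function

variable {d : ℕ} {M : Type*} [TopologicalSpace M] [ChartedSpace (EuclideanSpace ℝ (Fin d)) M]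
  [IsManifold (𝓡 d) ∞ M] [MeasurableSpace M] {r : ℕ∞} {g : SmoothRiemannianMetric d M}

lemma self_mem_crSubbasic (f : ConservativeDiffeo r g) {x y : M} {K : Set M} (k : ℕ) {ε : ℝ}
    (hfK : MapsTo f.1 K (chartAt (EuclideanSpace ℝ (Fin d)) y).source) (hε : 0 < ε) :
    f ∈ crSubbasic f x y K k ε :=
  ⟨hfK, fun p _ j _ => by rw [sub_self, norm_zero]; exact hε⟩

lemma isOpen_crSubbasic (f : ConservativeDiffeo r g) {x y : M} {K : Set M} {k : ℕ} {ε : ℝ}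
    (hK : IsCompact K) (hKx : K ⊆ (chartAt (EuclideanSpace ℝ (Fin d)) x).source)
    (hfK : MapsTo f.1 K (chartAt (EuclideanSpace ℝ (Fin d)) y).source) (hk : (k : ℕ∞) ≤ r)
    (hε : 0 < ε) : IsOpen (crSubbasic f x y K k ε) :=
  TopologicalSpace.isOpen_generateFrom_of_mem ⟨f, x, y, K, k, ε, hK, hKx, hfK, hk, hε, rfl⟩

lemma norm_sub_le_iteratedFDeriv_zero {F : Type*} [NormedAddCommGroup F] [NormedSpace ℝ F]
    (u v : F → F) (a : F) :
    ‖u a - v a‖ ≤ ‖iteratedFDeriv ℝ 0 u a - iteratedFDeriv ℝ 0 v a‖ := by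
  have := (iteratedFDeriv ℝ 0 u a - iteratedFDeriv ℝ 0 v a).le_opNorm 0
  simpa using this

lemma norm_fderiv_sub_le_iteratedFDeriv_one {F : Type*} [NormedAddCommGroup F] [NormedSpace ℝ F]
    (u v : F → F) (a : F) :
    ‖fderiv ℝ u a - fderiv ℝ v a‖ ≤ ‖iteratedFDeriv ℝ 1 u a - iteratedFDeriv ℝ 1 v a‖ := by
  refine ContinuousLinearMap.opNorm_le_bound _ (norm_nonneg _) fun w => ?_
  have := (iteratedFDeriv ℝ 1 u a - iteratedFDeriv ℝ 1 v a).le_opNorm fun _ => w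
  simpa [iteratedFDeriv_one_apply] using this

variable [BorelSpace M] [T2Space M] [SecondCountableTopology M]

/-- The complement is closed under `C¹` convergence on countably many compact sets covering `M`: the
invariant measures subconverge weakly, and the cocycles converge almost everywhere. -/
theorem isOpen_noProductInvariantMeasure [Nonempty M] (hr : 1 ≤ r) {P : FrameField d M}
    (hP : P ∈ measurableFrames d M) : IsOpen (noProductInvariantMeasure hr g P) := by
  have := isFiniteMeasure_normalizedVolume g
  have : LocallyCompactSpace M := Manifold.locallyCompact_of_finiteDimensional (𝓡 d)
  have : TopologicalSpace.MetrizableSpace M :=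
    TopologicalSpace.metrizableSpace_of_t3_secondCountable M
  rw [isOpen_iff_forall_mem_open]
  intro f hf
  by_contra! hcon
  -- countably many compact sets cover `M`, each of which is mapped by `f` into a single chart
  have hK : ∀ x : M, ∃ K : Set M, IsCompact K ∧ K ∈ 𝓝 x ∧
      K ⊆ (chartAt (EuclideanSpace ℝ (Fin d)) x).source ∩
        f.1 ⁻¹' (chartAt (EuclideanSpace ℝ (Fin d)) (f.1 x)).source := by
    intro x
    have hU : (chartAt (EuclideanSpace ℝ (Fin d)) x).source ∩
        f.1 ⁻¹' (chartAt (EuclideanSpace ℝ (Fin d)) (f.1 x)).source ∈ 𝓝 x :=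
      (((chartAt _ x).open_source.inter
        ((chartAt _ (f.1 x)).open_source.preimage f.1.continuous))).mem_nhds
        ⟨mem_chart_source _ x, mem_chart_source _ (f.1 x)⟩
    obtain ⟨K, hKn, hKU, hKc⟩ := local_compact_nhds hU
    exact ⟨K, hKc, hKn, hKU⟩
  choose K hKc hKn hKU using hK
  obtain ⟨T, hTc, hTU⟩ := TopologicalSpace.countable_cover_nhds hKn
  have hTne : T.Nonempty := by
    rw [nonempty_iff_ne_empty]
    rintro rfl
    obtain ⟨x⟩ := ‹Nonempty M›
    have : x ∈ ⋃ x ∈ (∅ : Set M), K x := by rw [hTU]; trivial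
    simp at this
  obtain ⟨s, hs⟩ := hTc.exists_eq_range hTne
  let U : ℕ → Set (ConservativeDiffeo r g) := fun n => ⋂ i ∈ Finset.range (n + 1),
    crSubbasic f (s i) (f.1 (s i)) (K (s i)) 1 (1 / ((n : ℝ) + 1))
  have hfK : ∀ x, MapsTo f.1 (K x) (chartAt (EuclideanSpace ℝ (Fin d)) (f.1 x)).source :=
    fun x p hp => (hKU x hp).2
  have hUo : ∀ n, IsOpen (U n) := fun n => isOpen_biInter_finset fun i _ =>
    isOpen_crSubbasic f (hKc _) (fun p hp => (hKU _ hp).1) (hfK _) (by simpa using hr)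
      (by positivity)
  have hUf : ∀ n, f ∈ U n := fun n => mem_iInter₂.2 fun i _ =>
    self_mem_crSubbasic f 1 (hfK _) (by positivity)
  have hex : ∀ n, ∃ h ∈ U n, h ∉ noProductInvariantMeasure hr g P := by
    intro n
    by_contra! hn
    exact hcon (U n) hn (hUo n) (hUf n)
  choose h hhU hhN using hex
  simp only [notMem_noProductInvariantMeasure_iff hr hP] at hhN
  choose ν hν using hhN
  obtain ⟨ν₀, φ, hφ, hνφ⟩ := CompactSpace.tendsto_subseq ν
  refine (notMem_noProductInvariantMeasure_iff hr hP f).2 ⟨ν₀, ?_⟩ hf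
  have hone : Tendsto (fun n : ℕ => 1 / ((n : ℝ) + 1)) atTop (𝓝 0) :=
    tendsto_one_div_add_atTop_nhds_zero_nat
  have key : ∀ i, ∀ᵐ p ∂normalizedVolume g, p ∈ K (s i) → FixesMeasure (jac hr P f.1 p)
      (ν₀ : Measure (ℙ ℝ (EuclideanSpace ℝ (Fin d)))) := by
    intro i
    set e := chartAt (EuclideanSpace ℝ (Fin d)) (s i) with he
    set e' := chartAt (EuclideanSpace ℝ (Fin d)) (f.1 (s i)) with he'
    have hmem : ∀ n, i ≤ n → h n ∈
        crSubbasic f (s i) (f.1 (s i)) (K (s i)) 1 (1 / ((n : ℝ) + 1)) := fun n hn =>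
      mem_iInter₂.1 (hhU n) i (Finset.mem_range.2 (by omega))
    have hsrc : ∀ p ∈ K (s i), ∀ n, i ≤ n → (h n).1 p ∈ e'.source := fun p hp n hn =>
      (hmem n hn).1 hp
    have hval : ∀ p ∈ K (s i), Tendsto (fun n => (h n).1 p) atTop (𝓝 (f.1 p)) := by
      intro p hp
      have hpe : e.symm (e p) = p := e.left_inv (hKU _ hp).1
      have h1 : Tendsto (fun n => e' ((h n).1 p)) atTop (𝓝 (e' (f.1 p))) := by
        rw [tendsto_iff_norm_sub_tendsto_zero]
        refine squeeze_zero' (Eventually.of_forall fun _ => norm_nonneg _) ?_ hone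
        filter_upwards [eventually_ge_atTop i] with n hn
        have h2 := norm_sub_le_iteratedFDeriv_zero (chartExpr (s i) (f.1 (s i)) (h n).1)
          (chartExpr (s i) (f.1 (s i)) f.1) (e p)
        have h3 := (hmem n hn).2 p hp 0 (by norm_num)
        have h4 : ∀ k : M → M, chartExpr (s i) (f.1 (s i)) k (e p) = e' (k p) := fun k => by
          simp only [chartExpr, comp_apply, ← he, ← he', hpe]
        rw [h4, h4] at h2
        exact (h2.trans_lt h3).le
      have h5 := ((e'.continuousAt_symm (e'.map_source (hfK _ hp))).tendsto.comp h1)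
      rw [e'.left_inv (hfK _ hp)] at h5
      refine h5.congr' ?_
      filter_upwards [eventually_ge_atTop i] with n hn
      exact e'.left_inv (hsrc p hp n hn)
    have hder : ∀ p ∈ K (s i), Tendsto (fun n => fderiv ℝ (e' ∘ (h n).1 ∘ e.symm) (e p)) atTop
        (𝓝 (fderiv ℝ (e' ∘ f.1 ∘ e.symm) (e p))) := by
      intro p hp
      rw [tendsto_iff_norm_sub_tendsto_zero]
      refine squeeze_zero' (Eventually.of_forall fun _ => norm_nonneg _) ?_ hone
      filter_upwards [eventually_ge_atTop i] with n hn
      exact ((norm_fderiv_sub_le_iteratedFDeriv_one _ _ _).trans_lt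
        ((hmem n hn).2 p hp 1 le_rfl)).le
    obtain ⟨ψ, hψ, hae⟩ := exists_subseq_ae_tendsto_comp (m := normalizedVolume g)
      (fun n => (h (φ n)).2) f.2 (hKc (s i)).measurableSet
      (fun p hp => (hval p hp).comp hφ.tendsto_atTop)
      (measurable_frameAt hP (chartAt_mem_maximalAtlas (f.1 (s i))))
    filter_upwards [hae, ae_all_iff.2 hν] with p hp hfix hpK
    have hcomp : Tendsto (fun n => φ (ψ n)) atTop atTop :=
      hφ.tendsto_atTop.comp hψ.tendsto_atTop
    refine fixesMeasure_of_tendsto (A := fun n => jac hr P (h (φ (ψ n))).1 p)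
      (jac_injective hr P f.1 p) ?_ (hνφ.comp hψ.tendsto_atTop) fun n => hfix _
    have h1 := tendsto_clm_comp (hp hpK) (tendsto_clm_comp ((hder p hpK).comp hcomp)
      (tendsto_const_nhds (x := (frameAt P e p).inverse)))
    rw [indicator_of_mem (hfK _ hpK), ← jac_eq_chart hr P (chartAt_mem_maximalAtlas (s i))
      (chartAt_mem_maximalAtlas (f.1 (s i))) f.1 (hKU _ hpK).1 (hfK _ hpK)] at h1
    refine h1.congr' ?_
    filter_upwards [hcomp.eventually_ge_atTop i] with n hn
    have h2 := hsrc p hpK _ hn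
    rw [indicator_of_mem h2, jac_eq_chart hr P (chartAt_mem_maximalAtlas (s i))
      (chartAt_mem_maximalAtlas (f.1 (s i))) (h (φ (ψ n))).1 (hKU _ hpK).1 h2]
    rfl
  filter_upwards [ae_all_iff.2 key] with p hp
  have : p ∈ ⋃ x ∈ T, K x := by rw [hTU]; trivial
  obtain ⟨x, hx, hpx⟩ := mem_iUnion₂.1 this
  rw [hs] at hx
  obtain ⟨i, rfl⟩ := hx
  exact hp i hpx

end Openness

/-! ### The Riemannian volume in charts -/

section RiemannianVolume

open Filter Topology Function

variable {d : ℕ} {M : Type*} [TopologicalSpace M] [ChartedSpace (EuclideanSpace ℝ (Fin d)) M]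
  [IsManifold (𝓡 d) ∞ M]

/-- The metric at `z` as a bilinear form in the coordinates given by the chart `e`. -/
def metricAt (g : SmoothRiemannianMetric d M)
    (e : OpenPartialHomeomorph M (EuclideanSpace ℝ (Fin d))) (z : M) :
    LinearMap.BilinForm ℝ (EuclideanSpace ℝ (Fin d)) :=
  LinearMap.mk₂ ℝ
    (fun v w => g.inner z ((chartDeriv e z).inverse v) ((chartDeriv e z).inverse w))
    (fun _ _ _ => by simp) (fun _ _ _ => by simp) (fun _ _ _ => by simp) (fun _ _ _ => by simp)

/-- The matrix of the metric at `z` in the coordinates given by the chart `e`. -/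
def metricMatrix (g : SmoothRiemannianMetric d M)
    (e : OpenPartialHomeomorph M (EuclideanSpace ℝ (Fin d))) (z : M) :
    Matrix (Fin d) (Fin d) ℝ :=
  LinearMap.BilinForm.toMatrix (EuclideanSpace.basisFun (Fin d) ℝ).toBasis (metricAt g e z)

/-- The density of the Riemannian volume at `z` with respect to Lebesgue measure in the coordinates
given by the chart `e`. -/
def chartDensity (g : SmoothRiemannianMetric d M)
    (e : OpenPartialHomeomorph M (EuclideanSpace ℝ (Fin d))) (z : M) : ℝ :=
  Real.sqrt (metricMatrix g e z).det

lemma metricMatrix_apply (g : SmoothRiemannianMetric d M)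
    (e : OpenPartialHomeomorph M (EuclideanSpace ℝ (Fin d))) (z : M) (i j : Fin d) :
    metricMatrix g e z i j = g.inner z
      ((chartDeriv e z).inverse (EuclideanSpace.single i (1 : ℝ)))
      ((chartDeriv e z).inverse (EuclideanSpace.single j (1 : ℝ))) := by
  simp [metricMatrix, metricAt, LinearMap.BilinForm.toMatrix_apply]

variable {e e' : OpenPartialHomeomorph M (EuclideanSpace ℝ (Fin d))}

lemma chartDeriv_inverse_eq (he : e ∈ IsManifold.maximalAtlas (𝓡 d) ∞ M)
    {y : EuclideanSpace ℝ (Fin d)} (hy : y ∈ e.target) :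
    (chartDeriv e (e.symm y)).inverse = mfderiv (𝓡 d) (𝓡 d) e.symm y := by
  obtain ⟨L, hL⟩ := chartDeriv_isInvertible he (e.map_target hy)
  have h5 := (mdifferentiable_of_mem_maximalAtlas he).comp_symm_deriv hy
  change (chartDeriv e (e.symm y)) ∘L (mfderiv (𝓡 d) (𝓡 d) e.symm y) =
    ContinuousLinearMap.id ℝ _ at h5
  rw [← hL, ContinuousLinearMap.inverse_equiv]
  rw [← hL] at h5
  refine ContinuousLinearMap.ext fun v => ?_
  have h6 := congrArg (fun A => A v) h5
  exact (L.symm_apply_eq).2 h6.symm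

lemma metricMatrix_chartAt (g : SmoothRiemannianMetric d M) (x : M)
    {y : EuclideanSpace ℝ (Fin d)} (hy : y ∈ (chartAt (EuclideanSpace ℝ (Fin d)) x).target) :
    gramMatrix g x y = metricMatrix g (chartAt _ x) ((chartAt _ x).symm y) := by
  ext i j
  rw [metricMatrix_apply, chartDeriv_inverse_eq (chartAt_mem_maximalAtlas x) hy]
  rfl

lemma chartDeriv_eq_comp (he : e ∈ IsManifold.maximalAtlas (𝓡 d) ∞ M)
    (he' : e' ∈ IsManifold.maximalAtlas (𝓡 d) ∞ M) {z : M} (hz : z ∈ e.source)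
    (hz' : z ∈ e'.source) :
    chartDeriv e' z = fderiv ℝ (e' ∘ e.symm) (e z) ∘L chartDeriv e z := by
  have h := chartDeriv_comp_mfderiv he he' (f := id) hz hz' mdifferentiableAt_id
  rw [mfderiv_id] at h
  exact h

lemma metricAt_eq_comp (g : SmoothRiemannianMetric d M)
    (he : e ∈ IsManifold.maximalAtlas (𝓡 d) ∞ M) (he' : e' ∈ IsManifold.maximalAtlas (𝓡 d) ∞ M)
    {z : M} (hz : z ∈ e.source) (hz' : z ∈ e'.source) :
    metricAt g e z = (metricAt g e' z).comp (fderiv ℝ (e' ∘ e.symm) (e z)).toLinearMap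
      (fderiv ℝ (e' ∘ e.symm) (e z)).toLinearMap := by
  have h := chartDeriv_eq_comp he he' hz hz'
  obtain ⟨L, hL⟩ := chartDeriv_isInvertible he hz
  obtain ⟨L', hL'⟩ := chartDeriv_isInvertible he' hz'
  have key : ∀ v, (chartDeriv e' z).inverse (fderiv ℝ (e' ∘ e.symm) (e z) v) =
      (chartDeriv e z).inverse v := by
    intro v
    have h1 := congrArg (fun A => A (L.symm v)) h
    rw [← hL, ← hL'] at h1
    rw [← hL, ← hL', ContinuousLinearMap.inverse_equiv, ContinuousLinearMap.inverse_equiv]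
    simp only [ContinuousLinearMap.comp_apply, ContinuousLinearEquiv.coe_coe,
      ContinuousLinearEquiv.apply_symm_apply] at h1 ⊢
    rw [← h1, L'.symm_apply_apply]
  refine LinearMap.ext₂ fun v w => ?_
  change g.inner z _ _ = g.inner z ((chartDeriv e' z).inverse _) ((chartDeriv e' z).inverse _)
  exact (congrArg₂ (fun a b => g.inner z a b) (key v) (key w)).symm

/-- The transformation rule for the density of the volume. -/
lemma chartDensity_eq_mul (g : SmoothRiemannianMetric d M)
    (he : e ∈ IsManifold.maximalAtlas (𝓡 d) ∞ M) (he' : e' ∈ IsManifold.maximalAtlas (𝓡 d) ∞ M)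
    {z : M} (hz : z ∈ e.source) (hz' : z ∈ e'.source) :
    chartDensity g e z = |(fderiv ℝ (e' ∘ e.symm) (e z)).det| * chartDensity g e' z := by
  rw [chartDensity, chartDensity, metricMatrix, metricAt_eq_comp g he he' hz hz',
    LinearMap.BilinForm.toMatrix_comp (EuclideanSpace.basisFun (Fin d) ℝ).toBasis
      (EuclideanSpace.basisFun (Fin d) ℝ).toBasis, Matrix.det_mul, Matrix.det_mul,
    Matrix.det_transpose, LinearMap.det_toMatrix, ← metricMatrix, mul_right_comm,
    ← sq, Real.sqrt_mul (sq_nonneg _), Real.sqrt_sq_eq_abs]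

lemma posDef_metricMatrix (g : SmoothRiemannianMetric d M)
    (he : e ∈ IsManifold.maximalAtlas (𝓡 d) ∞ M) {z : M} (hz : z ∈ e.source) :
    (metricMatrix g e z).PosDef := by
  obtain ⟨L, hL⟩ := chartDeriv_isInvertible he hz
  refine Matrix.PosDef.of_dotProduct_mulVec_pos ?_ fun {v} hv => ?_
  · ext i j
    simp only [Matrix.conjTranspose_apply, metricMatrix_apply, star_trivial]
    exact g.symm _ _ _
  · have h1 := LinearMap.BilinForm.apply_eq_dotProduct_toMatrix_mulVec
      (EuclideanSpace.basisFun (Fin d) ℝ).toBasis (metricAt g e z) (WithLp.toLp 2 v)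
      (WithLp.toLp 2 v)
    have h2 : (⇑((EuclideanSpace.basisFun (Fin d) ℝ).toBasis.repr (WithLp.toLp 2 v)) :
        Fin d → ℝ) = v := by
      ext i; simp
    rw [h2] at h1
    rw [star_trivial, metricMatrix, ← h1]
    refine g.pos z _ fun h => hv ?_
    rw [← hL, ContinuousLinearMap.inverse_equiv] at h
    have h3 := (L.symm.map_eq_zero_iff).1 h
    exact congrArg WithLp.ofLp h3

lemma chartDensity_pos (g : SmoothRiemannianMetric d M)
    (he : e ∈ IsManifold.maximalAtlas (𝓡 d) ∞ M) {z : M} (hz : z ∈ e.source) :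
    0 < chartDensity g e z :=
  Real.sqrt_pos.2 (posDef_metricMatrix g he hz).det_pos

lemma contDiffOn_metricMatrix (g : SmoothRiemannianMetric d M)
    (he : e ∈ IsManifold.maximalAtlas (𝓡 d) ∞ M) (i j : Fin d) :
    ContDiffOn ℝ ∞ (fun y => metricMatrix g e (e.symm y) i j) e.target := by
  have hsec : ∀ i : Fin d, ContMDiffOn (𝓡 d) (𝓡 d).tangent ∞
      (fun y => TotalSpace.mk' (EuclideanSpace ℝ (Fin d)) (E := TangentSpace (𝓡 d)) (e.symm y)
        (mfderiv (𝓡 d) (𝓡 d) e.symm y (EuclideanSpace.single i (1 : ℝ)))) e.target := by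
    intro i
    have h1 := (contMDiffOn_symm_of_mem_maximalAtlas he).contMDiffOn_tangentMapWithin
      (m := ∞) (by simp) e.open_target.uniqueMDiffOn
    have h2 : ContMDiffOn (𝓡 d) (𝓡 d).tangent ∞ (fun y => (⟨y, EuclideanSpace.single i (1 : ℝ)⟩ :
        TangentBundle (𝓡 d) (EuclideanSpace ℝ (Fin d)))) e.target := by
      have : ContMDiff (𝓡 d) (𝓡 d).tangent ∞ (fun y => (⟨y, EuclideanSpace.single i (1 : ℝ)⟩ :
        TangentBundle (𝓡 d) (EuclideanSpace ℝ (Fin d)))) :=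
        (contMDiff_vectorSpace_iff_contDiff (V := fun _ => EuclideanSpace.single i (1 : ℝ))).2
          contDiff_const
      exact this.contMDiffOn
    refine (h1.comp h2 fun y hy => hy).congr fun y hy => ?_
    simp only [tangentMapWithin, comp_apply, mfderivWithin_of_isOpen e.open_target hy]
  have h3 : ContMDiffOn (𝓡 d) ((𝓡 d).prod 𝓘(ℝ, ℝ)) ∞ (fun y => TotalSpace.mk' ℝ
      (E := Bundle.Trivial M ℝ) (e.symm y) (g.inner (e.symm y)
        (mfderiv (𝓡 d) (𝓡 d) e.symm y (EuclideanSpace.single i (1 : ℝ)))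
        (mfderiv (𝓡 d) (𝓡 d) e.symm y (EuclideanSpace.single j (1 : ℝ))))) e.target := by
    refine ContMDiffOn.clm_bundle_apply₂ (F₁ := EuclideanSpace ℝ (Fin d))
      (F₂ := EuclideanSpace ℝ (Fin d)) ?_ (hsec i) (hsec j)
    exact g.contMDiff.comp_contMDiffOn (contMDiffOn_symm_of_mem_maximalAtlas he)
  intro y hy
  have h4 := h3 y hy
  simp only [contMDiffWithinAt_totalSpace] at h4
  refine (contMDiffWithinAt_iff_contDiffWithinAt.1 h4.2).congr_of_eventuallyEq ?_ ?_
  · filter_upwards [self_mem_nhdsWithin] with w hw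
    rw [metricMatrix_apply, chartDeriv_inverse_eq he hw]
    rfl
  · rw [metricMatrix_apply, chartDeriv_inverse_eq he hy]
    rfl

lemma contDiffOn_chartDensity (g : SmoothRiemannianMetric d M)
    (he : e ∈ IsManifold.maximalAtlas (𝓡 d) ∞ M) :
    ContDiffOn ℝ ∞ (fun y => chartDensity g e (e.symm y)) e.target := by
  refine ContDiffOn.sqrt ?_ fun y hy =>
    (posDef_metricMatrix g he (e.map_target hy)).det_pos.ne'
  simp only [Matrix.det_apply]
  refine ContDiffOn.sum fun σ _ => ContDiffOn.const_smul _ ?_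
  exact contDiffOn_prod fun i _ => contDiffOn_metricMatrix g he _ _

variable [MeasurableSpace M]

/-- The Riemannian volume of the domain of a chart `e`, extended by zero. -/
def chartMeasure (g : SmoothRiemannianMetric d M)
    (e : OpenPartialHomeomorph M (EuclideanSpace ℝ (Fin d))) : Measure M :=
  (((volume : Measure (EuclideanSpace ℝ (Fin d))).restrict e.target).withDensity
    fun y => ENNReal.ofReal (chartDensity g e (e.symm y))).map e.symm

lemma chartVolume_eq (g : SmoothRiemannianMetric d M) (x : M) :
    chartVolume g x = chartMeasure g (chartAt (EuclideanSpace ℝ (Fin d)) x) := by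
  rw [chartVolume, chartMeasure]
  congr 1
  refine withDensity_congr_ae ?_
  filter_upwards [ae_restrict_mem (chartAt (EuclideanSpace ℝ (Fin d)) x).open_target.measurableSet]
    with y hy
  rw [metricMatrix_chartAt g x hy, chartDensity]

variable [BorelSpace M]

lemma measurableSet_target_inter_preimage
    (e : OpenPartialHomeomorph M (EuclideanSpace ℝ (Fin d))) {A : Set M} (hA : MeasurableSet A) :
    MeasurableSet (e.target ∩ e.symm ⁻¹' A) := by
  rw [← Subtype.image_preimage_coe]
  exact MeasurableSet.subtype_image e.open_target.measurableSet
    ((continuousOn_iff_continuous_domRestrict.1 e.continuousOn_symm).measurable hA)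

lemma chartMeasure_apply (g : SmoothRiemannianMetric d M)
    (e : OpenPartialHomeomorph M (EuclideanSpace ℝ (Fin d))) {A : Set M} (hA : MeasurableSet A) :
    chartMeasure g e A = ∫⁻ y in e.target ∩ e.symm ⁻¹' A,
      ENNReal.ofReal (chartDensity g e (e.symm y)) := by
  have h1 : AEMeasurable e.symm ((volume : Measure (EuclideanSpace ℝ (Fin d))).restrict e.target) :=
    e.continuousOn_symm.aemeasurable e.open_target.measurableSet
  have h2 := measurableSet_target_inter_preimage e hA
  rw [chartMeasure, Measure.map_apply_of_aemeasurable
    (h1.mono_ac (withDensity_absolutelyContinuous _ _)) hA]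
  have h3 : ∀ s : Set (EuclideanSpace ℝ (Fin d)), (((volume : Measure
      (EuclideanSpace ℝ (Fin d))).restrict e.target).withDensity
      fun y => ENNReal.ofReal (chartDensity g e (e.symm y))) s =
      (((volume : Measure (EuclideanSpace ℝ (Fin d))).restrict e.target).withDensity
      fun y => ENNReal.ofReal (chartDensity g e (e.symm y))) (e.target ∩ s) := by
    intro s
    refine measure_congr ?_
    have : ∀ᵐ y ∂(((volume : Measure (EuclideanSpace ℝ (Fin d))).restrict e.target).withDensity
        fun y => ENNReal.ofReal (chartDensity g e (e.symm y))), y ∈ e.target :=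
      (withDensity_absolutelyContinuous _ _).ae_le (ae_restrict_mem e.open_target.measurableSet)
    filter_upwards [this] with y hy
    exact propext ⟨fun h => ⟨hy, h⟩, fun h => h.2⟩
  rw [h3, withDensity_apply _ h2, Measure.restrict_restrict h2,
    inter_eq_left.2 inter_subset_left]

lemma chartMeasure_apply_of_subset (g : SmoothRiemannianMetric d M)
    (e : OpenPartialHomeomorph M (EuclideanSpace ℝ (Fin d))) {A : Set M} (hA : MeasurableSet A)
    (hAe : A ⊆ e.source) :
    chartMeasure g e A = ∫⁻ y in e '' A, ENNReal.ofReal (chartDensity g e (e.symm y)) := by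
  rw [chartMeasure_apply g e hA, e.image_eq_target_inter_inv_preimage hAe]

lemma chartMeasure_inter_source (g : SmoothRiemannianMetric d M)
    (e : OpenPartialHomeomorph M (EuclideanSpace ℝ (Fin d))) {A : Set M} (hA : MeasurableSet A) :
    chartMeasure g e (A ∩ e.source) = chartMeasure g e A := by
  rw [chartMeasure_apply g e hA, chartMeasure_apply g e (hA.inter e.open_source.measurableSet)]
  congr 2
  ext y
  simp only [mem_inter_iff, mem_preimage]
  exact ⟨fun h => ⟨h.1, h.2.1⟩, fun h => ⟨h.1, h.2, e.map_target h.1⟩⟩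

/-- The change of variables formula: the volume of a set does not depend on the chart. -/
lemma chartMeasure_eq_of_subset (g : SmoothRiemannianMetric d M)
    (he : e ∈ IsManifold.maximalAtlas (𝓡 d) ∞ M) (he' : e' ∈ IsManifold.maximalAtlas (𝓡 d) ∞ M)
    {A : Set M} (hA : MeasurableSet A) (hAe : A ⊆ e.source) (hAe' : A ⊆ e'.source) :
    chartMeasure g e A = chartMeasure g e' A := by
  rw [chartMeasure_apply_of_subset g e hA hAe, chartMeasure_apply_of_subset g e' hA hAe']
  have hmeas : MeasurableSet (e '' A) := by
    rw [e.image_eq_target_inter_inv_preimage hAe]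
    exact measurableSet_target_inter_preimage e hA
  have himage : e' '' A = (e' ∘ e.symm) '' (e '' A) := by
    rw [image_image]
    exact image_congr fun z hz => by simp [e.left_inv (hAe hz)]
  rw [himage, lintegral_image_eq_lintegral_abs_det_fderiv_mul volume hmeas
    (f' := fun y => fderiv ℝ (e' ∘ e.symm) y)]
  · refine setLIntegral_congr_fun hmeas ?_
    rintro _ ⟨z, hz, rfl⟩
    simp only [comp_apply, e.left_inv (hAe hz), e'.left_inv (hAe' hz)]
    rw [chartDensity_eq_mul g he he' (hAe hz) (hAe' hz), ENNReal.ofReal_mul (abs_nonneg _)]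
  · rintro _ ⟨z, hz, rfl⟩
    refine DifferentiableAt.hasFDerivAt ?_ |>.hasFDerivWithinAt
    have h1 : MDifferentiableAt (𝓡 d) (𝓡 d) (e' ∘ e.symm) (e z) := by
      refine MDifferentiableAt.comp (I' := 𝓡 d) (e z) ?_
        ((mdifferentiable_of_mem_maximalAtlas he).mdifferentiableAt_symm (e.map_source (hAe hz)))
      rw [e.left_inv (hAe hz)]
      exact (mdifferentiable_of_mem_maximalAtlas he').mdifferentiableAt (hAe' hz)
    exact h1.differentiableAt
  · rintro _ ⟨z, hz, rfl⟩ _ ⟨w, hw, rfl⟩ h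
    simp only [comp_apply, e.left_inv (hAe hz), e.left_inv (hAe hw)] at h
    rw [e'.injOn (hAe' hz) (hAe' hw) h]

variable [SecondCountableTopology M]

/-- The Riemannian volume restricts to the volume of any chart domain. -/
lemma riemannianVolume_apply_of_subset (g : SmoothRiemannianMetric d M)
    (he : e ∈ IsManifold.maximalAtlas (𝓡 d) ∞ M) {A : Set M} (hA : MeasurableSet A)
    (hAe : A ⊆ e.source) : riemannianVolume g A = chartMeasure g e A := by
  classical
  rcases isEmpty_or_nonempty M with hM | hM
  · rw [Set.eq_empty_of_isEmpty A, measure_empty, measure_empty]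
  have hcov := TopologicalSpace.countable_cover_nhds
    (f := fun x : M => (chartAt (EuclideanSpace ℝ (Fin d)) x).source)
    fun x => (chartAt _ x).open_source.mem_nhds (mem_chart_source _ x)
  obtain ⟨T, hT, hTU⟩ := hcov
  have hTne : T.Nonempty := by
    rw [nonempty_iff_ne_empty]
    rintro rfl
    obtain ⟨x⟩ := hM
    have : x ∈ ⋃ x ∈ (∅ : Set M), (chartAt (EuclideanSpace ℝ (Fin d)) x).source := by
      rw [hTU]; trivial
    simp at this
  obtain ⟨s, hs⟩ := hT.exists_eq_range hTne
  let c : ℕ → OpenPartialHomeomorph M (EuclideanSpace ℝ (Fin d)) := fun n => chartAt _ (s n)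
  let D : ℕ → Set M := disjointed fun n => (c n).source
  have hDc : ∀ n, D n ⊆ (c n).source := fun n => disjointed_subset _ n
  have hDm : ∀ n, MeasurableSet (D n) := fun n =>
    MeasurableSet.disjointed (fun n => (c n).open_source.measurableSet) n
  have hDU : ⋃ n, D n = univ := by
    rw [iUnion_disjointed, ← hTU, hs, biUnion_range]
  have hdec : ∀ (μ : Measure M) (B : Set M), MeasurableSet B → μ B = ∑' n, μ (B ∩ D n) := by
    intro μ B hB
    rw [← measure_iUnion (fun a b hab => ((disjoint_disjointed _) hab).mono inter_subset_right
      inter_subset_right) fun n => hB.inter (hDm n), ← inter_iUnion, hDU, inter_univ]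
  -- the measure that is put together from the charts `c n` dominates every `chartVolume`
  let μ : Measure M := Measure.sum fun n => (chartMeasure g (c n)).restrict (D n)
  have hμ : ∀ B, MeasurableSet B → μ B = ∑' n, chartMeasure g (c n) (B ∩ D n) := by
    intro B hB
    rw [Measure.sum_apply _ hB]
    exact tsum_congr fun n => Measure.restrict_apply hB
  have hle : ∀ x, chartVolume g x ≤ μ := by
    intro x
    refine Measure.le_iff.2 fun B hB => ?_
    rw [hdec _ B hB, hμ B hB, chartVolume_eq]
    refine ENNReal.tsum_le_tsum fun n => ?_
    have hBD := hB.inter (hDm n)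
    rw [← chartMeasure_inter_source g _ hBD, chartMeasure_eq_of_subset g
      (chartAt_mem_maximalAtlas x) (chartAt_mem_maximalAtlas (s n))
      (hBD.inter (chartAt _ x).open_source.measurableSet) inter_subset_right
      fun z hz => hDc n hz.1.2]
    exact measure_mono inter_subset_left
  refine le_antisymm ?_ ?_
  · refine ((Measure.le_iff.1 (iSup_le hle : riemannianVolume g ≤ μ)) A hA).trans ?_
    rw [hμ A hA, hdec (chartMeasure g e) A hA]
    refine ENNReal.tsum_le_tsum fun n => ?_
    rw [chartMeasure_eq_of_subset g (chartAt_mem_maximalAtlas (s n)) he (hA.inter (hDm n))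
      (fun z hz => hDc n hz.2) fun z hz => hAe hz.1]
  · rw [hdec _ A hA, hdec (riemannianVolume g) A hA]
    refine ENNReal.tsum_le_tsum fun n => ?_
    rw [chartMeasure_eq_of_subset g he (chartAt_mem_maximalAtlas (s n)) (hA.inter (hDm n))
      (fun z hz => hAe hz.1) fun z hz => hDc n hz.2, ← chartVolume_eq]
    exact (le_iSup (chartVolume g) (s n)) _

end RiemannianVolume

/-! ### Charts in which the Riemannian volume is Lebesgue measure -/

section StraightChart

open Filter Topology Function

variable {d : ℕ}

/-- A compactly supported smooth function has a smooth primitive along a coordinate direction: the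
integral over a half-line, which is a convolution with a Heaviside function. -/
lemma exists_contDiff_fderiv_single_eq (i : Fin d) {F : EuclideanSpace ℝ (Fin d) → ℝ}
    (hF : ContDiff ℝ ∞ F) (hFc : HasCompactSupport F) :
    ∃ h : EuclideanSpace ℝ (Fin d) → ℝ, ContDiff ℝ ∞ h ∧
      ∀ y, fderiv ℝ h y (EuclideanSpace.single i (1 : ℝ)) = F y := by
  -- `G p s` is the value of `F` at `p` with the `i`-th coordinate replaced by `s`
  let G : EuclideanSpace ℝ (Fin d) → ℝ → ℝ :=
    fun p s => F (p + (s - p i) • EuclideanSpace.single i (1 : ℝ))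
  have hGsmooth : ContDiff ℝ ∞ ↿G := by
    refine hF.comp (contDiff_fst.add (ContDiff.smul (contDiff_snd.sub ?_) contDiff_const))
    exact (EuclideanSpace.proj i : EuclideanSpace ℝ (Fin d) →L[ℝ] ℝ).contDiff.comp contDiff_fst
  obtain ⟨R, hR⟩ := hFc.isCompact.isBounded.subset_closedBall (0 : EuclideanSpace ℝ (Fin d))
  have hGk : ∀ p s, s ∉ Icc (-R) R → G p s = 0 := by
    intro p s hs
    by_contra h0
    have h1 := hR (subset_tsupport F h0)
    rw [mem_closedBall_zero_iff] at h1
    have h2 := (PiLp.norm_apply_le _ i).trans h1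
    simp only [PiLp.add_apply, PiLp.smul_apply, PiLp.single_apply, if_true, smul_eq_mul,
      mul_one, add_sub_cancel, Real.norm_eq_abs] at h2
    exact hs ⟨(abs_le.1 h2).1, (abs_le.1 h2).2⟩
  let f : ℝ → ℝ := indicator (Ioi 0) fun _ => 1
  have hf : LocallyIntegrable f volume :=
    (locallyIntegrable_const (1 : ℝ)).indicator measurableSet_Ioi
  let H : EuclideanSpace ℝ (Fin d) × ℝ → ℝ := fun q =>
    (MeasureTheory.convolution f (G q.1) (ContinuousLinearMap.mul ℝ ℝ) volume) q.2
  have hH : ContDiff ℝ ∞ H := by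
    rw [← contDiffOn_univ, ← univ_prod_univ]
    exact contDiffOn_convolution_right_with_param (n := ⊤) _ isOpen_univ isCompact_Icc
      (fun p s _ hs => hGk p s hs) hf (hGsmooth.contDiffOn)
  have hproj : ContDiff ℝ ∞ (fun y : EuclideanSpace ℝ (Fin d) => y i) :=
    (EuclideanSpace.proj i : EuclideanSpace ℝ (Fin d) →L[ℝ] ℝ).contDiff
  have hh : ContDiff ℝ ∞ (fun y => H (y, y i)) := hH.comp (contDiff_id.prodMk hproj)
  refine ⟨fun y => H (y, y i), hh, fun y => ?_⟩
  have hGy : ContDiff ℝ 1 (G y) :=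
    (hGsmooth.comp (contDiff_const.prodMk contDiff_id)).of_le (by simp)
  have hGc : HasCompactSupport (G y) := HasCompactSupport.intro isCompact_Icc (hGk y)
  have h1 : HasDerivAt (fun s => H (y, s)) (F y) (y i) := by
    have h2 := hGc.hasDerivAt_convolution_right (ContinuousLinearMap.mul ℝ ℝ) hf hGy (y i)
    convert! h2 using 1
    have h3 : ContDiff ℝ 1 fun t => G y (y i - t) := hGy.comp (contDiff_const.sub contDiff_id)
    have h4 : HasCompactSupport fun t => G y (y i - t) :=
      hGc.comp_homeomorph (Homeomorph.subLeft (y i))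
    have h5 := h4.integral_Ioi_deriv_eq h3 0
    have h6 : ∀ t, deriv (fun t => G y (y i - t)) t = -deriv (G y) (y i - t) := fun t =>
      deriv_comp_const_sub _ _ _
    simp only [h6, integral_neg, sub_zero, neg_inj] at h5
    rw [MeasureTheory.convolution]
    have h7 : ∀ t, (ContinuousLinearMap.mul ℝ ℝ) (f t) (deriv (G y) (y i - t)) =
        (Ioi 0).indicator (fun t => deriv (G y) (y i - t)) t := by
      intro t
      by_cases ht : t ∈ Ioi (0 : ℝ)
      · simp only [f, indicator_of_mem ht, ContinuousLinearMap.mul_apply', one_mul]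
      · simp only [f, indicator_of_notMem ht, ContinuousLinearMap.mul_apply', zero_mul]
    simp only [h7]
    rw [integral_indicator measurableSet_Ioi, h5]
    simp [G]
  have h8 : HasDerivAt (fun t : ℝ => H (y + t • EuclideanSpace.single i (1 : ℝ),
      (y + t • EuclideanSpace.single i (1 : ℝ)) i)) (F y) 0 := by
    have h9 : (fun t : ℝ => H (y + t • EuclideanSpace.single i (1 : ℝ),
        (y + t • EuclideanSpace.single i (1 : ℝ)) i)) = fun t => H (y, y i + t) := by
      ext1 t
      have hG : G (y + t • EuclideanSpace.single i (1 : ℝ)) = G y := by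
        ext1 s
        simp only [G]
        congr 1
        simp only [PiLp.add_apply, PiLp.smul_apply, PiLp.single_apply, if_true,
          smul_eq_mul, mul_one]
        module
      simp only [H, hG]
      simp
    rw [h9]
    exact HasDerivAt.comp_const_add (y i) 0 (by rwa [add_zero])
  have h10 := ((hh.differentiable (by simp)) y).hasFDerivAt
  have h11 : HasDerivAt (fun t : ℝ => y + t • EuclideanSpace.single i (1 : ℝ))
      (EuclideanSpace.single i (1 : ℝ)) 0 := by
    simpa using ((hasDerivAt_id (0 : ℝ)).smul_const
      (EuclideanSpace.single i (1 : ℝ))).const_add y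
  have h12 := HasFDerivAt.comp_hasDerivAt_of_eq (0 : ℝ) h10 h11 (by simp)
  exact h12.unique h8

/-- Near any point there is a smooth change of coordinates with a given positive smooth Jacobian
determinant: a map that moves points in a single coordinate direction only. -/
lemma exists_openPartialHomeomorph_det_fderiv_eq (i : Fin d) {ρ : EuclideanSpace ℝ (Fin d) → ℝ}
    {U : Set (EuclideanSpace ℝ (Fin d))} (hU : IsOpen U) (hρ : ContDiffOn ℝ ∞ ρ U)
    (hpos : ∀ y ∈ U, 0 < ρ y) {a : EuclideanSpace ℝ (Fin d)} (ha : a ∈ U) :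
    ∃ φ : OpenPartialHomeomorph (EuclideanSpace ℝ (Fin d)) (EuclideanSpace ℝ (Fin d)),
      a ∈ φ.source ∧ φ.source ⊆ U ∧ ContDiffOn ℝ ∞ φ φ.source ∧
      ContDiffOn ℝ ∞ φ.symm φ.target ∧ ∀ y ∈ φ.source, (fderiv ℝ φ y).det = ρ y := by
  obtain ⟨δ, hδ, hδU⟩ := Metric.isOpen_iff.1 hU a ha
  let χ : ContDiffBump a := ⟨δ / 4, δ / 2, by positivity, by linarith⟩
  have hχU : tsupport χ ⊆ U := by
    rw [χ.tsupport_eq]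
    exact (Metric.closedBall_subset_ball (by change δ / 2 < δ; linarith)).trans hδU
  let F : EuclideanSpace ℝ (Fin d) → ℝ := fun y => χ y * ρ y
  have hF : ContDiff ℝ ∞ F := by
    rw [contDiff_iff_contDiffAt]
    intro y
    by_cases hy : y ∈ tsupport χ
    · exact χ.contDiff.contDiffAt.mul (hρ.contDiffAt (hU.mem_nhds (hχU hy)))
    · have h1 : F =ᶠ[𝓝 y] fun _ => 0 := by
        filter_upwards [(isClosed_tsupport χ).isOpen_compl.mem_nhds hy] with w hw
        simp [F, image_eq_zero_of_notMem_tsupport hw]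
      exact contDiffAt_const.congr_of_eventuallyEq h1
  have hFc : HasCompactSupport F := χ.hasCompactSupport.mul_right
  obtain ⟨h, hh, hhF⟩ := exists_contDiff_fderiv_single_eq i hF hFc
  let Φ : EuclideanSpace ℝ (Fin d) → EuclideanSpace ℝ (Fin d) := fun y =>
    y + (h y - y i) • EuclideanSpace.single i (1 : ℝ)
  have hproj : ContDiff ℝ ∞ (fun y : EuclideanSpace ℝ (Fin d) => y i) :=
    (EuclideanSpace.proj i : EuclideanSpace ℝ (Fin d) →L[ℝ] ℝ).contDiff
  have hΦ : ContDiff ℝ ∞ Φ := contDiff_id.add ((hh.sub hproj).smul contDiff_const)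
  have hder : ∀ y, HasFDerivAt Φ (ContinuousLinearMap.id ℝ _ +
      (fderiv ℝ h y - EuclideanSpace.proj i).smulRight (EuclideanSpace.single i (1 : ℝ))) y := by
    intro y
    refine (hasFDerivAt_id y).add (HasFDerivAt.smul_const (HasFDerivAt.sub
      ((hh.differentiable (by simp)) y).hasFDerivAt ?_) _)
    exact (EuclideanSpace.proj i : EuclideanSpace ℝ (Fin d) →L[ℝ] ℝ).hasFDerivAt
  have hdet : ∀ y, (fderiv ℝ Φ y).det = F y := by
    intro y
    rw [(hder y).fderiv, ContinuousLinearMap.det]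
    have h1 : ((ContinuousLinearMap.id ℝ _ + (fderiv ℝ h y - EuclideanSpace.proj i).smulRight
        (EuclideanSpace.single i (1 : ℝ)) : EuclideanSpace ℝ (Fin d) →L[ℝ]
        EuclideanSpace ℝ (Fin d)) : EuclideanSpace ℝ (Fin d) →ₗ[ℝ] EuclideanSpace ℝ (Fin d)) =
        LinearMap.transvection ((fderiv ℝ h y - EuclideanSpace.proj i : _ →L[ℝ] ℝ) : _ →ₗ[ℝ] ℝ)
          (EuclideanSpace.single i (1 : ℝ)) := by
      ext v
      simp [LinearMap.transvection.apply]
    rw [h1, LinearMap.transvection.det]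
    simp [hhF]
  have hball : ∀ y ∈ Metric.ball a (δ / 4), F y = ρ y ∧ y ∈ U := by
    intro y hy
    refine ⟨?_, hδU (Metric.ball_subset_ball (by linarith) hy)⟩
    have : χ y = 1 := χ.one_of_mem_closedBall (Metric.ball_subset_closedBall hy)
    simp [F, this]
  have hequiv : ∀ y ∈ Metric.ball a (δ / 4), ∃ L : EuclideanSpace ℝ (Fin d) ≃L[ℝ]
      EuclideanSpace ℝ (Fin d), HasFDerivAt Φ (L : _ →L[ℝ] _) y := by
    intro y hy
    have h1 : (fderiv ℝ Φ y).det ≠ 0 := by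
      rw [hdet, (hball y hy).1]
      exact (hpos y (hball y hy).2).ne'
    refine ⟨(fderiv ℝ Φ y).toContinuousLinearEquivOfDetNeZero h1, ?_⟩
    rw [ContinuousLinearMap.coe_toContinuousLinearEquivOfDetNeZero]
    exact ((hΦ.differentiable (by simp)) y).hasFDerivAt
  have haB : a ∈ Metric.ball a (δ / 4) := Metric.mem_ball_self (by positivity)
  obtain ⟨L, hL⟩ := hequiv a haB
  let φ₀ := hΦ.contDiffAt.toOpenPartialHomeomorph Φ hL (by simp)
  let φ := φ₀.restr (Metric.ball a (δ / 4))
  have hφs : φ.source = φ₀.source ∩ Metric.ball a (δ / 4) :=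
    φ₀.restr_source' _ Metric.isOpen_ball
  have hφ : ⇑φ = Φ := rfl
  refine ⟨φ, ?_, ?_, ?_, ?_, ?_⟩
  · rw [hφs]
    exact ⟨ContDiffAt.mem_toOpenPartialHomeomorph_source _ _ _, haB⟩
  · rw [hφs]
    exact fun y hy => (hball y hy.2).2
  · rw [hφ]
    exact hΦ.contDiffOn
  · intro y hy
    have hy' : φ.symm y ∈ Metric.ball a (δ / 4) := by
      have := φ.map_target hy
      rw [hφs] at this
      exact this.2
    obtain ⟨L', hL'⟩ := hequiv _ hy'
    exact (φ.contDiffAt_symm hy hL' hΦ.contDiffAt).contDiffWithinAt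
  · intro y hy
    rw [hφs] at hy
    rw [hφ, hdet, (hball y hy.2).1]

variable {M : Type*} [TopologicalSpace M] [ChartedSpace (EuclideanSpace ℝ (Fin d)) M]
  [IsManifold (𝓡 d) ∞ M]

lemma trans_mem_maximalAtlas {e : OpenPartialHomeomorph M (EuclideanSpace ℝ (Fin d))}
    (he : e ∈ IsManifold.maximalAtlas (𝓡 d) ∞ M)
    {φ : OpenPartialHomeomorph (EuclideanSpace ℝ (Fin d)) (EuclideanSpace ℝ (Fin d))}
    (h1 : ContDiffOn ℝ ∞ φ φ.source) (h2 : ContDiffOn ℝ ∞ φ.symm φ.target) :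
    e ≫ₕ φ ∈ IsManifold.maximalAtlas (𝓡 d) ∞ M := by
  have hφ : φ ∈ contDiffGroupoid ∞ (𝓡 d) := by
    rw [contDiffGroupoid, mem_groupoid_of_pregroupoid]
    constructor
    · simpa [contDiffPregroupoid] using h1
    · simpa [contDiffPregroupoid] using h2
  refine mem_maximalAtlas_iff.2 fun e' he' => ?_
  obtain ⟨h3, h4⟩ := mem_maximalAtlas_iff.1 he e' he'
  constructor
  · rw [OpenPartialHomeomorph.trans_symm_eq_symm_trans_symm, OpenPartialHomeomorph.trans_assoc]
    exact StructureGroupoid.trans _ (StructureGroupoid.symm _ hφ) h3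
  · rw [← OpenPartialHomeomorph.trans_assoc]
    exact StructureGroupoid.trans _ h4 hφ

variable [MeasurableSpace M] [BorelSpace M] [SecondCountableTopology M]

/-- Around every point there is a smooth chart in which the Riemannian volume is Lebesgue
measure. -/
theorem exists_volume_chart (i : Fin d) (g : SmoothRiemannianMetric d M) (x : M) :
    ∃ e ∈ IsManifold.maximalAtlas (𝓡 d) ∞ M, x ∈ e.source ∧
      ∀ A ⊆ e.source, MeasurableSet A → riemannianVolume g A = volume (e '' A) := by
  let e₀ := chartAt (EuclideanSpace ℝ (Fin d)) x
  have he₀ := chartAt_mem_maximalAtlas (d := d) x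
  obtain ⟨φ, hφa, hφU, hφ1, hφ2, hφd⟩ := exists_openPartialHomeomorph_det_fderiv_eq i
    e₀.open_target (contDiffOn_chartDensity g he₀)
    (fun y hy => chartDensity_pos g he₀ (e₀.map_target hy))
    (e₀.map_source (mem_chart_source _ x))
  have he := trans_mem_maximalAtlas he₀ hφ1 hφ2
  refine ⟨e₀ ≫ₕ φ, he, ?_, fun A hA hAm => ?_⟩
  · rw [OpenPartialHomeomorph.trans_source]
    exact ⟨mem_chart_source _ x, hφa⟩
  · have hone : ∀ z ∈ (e₀ ≫ₕ φ).source, chartDensity g (e₀ ≫ₕ φ) z = 1 := by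
      intro z hz
      have hz' := hz
      rw [OpenPartialHomeomorph.trans_source] at hz'
      have h1 := chartDensity_eq_mul g he₀ he hz'.1 hz
      have h2 : (e₀ ≫ₕ φ) ∘ e₀.symm =ᶠ[𝓝 (e₀ z)] φ := by
        filter_upwards [e₀.open_target.mem_nhds (e₀.map_source hz'.1)] with w hw
        simp [e₀.right_inv hw]
      rw [h2.fderiv_eq, hφd _ hz'.2, e₀.left_inv hz'.1,
        abs_of_pos (chartDensity_pos g he₀ hz'.1)] at h1
      exact (mul_eq_left₀ (chartDensity_pos g he₀ hz'.1).ne').1 h1.symm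
    rw [riemannianVolume_apply_of_subset g he hAm hA, chartMeasure_apply_of_subset g _ hAm hA,
      ← setLIntegral_one]
    have hmeas : MeasurableSet ((e₀ ≫ₕ φ) '' A) := by
      rw [OpenPartialHomeomorph.image_eq_target_inter_inv_preimage _ hA]
      exact measurableSet_target_inter_preimage _ hAm
    refine setLIntegral_congr_fun hmeas ?_
    rintro _ ⟨z, hz, rfl⟩
    beta_reduce
    rw [OpenPartialHomeomorph.left_inv _ (hA hz), hone z (hA hz), ENNReal.ofReal_one]

end StraightChart

/-! ### Localized rotations of Euclidean space -/

section Twist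

open Filter Topology Function

variable {d : ℕ} {i j : Fin d}

/-- A smooth radial cutoff function: it is `1` on the ball of radius `R` and `0` outside of the ball
of radius `√2 R`. -/
def radialCutoff (R : ℝ) (v : EuclideanSpace ℝ (Fin d)) : ℝ :=
  Real.smoothTransition (2 - ‖v‖ ^ 2 / R ^ 2)

lemma contDiff_radialCutoff (R : ℝ) :
    ContDiff ℝ ∞ (radialCutoff R : EuclideanSpace ℝ (Fin d) → ℝ) :=
  Real.smoothTransition.contDiff.comp (contDiff_const.sub ((contDiff_norm_sq ℝ).div_const _))

lemma radialCutoff_eq_one {R : ℝ} (hR : 0 < R) {v : EuclideanSpace ℝ (Fin d)} (hv : ‖v‖ ≤ R) :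
    radialCutoff R v = 1 := by
  refine Real.smoothTransition.one_of_one_le ?_
  have : ‖v‖ ^ 2 / R ^ 2 ≤ 1 := by
    rw [div_le_one (by positivity)]
    gcongr
  linarith

lemma radialCutoff_eq_zero {R : ℝ} (hR : 0 < R) {v : EuclideanSpace ℝ (Fin d)}
    (hv : 2 * R < ‖v‖) : radialCutoff R v = 0 := by
  refine Real.smoothTransition.zero_of_nonpos ?_
  have : 2 ≤ ‖v‖ ^ 2 / R ^ 2 := by
    rw [le_div_iff₀ (by positivity)]
    nlinarith [norm_nonneg v]
  linarith

lemma radialCutoff_planeRot (hij : i ≠ j) (R a : ℝ) (v : EuclideanSpace ℝ (Fin d)) :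
    radialCutoff R (planeRot i j a v) = radialCutoff R v := by
  rw [radialCutoff, norm_planeRot hij, radialCutoff]

/-- The cutoff is constant along the orbits of the rotations. -/
lemma fderiv_radialCutoff_planeJ (R : ℝ) (v : EuclideanSpace ℝ (Fin d)) :
    fderiv ℝ (radialCutoff R) v (planeJ i j v) = 0 := by
  have h1 : HasFDerivAt (fun v : EuclideanSpace ℝ (Fin d) => 2 - ‖v‖ ^ 2 / R ^ 2)
      (-((R ^ 2)⁻¹ • (2 • (innerSL ℝ v)))) v := by
    simpa [div_eq_mul_inv] using (((hasStrictFDerivAt_norm_sq v).hasFDerivAt).mul_const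
      (R ^ 2)⁻¹).const_sub 2
  have h2 : HasDerivAt Real.smoothTransition _ (2 - ‖v‖ ^ 2 / R ^ 2) :=
    ((Real.smoothTransition.contDiff (n := 1)).differentiable one_ne_zero _).hasDerivAt
  have h3 := h2.comp_hasFDerivAt v h1
  have h4 : fderiv ℝ (radialCutoff R) v = _ := h3.fderiv
  rw [h4]
  simp [inner_planeJ_self]

/-- The rotation by the angle `t` in the `i`-`j` plane on the ball of radius `R`, damped to the
identity outside of the ball of radius `2R`. -/
def dampedRot (i j : Fin d) (R t : ℝ) (v : EuclideanSpace ℝ (Fin d)) : EuclideanSpace ℝ (Fin d) :=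
  planeRot i j (t * radialCutoff R v) v

lemma contDiff_dampedRot (i j : Fin d) (R : ℝ) :
    ContDiff ℝ ∞ (fun p : ℝ × EuclideanSpace ℝ (Fin d) => dampedRot i j R p.1 p.2) := by
  have h1 : ContDiff ℝ ∞ (fun p : ℝ × EuclideanSpace ℝ (Fin d) => p.1 * radialCutoff R p.2) :=
    contDiff_fst.mul ((contDiff_radialCutoff R).comp contDiff_snd)
  simp only [dampedRot, planeRot_apply]
  refine (contDiff_snd.add (((Real.contDiff_cos.comp h1).sub contDiff_const).smul
    ((planeProj i j).contDiff.comp contDiff_snd))).add ((Real.contDiff_sin.comp h1).smul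
    ((planeJ i j).contDiff.comp contDiff_snd))

lemma norm_dampedRot (hij : i ≠ j) (R t : ℝ) (v : EuclideanSpace ℝ (Fin d)) :
    ‖dampedRot i j R t v‖ = ‖v‖ := norm_planeRot hij _ _

lemma dampedRot_dampedRot (hij : i ≠ j) (R a b : ℝ) (v : EuclideanSpace ℝ (Fin d)) :
    dampedRot i j R a (dampedRot i j R b v) = dampedRot i j R (a + b) v := by
  rw [dampedRot, dampedRot, radialCutoff_planeRot hij, planeRot_planeRot hij, ← add_mul]
  rfl

lemma dampedRot_zero (i j : Fin d) (R : ℝ) (v : EuclideanSpace ℝ (Fin d)) :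
    dampedRot i j R 0 v = v := by
  rw [dampedRot, zero_mul, planeRot_zero]
  rfl

/-- The derivative of the damped rotation is a rotation composed with the transvection by the vector
`planeJ i j v`, along which the cutoff has derivative zero. Hence the damped rotation preserves
volume. -/
lemma abs_det_fderiv_dampedRot (hij : i ≠ j) (R t : ℝ) (v : EuclideanSpace ℝ (Fin d)) :
    |(fderiv ℝ (dampedRot i j R t) v).det| = 1 := by
  set θ := t * radialCutoff R v with hθ
  have h1 : HasFDerivAt (fun v : EuclideanSpace ℝ (Fin d) => t * radialCutoff R v)
      (t • fderiv ℝ (radialCutoff R) v) v :=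
    (((contDiff_radialCutoff R).differentiable (by simp) v).hasFDerivAt).const_mul t
  have hcos := (Real.hasDerivAt_cos θ).comp_hasFDerivAt v h1
  have hsin := (Real.hasDerivAt_sin θ).comp_hasFDerivAt v h1
  have h2 : HasFDerivAt (dampedRot i j R t)
      (planeRot i j θ ∘L (ContinuousLinearMap.id ℝ _ +
        (t • fderiv ℝ (radialCutoff R) v).smulRight (planeJ i j v))) v := by
    have h3 := ((hasFDerivAt_id v).add ((hcos.sub_const 1).smul (planeProj i j).hasFDerivAt)).add
      (hsin.smul (planeJ i j).hasFDerivAt)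
    refine h3.congr_fderiv ?_
    ext1 w
    simp only [ContinuousLinearMap.comp_apply, ContinuousLinearMap.smulRight_apply,
      ContinuousLinearMap.id_apply, add_apply, smul_apply, planeRot_apply, map_add, map_smul,
      planeJ_planeJ hij, planeProj_planeJ hij, comp_apply, ← hθ, smul_eq_mul]
    module
  have hdet : (ContinuousLinearMap.id ℝ (EuclideanSpace ℝ (Fin d)) +
      (t • fderiv ℝ (radialCutoff R) v).smulRight (planeJ i j v)).det = 1 := by
    have h4 : ((ContinuousLinearMap.id ℝ (EuclideanSpace ℝ (Fin d)) +
        (t • fderiv ℝ (radialCutoff R) v).smulRight (planeJ i j v) : EuclideanSpace ℝ (Fin d) →L[ℝ]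
        EuclideanSpace ℝ (Fin d)) : EuclideanSpace ℝ (Fin d) →ₗ[ℝ] EuclideanSpace ℝ (Fin d)) =
        LinearMap.transvection ((t • fderiv ℝ (radialCutoff R) v : _ →L[ℝ] ℝ) : _ →ₗ[ℝ] ℝ)
          (planeJ i j v) := by
      ext w
      simp [LinearMap.transvection.apply]
    rw [ContinuousLinearMap.det, h4, LinearMap.transvection.det]
    simp [fderiv_radialCutoff_planeJ]
  have h5 : (planeRot i j θ ∘L (ContinuousLinearMap.id ℝ (EuclideanSpace ℝ (Fin d)) +
      (t • fderiv ℝ (radialCutoff R) v).smulRight (planeJ i j v))).det = (planeRot i j θ).det *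
      (ContinuousLinearMap.id ℝ (EuclideanSpace ℝ (Fin d)) +
      (t • fderiv ℝ (radialCutoff R) v).smulRight (planeJ i j v)).det := LinearMap.det_comp _ _
  rw [h2.fderiv, h5, hdet, mul_one, abs_det_planeRot hij]

/-- The damped rotation around the point `c` in the plane spanned by the images of `eᵢ` and `eⱼ`
under `S`. -/
def twist (i j : Fin d) (S : EuclideanSpace ℝ (Fin d) ≃L[ℝ] EuclideanSpace ℝ (Fin d))
    (c : EuclideanSpace ℝ (Fin d)) (R t : ℝ) (u : EuclideanSpace ℝ (Fin d)) :
    EuclideanSpace ℝ (Fin d) :=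
  c + S (dampedRot i j R t (S.symm (u - c)))

variable (S : EuclideanSpace ℝ (Fin d) ≃L[ℝ] EuclideanSpace ℝ (Fin d))
  (c : EuclideanSpace ℝ (Fin d))

/-- The ellipsoid outside of which `twist` is the identity. -/
def twistSupport (R : ℝ) : Set (EuclideanSpace ℝ (Fin d)) :=
  (fun v => c + S v) '' Metric.closedBall 0 (2 * R)

lemma mem_twistSupport {R : ℝ} {u : EuclideanSpace ℝ (Fin d)} :
    u ∈ twistSupport S c R ↔ ‖S.symm (u - c)‖ ≤ 2 * R := by
  constructor
  · rintro ⟨v, hv, rfl⟩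
    simpa using hv
  · intro h
    exact ⟨S.symm (u - c), by simpa using h, by simp⟩

lemma isCompact_twistSupport (R : ℝ) : IsCompact (twistSupport S c R) :=
  (isCompact_closedBall _ _).image (by fun_prop)

lemma exists_twistSupport_subset {U : Set (EuclideanSpace ℝ (Fin d))} (hU : U ∈ 𝓝 c) :
    ∃ R > 0, twistSupport S c R ⊆ U := by
  have h1 : Continuous fun v => c + S v := by fun_prop
  have h2 : (fun v => c + S v) ⁻¹' U ∈ 𝓝 (0 : EuclideanSpace ℝ (Fin d)) :=
    h1.continuousAt.preimage_mem_nhds (by simpa using hU)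
  obtain ⟨δ, hδ, h⟩ := Metric.nhds_basis_closedBall.mem_iff.1 h2
  refine ⟨δ / 2, by positivity, ?_⟩
  rw [twistSupport, image_subset_iff, mul_div_cancel₀ _ two_ne_zero]
  exact h

lemma contDiff_clmEquiv_comp {F : Type*} [NormedAddCommGroup F] [NormedSpace ℝ F]
    {f : F → EuclideanSpace ℝ (Fin d)} (hf : ContDiff ℝ ∞ f) : ContDiff ℝ ∞ fun p => S (f p) :=
  ContDiff.comp (g := S) (f := f) S.contDiff hf

lemma contDiff_twist (i j : Fin d) (R : ℝ) :
    ContDiff ℝ ∞ (fun p : ℝ × EuclideanSpace ℝ (Fin d) => twist i j S c R p.1 p.2) := by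
  have h := contDiff_dampedRot i j R
  unfold twist
  generalize dampedRot i j R = D at h ⊢
  have h2 : ContDiff ℝ ∞ (fun p : ℝ × EuclideanSpace ℝ (Fin d) => S.symm (p.2 - c)) :=
    contDiff_clmEquiv_comp S.symm (contDiff_snd.sub contDiff_const)
  exact ContDiff.add contDiff_const (contDiff_clmEquiv_comp S
    (ContDiff.comp (g := fun q : ℝ × EuclideanSpace ℝ (Fin d) => D q.1 q.2)
      (f := fun p : ℝ × EuclideanSpace ℝ (Fin d) => (p.1, S.symm (p.2 - c))) h
      (contDiff_fst.prodMk h2)))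

lemma contDiff_twist_apply (i j : Fin d) (R t : ℝ) : ContDiff ℝ ∞ (twist i j S c R t) := by
  have h := contDiff_twist S c i j R
  generalize twist i j S c R = T at h ⊢
  exact ContDiff.comp (g := fun p : ℝ × EuclideanSpace ℝ (Fin d) => T p.1 p.2)
    (f := fun u => (t, u)) h (contDiff_const.prodMk contDiff_id)

lemma twist_twist (hij : i ≠ j) (R a b : ℝ) (u : EuclideanSpace ℝ (Fin d)) :
    twist i j S c R a (twist i j S c R b u) = twist i j S c R (a + b) u := by
  simp [twist, dampedRot_dampedRot hij]

lemma twist_zero (i j : Fin d) (R : ℝ) (u : EuclideanSpace ℝ (Fin d)) :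
    twist i j S c R 0 u = u := by
  simp [twist, dampedRot_zero]

lemma twist_mem_twistSupport (hij : i ≠ j) {R t : ℝ} {u : EuclideanSpace ℝ (Fin d)} :
    twist i j S c R t u ∈ twistSupport S c R ↔ u ∈ twistSupport S c R := by
  simp [mem_twistSupport, twist, norm_dampedRot hij]

lemma twist_eq_self {R : ℝ} (hR : 0 < R) {t : ℝ} {u : EuclideanSpace ℝ (Fin d)}
    (hu : u ∉ twistSupport S c R) : twist i j S c R t u = u := by
  rw [mem_twistSupport, not_le] at hu
  rw [twist, dampedRot, radialCutoff_eq_zero hR hu, mul_zero, planeRot_zero]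
  simp

lemma twist_eventuallyEq (hij : i ≠ j) {R : ℝ} (hR : 0 < R) (t : ℝ) :
    twist i j S c R t =ᶠ[𝓝 c] fun u => c + conjRot hij S t (u - c) := by
  have h1 : ContinuousAt (fun u => ‖S.symm (u - c)‖) c := by fun_prop
  have h2 : ∀ᶠ u in 𝓝 c, ‖S.symm (u - c)‖ < R := h1.eventually_lt_const (by simpa using hR)
  filter_upwards [h2] with u hu
  rw [twist, dampedRot, radialCutoff_eq_one hR hu.le, mul_one, conjRot_apply]

lemma abs_det_fderiv_twist (hij : i ≠ j) (R t : ℝ) (u : EuclideanSpace ℝ (Fin d)) :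
    |(fderiv ℝ (twist i j S c R t) u).det| = 1 := by
  have hND : ContDiff ℝ ∞ (dampedRot i j R t) := by
    have h := contDiff_dampedRot i j R
    generalize dampedRot i j R = D at h ⊢
    exact ContDiff.comp (g := fun q : ℝ × EuclideanSpace ℝ (Fin d) => D q.1 q.2)
      (f := fun v => (t, v)) h (contDiff_const.prodMk contDiff_id)
  have hN : HasFDerivAt (dampedRot i j R t) (fderiv ℝ (dampedRot i j R t) (S.symm (u - c)))
      (S.symm (u - c)) :=
    (hND.differentiable (by simp) _).hasFDerivAt
  have h0 := (S.symm.hasFDerivAt (x := u - c)).comp u ((hasFDerivAt_id u).sub_const c)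
  rw [ContinuousLinearMap.comp_id] at h0
  have h1 : HasFDerivAt (fun u => S.symm (u - c))
      (S.symm : EuclideanSpace ℝ (Fin d) →L[ℝ] EuclideanSpace ℝ (Fin d)) u := h0
  have h2 : HasFDerivAt (twist i j S c R t) ((S : _ →L[ℝ] EuclideanSpace ℝ (Fin d)) ∘L
      (fderiv ℝ (dampedRot i j R t) (S.symm (u - c)) ∘L (S.symm : _ →L[ℝ] _))) u :=
    (S.hasFDerivAt.comp u (HasFDerivAt.comp (g := dampedRot i j R t) u hN h1)).const_add c
  rw [h2.fderiv]
  have h3 : ((S : _ →L[ℝ] EuclideanSpace ℝ (Fin d)) ∘L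
      (fderiv ℝ (dampedRot i j R t) (S.symm (u - c)) ∘L
        (S.symm : EuclideanSpace ℝ (Fin d) →L[ℝ] _)) :
      EuclideanSpace ℝ (Fin d) →L[ℝ] EuclideanSpace ℝ (Fin d)).toLinearMap =
      S.toLinearEquiv.toLinearMap ∘ₗ (fderiv ℝ (dampedRot i j R t) (S.symm (u - c))).toLinearMap ∘ₗ
        S.toLinearEquiv.symm.toLinearMap := rfl
  rw [ContinuousLinearMap.det, h3, LinearMap.det_conj]
  exact abs_det_fderiv_dampedRot hij R t _

lemma volume_image_twist (hij : i ≠ j) (R t : ℝ) {A : Set (EuclideanSpace ℝ (Fin d))}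
    (hA : MeasurableSet A) : volume (twist i j S c R t '' A) = volume A := by
  have hinj : Injective (twist i j S c R t) := by
    refine LeftInverse.injective (g := twist i j S c R (-t)) fun u => ?_
    rw [twist_twist S c hij, neg_add_cancel, twist_zero]
  rw [← lintegral_abs_det_fderiv_eq_addHaar_image volume hA
    (f' := fun u => fderiv ℝ (twist i j S c R t) u)
    (fun u _ => (((contDiff_twist_apply S c i j R t).differentiable (by simp) u).hasFDerivAt
      ).hasFDerivWithinAt) hinj.injOn]
  simp [abs_det_fderiv_twist S c hij]

end Twist

/-! ### Lebesgue density as a filter -/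

section DensityFilter

open Filter Topology Function

variable {d : ℕ}

/-- The filter of the sets that have Lebesgue density one at `c`. -/
def densityFilter (c : EuclideanSpace ℝ (Fin d)) : Filter (EuclideanSpace ℝ (Fin d)) where
  sets := {s | Tendsto (fun r => volume (sᶜ ∩ Metric.closedBall c r) /
    volume (Metric.closedBall c r)) (𝓝[>] 0) (𝓝 0)}
  univ_sets := by simp
  sets_of_superset {s t} hs hst := by
    refine tendsto_of_tendsto_of_tendsto_of_le_of_le tendsto_const_nhds hs (fun _ => zero_le) ?_
    intro r
    exact ENNReal.div_le_div_right (measure_mono (inter_subset_inter_left _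
      (compl_subset_compl.2 hst))) _
  inter_sets {s t} hs ht := by
    have h := Tendsto.add (f := fun r => volume (sᶜ ∩ Metric.closedBall c r) /
      volume (Metric.closedBall c r)) hs ht
    rw [add_zero] at h
    refine tendsto_of_tendsto_of_tendsto_of_le_of_le tendsto_const_nhds h (fun _ => zero_le) ?_
    intro r
    change _ ≤ volume (sᶜ ∩ Metric.closedBall c r) / volume (Metric.closedBall c r) +
      volume (tᶜ ∩ Metric.closedBall c r) / volume (Metric.closedBall c r)
    rw [← ENNReal.add_div, compl_inter]
    beta_reduce
    rw [union_inter_distrib_right]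
    exact ENNReal.div_le_div_right (measure_union_le _ _) _

variable {c : EuclideanSpace ℝ (Fin d)}

lemma mem_densityFilter {s : Set (EuclideanSpace ℝ (Fin d))} : s ∈ densityFilter c ↔
    Tendsto (fun r => volume (sᶜ ∩ Metric.closedBall c r) / volume (Metric.closedBall c r))
      (𝓝[>] 0) (𝓝 0) := Iff.rfl

instance densityFilter_neBot : (densityFilter c).NeBot := by
  refine ⟨fun h => ?_⟩
  have h1 : (∅ : Set (EuclideanSpace ℝ (Fin d))) ∈ densityFilter c := h ▸ mem_bot
  rw [mem_densityFilter] at h1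
  have h2 : (fun r => volume ((∅ : Set (EuclideanSpace ℝ (Fin d)))ᶜ ∩ Metric.closedBall c r) /
      volume (Metric.closedBall c r)) =ᶠ[𝓝[>] 0] fun _ => (1 : ℝ≥0∞) := by
    filter_upwards [self_mem_nhdsWithin] with r hr
    rw [compl_empty, univ_inter]
    exact ENNReal.div_self (Metric.measure_closedBall_pos volume c hr).ne'
      measure_closedBall_lt_top.ne
  exact zero_ne_one (tendsto_nhds_unique h1 (tendsto_const_nhds.congr' h2.symm))

lemma densityFilter_le_nhds : densityFilter c ≤ 𝓝 c := by
  intro s hs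
  obtain ⟨δ, hδ, h⟩ := Metric.nhds_basis_closedBall.mem_iff.1 hs
  rw [mem_densityFilter]
  refine tendsto_const_nhds.congr' ?_
  filter_upwards [Ioo_mem_nhdsGT hδ] with r hr
  have : sᶜ ∩ Metric.closedBall c r = ∅ := by
    rw [← disjoint_iff_inter_eq_empty, disjoint_compl_left_iff_subset]
    exact (Metric.closedBall_subset_closedBall hr.2.le).trans h
  simp [this]

lemma densityFilter_le_ae : densityFilter c ≤ ae volume := by
  intro s hs
  rw [mem_densityFilter]
  have : ∀ r, volume (sᶜ ∩ Metric.closedBall c r) = 0 := fun r =>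
    measure_mono_null inter_subset_left (mem_ae_iff.1 hs)
  simp [this]

/-- The Lebesgue density theorem: a measurable map is approximately continuous almost everywhere. -/
lemma ae_tendsto_densityFilter {Y : Type*} [TopologicalSpace Y] [SecondCountableTopology Y]
    [MeasurableSpace Y] [OpensMeasurableSpace Y] {Q : EuclideanSpace ℝ (Fin d) → Y}
    (hQ : Measurable Q) :
    ∀ᵐ c, Tendsto Q (densityFilter c) (𝓝 (Q c)) := by
  have hb := TopologicalSpace.isBasis_countableBasis Y
  have h : ∀ s ∈ TopologicalSpace.countableBasis Y, ∀ᵐ c : EuclideanSpace ℝ (Fin d),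
      Q c ∈ s → Q ⁻¹' s ∈ densityFilter c := by
    intro s hs
    filter_upwards [Besicovitch.ae_tendsto_measure_inter_div_of_measurableSet volume
      (hQ (hb.isOpen hs).measurableSet).compl] with c hc hcs
    rw [indicator_of_notMem (by simpa using hcs)] at hc
    exact hc
  filter_upwards [(ae_ball_iff (TopologicalSpace.countable_countableBasis Y)).2 h] with c hc
  intro W hW
  obtain ⟨s, hs, hcs, hsW⟩ := hb.mem_nhds_iff.1 hW
  exact mem_of_superset (hc s hs hcs) (preimage_mono hsW)

/-- Density one at `c` is preserved by affine isomorphisms fixing `c`: they distort balls and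
volumes by bounded factors. -/
lemma tendsto_densityFilter_affine
    (L : EuclideanSpace ℝ (Fin d) ≃L[ℝ] EuclideanSpace ℝ (Fin d))
    (c : EuclideanSpace ℝ (Fin d)) :
    Tendsto (fun u => c + L (u - c)) (densityFilter c) (densityFilter c) := by
  intro s hs
  rw [mem_map, mem_densityFilter]
  rw [mem_densityFilter] at hs
  set C : ℝ := ‖(L : EuclideanSpace ℝ (Fin d) →L[ℝ] EuclideanSpace ℝ (Fin d))‖ + 1 with hC
  have hC0 : 0 < C := by positivity
  have hCr : Tendsto (fun r => C * r) (𝓝[>] 0) (𝓝[>] 0) := by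
    refine tendsto_nhdsWithin_iff.2 ⟨?_, ?_⟩
    · have : Tendsto (fun r => C * r) (𝓝 0) (𝓝 (C * 0)) := tendsto_id.const_mul C
      rw [mul_zero] at this
      exact this.mono_left nhdsWithin_le_nhds
    · filter_upwards [self_mem_nhdsWithin] with r hr
      exact mul_pos hC0 hr
  let κ : ℝ≥0∞ := ENNReal.ofReal |LinearMap.det (L.symm : EuclideanSpace ℝ (Fin d) →ₗ[ℝ]
    EuclideanSpace ℝ (Fin d))| * ENNReal.ofReal (C ^ Module.finrank ℝ (EuclideanSpace ℝ (Fin d)))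
  have hκ : κ ≠ ⊤ := ENNReal.mul_ne_top ENNReal.ofReal_ne_top ENNReal.ofReal_ne_top
  have hlim := ENNReal.Tendsto.const_mul (a := κ) (hs.comp hCr) (Or.inr hκ)
  rw [mul_zero] at hlim
  refine tendsto_of_tendsto_of_tendsto_of_le_of_le' tendsto_const_nhds hlim
    (Eventually.of_forall fun _ => zero_le) ?_
  filter_upwards [self_mem_nhdsWithin] with r hr
  have hr : 0 < r := hr
  have hmeas : ∀ N : Set (EuclideanSpace ℝ (Fin d)), volume ((fun u => c + L (u - c)) ⁻¹' N) =
      ENNReal.ofReal |LinearMap.det (L.symm : EuclideanSpace ℝ (Fin d) →ₗ[ℝ]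
        EuclideanSpace ℝ (Fin d))| * volume N := by
    intro N
    have h1 : (fun u => c + L (u - c)) ⁻¹' N =
        (fun u => u + -c) ⁻¹' (L ⁻¹' ((fun v => c + v) ⁻¹' N)) := by
      simp only [preimage_preimage, sub_eq_add_neg]
    rw [h1, measure_preimage_add_right, Measure.addHaar_preimage_continuousLinearEquiv,
      measure_preimage_add]
  have hsub : ((fun u => c + L (u - c)) ⁻¹' s)ᶜ ∩ Metric.closedBall c r ⊆
      (fun u => c + L (u - c)) ⁻¹' (sᶜ ∩ Metric.closedBall c (C * r)) := by
    rintro u ⟨hu, hur⟩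
    refine ⟨hu, ?_⟩
    rw [mem_closedBall_iff_norm] at hur ⊢
    rw [add_sub_cancel_left]
    refine (L.toContinuousLinearMap.le_opNorm _).trans ?_
    refine mul_le_mul ?_ hur (norm_nonneg _) hC0.le
    simp [hC]
  have hball : volume (Metric.closedBall c (C * r)) =
      ENNReal.ofReal (C ^ Module.finrank ℝ (EuclideanSpace ℝ (Fin d))) *
        volume (Metric.closedBall c r) := by
    rw [Measure.addHaar_closedBall_mul volume c hC0.le hr.le,
      Measure.addHaar_closedBall_center volume c]
  have hCd : ENNReal.ofReal (C ^ Module.finrank ℝ (EuclideanSpace ℝ (Fin d))) ≠ 0 := by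
    rw [Ne, ENNReal.ofReal_eq_zero, not_le]
    positivity
  calc _ ≤ volume ((fun u => c + L (u - c)) ⁻¹' (sᶜ ∩ Metric.closedBall c (C * r))) /
        volume (Metric.closedBall c r) := ENNReal.div_le_div_right (measure_mono hsub) _
    _ = κ * (volume (sᶜ ∩ Metric.closedBall c (C * r)) / volume (Metric.closedBall c (C * r))) := by
      rw [hmeas, hball, mul_assoc, ← mul_div_assoc,
        ENNReal.mul_div_mul_left _ _ hCd ENNReal.ofReal_ne_top, mul_div_assoc]

end DensityFilter

/-! ### Localized rotations of the manifold -/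

section TwistManifold

open Filter Topology Function

variable {d : ℕ} {M : Type*} [TopologicalSpace M] [ChartedSpace (EuclideanSpace ℝ (Fin d)) M]

open Classical in
/-- The map of `M` that is given by `T` in the chart `e` and is the identity outside of the domain
of `e`. -/
def chartExtend (e : OpenPartialHomeomorph M (EuclideanSpace ℝ (Fin d)))
    (T : EuclideanSpace ℝ (Fin d) → EuclideanSpace ℝ (Fin d)) (z : M) : M :=
  if z ∈ e.source then e.symm (T (e z)) else z

variable {e : OpenPartialHomeomorph M (EuclideanSpace ℝ (Fin d))}
  {T T' : EuclideanSpace ℝ (Fin d) → EuclideanSpace ℝ (Fin d)}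

lemma chartExtend_of_mem {z : M} (hz : z ∈ e.source) :
    chartExtend e T z = e.symm (T (e z)) := if_pos hz

lemma chartExtend_of_notMem {z : M} (hz : z ∉ e.source) : chartExtend e T z = z := if_neg hz

lemma chartExtend_mem_source (hT : MapsTo T e.target e.target) {z : M} (hz : z ∈ e.source) :
    chartExtend e T z ∈ e.source := by
  rw [chartExtend_of_mem hz]
  exact e.map_target (hT (e.map_source hz))

lemma apply_chartExtend (hT : MapsTo T e.target e.target) {z : M} (hz : z ∈ e.source) :
    e (chartExtend e T z) = T (e z) := by
  rw [chartExtend_of_mem hz, e.right_inv (hT (e.map_source hz))]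

lemma chartExtend_chartExtend (hT' : MapsTo T' e.target e.target) (z : M) :
    chartExtend e T (chartExtend e T' z) = chartExtend e (T ∘ T') z := by
  by_cases hz : z ∈ e.source
  · rw [chartExtend_of_mem (chartExtend_mem_source hT' hz), apply_chartExtend hT' hz,
      chartExtend_of_mem hz, comp_apply]
  · rw [chartExtend_of_notMem hz, chartExtend_of_notMem hz, chartExtend_of_notMem hz]

lemma chartExtend_eq_self (h : ∀ u, T u = u) (z : M) : chartExtend e T z = z := by
  by_cases hz : z ∈ e.source
  · rw [chartExtend_of_mem hz, h, e.left_inv hz]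
  · exact chartExtend_of_notMem hz

lemma chartExtend_eq_self_of_notMem {K : Set (EuclideanSpace ℝ (Fin d))}
    (h : ∀ u ∉ K, T u = u) {z : M} (hz : z ∉ e.symm '' K) : chartExtend e T z = z := by
  by_cases hzs : z ∈ e.source
  · rw [chartExtend_of_mem hzs, h, e.left_inv hzs]
    exact fun hK => hz ⟨e z, hK, e.left_inv hzs⟩
  · exact chartExtend_of_notMem hzs

variable [IsManifold (𝓡 d) ∞ M]

/-- A smooth family of maps supported in a compact subset of the chart extends smoothly, also in the
parameter; `M` being Hausdorff, the support is closed in `M`. -/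
lemma contMDiff_chartExtend [T2Space M] (he : e ∈ IsManifold.maximalAtlas (𝓡 d) ∞ M)
    {K : Set (EuclideanSpace ℝ (Fin d))} (hK : IsCompact K) (hKe : K ⊆ e.target)
    {T : ℝ → EuclideanSpace ℝ (Fin d) → EuclideanSpace ℝ (Fin d)}
    (hT : ContDiff ℝ ∞ fun p : ℝ × EuclideanSpace ℝ (Fin d) => T p.1 p.2)
    (hTK : ∀ t, ∀ u ∉ K, T t u = u) (hTe : ∀ t, MapsTo (T t) e.target e.target) :
    ContMDiff (𝓘(ℝ, ℝ).prod (𝓡 d)) (𝓡 d) ∞ fun p : ℝ × M => chartExtend e (T p.1) p.2 := by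
  rintro ⟨t, z⟩
  by_cases hz : z ∈ e.source
  · have h1 : (fun p : ℝ × M => chartExtend e (T p.1) p.2) =ᶠ[𝓝 (t, z)]
        fun p => e.symm (T p.1 (e p.2)) := by
      filter_upwards [continuousAt_snd.preimage_mem_nhds (e.open_source.mem_nhds hz)] with p hp
      exact chartExtend_of_mem hp
    refine ContMDiffAt.congr_of_eventuallyEq ?_ h1
    have h2 : ContMDiffAt (𝓘(ℝ, ℝ).prod (𝓡 d)) (𝓡 d) ∞ (fun p : ℝ × M => e p.2) (t, z) :=
      ContMDiffAt.comp (t, z) (contMDiffAt_of_mem_maximalAtlas he hz) contMDiffAt_snd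
    have h3 : ContMDiffAt (𝓘(ℝ, ℝ).prod (𝓡 d)) 𝓘(ℝ, ℝ × EuclideanSpace ℝ (Fin d)) ∞
        (fun p : ℝ × M => (p.1, e p.2)) (t, z) := contMDiffAt_fst.prodMk_space h2
    have h4 : ContMDiffAt (𝓘(ℝ, ℝ).prod (𝓡 d)) (𝓡 d) ∞ (fun p : ℝ × M => T p.1 (e p.2))
        (t, z) :=
      ContMDiffAt.comp (g := fun q : ℝ × EuclideanSpace ℝ (Fin d) => T q.1 q.2)
        (f := fun p : ℝ × M => (p.1, e p.2)) (t, z) hT.contMDiff.contMDiffAt h3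
    exact ContMDiffAt.comp (g := e.symm) (f := fun p : ℝ × M => T p.1 (e p.2)) (t, z)
      (contMDiffAt_symm_of_mem_maximalAtlas he (hTe t (e.map_source hz))) h4
  · have hclosed : IsClosed (e.symm '' K) :=
      (hK.image_of_continuousOn (e.continuousOn_symm.mono hKe)).isClosed
    have hzK : z ∉ e.symm '' K := by
      rintro ⟨u, hu, rfl⟩
      exact hz (e.map_target (hKe hu))
    have h1 : (fun p : ℝ × M => chartExtend e (T p.1) p.2) =ᶠ[𝓝 (t, z)] fun p => p.2 := by
      filter_upwards [continuousAt_snd.preimage_mem_nhds (hclosed.isOpen_compl.mem_nhds hzK)]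
        with p hp
      exact chartExtend_eq_self_of_notMem (hTK p.1) hp
    exact contMDiffAt_snd.congr_of_eventuallyEq h1

variable [MeasurableSpace M] [BorelSpace M]

lemma measurePreserving_chartExtend {g : SmoothRiemannianMetric d M}
    (hvol : ∀ A ⊆ e.source, MeasurableSet A → riemannianVolume g A = volume (e '' A))
    (hT : MapsTo T e.target e.target) (hT' : MapsTo T' e.target e.target)
    (hTT' : ∀ u, T (T' u) = u) (hcont : Continuous (chartExtend e T))
    (hTvol : ∀ A, MeasurableSet A → volume (T '' A) = volume A) :
    MeasurePreserving (chartExtend e T) (normalizedVolume g) (normalizedVolume g) := by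
  suffices h : MeasurePreserving (chartExtend e T) (riemannianVolume g) (riemannianVolume g) from
    h.smul_measure _
  refine ⟨hcont.measurable, Measure.ext fun A hA => ?_⟩
  have hs := e.open_source.measurableSet
  have hpre : MeasurableSet (chartExtend e T ⁻¹' A) := hcont.measurable hA
  rw [Measure.map_apply hcont.measurable hA, ← measure_inter_add_sdiff _ hs,
    ← measure_inter_add_sdiff A hs]
  congr 1
  · have hB : MeasurableSet (e '' (chartExtend e T ⁻¹' A ∩ e.source)) := by
      rw [e.image_eq_target_inter_inv_preimage inter_subset_right]
      exact measurableSet_target_inter_preimage e (hpre.inter hs)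
    rw [hvol _ inter_subset_right (hpre.inter hs), hvol _ inter_subset_right (hA.inter hs),
      ← hTvol _ hB]
    congr 1
    ext u
    constructor
    · rintro ⟨_, ⟨z, hz, rfl⟩, rfl⟩
      exact ⟨_, ⟨hz.1, chartExtend_mem_source hT hz.2⟩, apply_chartExtend hT hz.2⟩
    · rintro ⟨z, hz, rfl⟩
      have h1 : chartExtend e T (chartExtend e T' z) = z := by
        rw [chartExtend_chartExtend hT']
        exact chartExtend_eq_self hTT' z
      refine ⟨_, ⟨chartExtend e T' z, ⟨?_, chartExtend_mem_source hT' hz.2⟩, rfl⟩, ?_⟩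
      · rw [mem_preimage, h1]; exact hz.1
      · rw [apply_chartExtend hT' hz.2, hTT']
  · congr 1
    ext z
    simp only [Set.mem_sdiff, mem_preimage, and_congr_left_iff]
    intro hz
    rw [chartExtend_of_notMem hz]

/-- In a chart in which the volume is Lebesgue measure, all rotations around a point extend to
conservative diffeomorphisms with support in a given neighbourhood of the point, smoothly in the
angle. -/
theorem exists_twist_family [T2Space M] {i j : Fin d} (hij : i ≠ j) (r : ℕ∞)
    {g : SmoothRiemannianMetric d M} (he : e ∈ IsManifold.maximalAtlas (𝓡 d) ∞ M)
    (hvol : ∀ A ⊆ e.source, MeasurableSet A → riemannianVolume g A = volume (e '' A))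
    (S : EuclideanSpace ℝ (Fin d) ≃L[ℝ] EuclideanSpace ℝ (Fin d)) (c : EuclideanSpace ℝ (Fin d))
    {U : Set (EuclideanSpace ℝ (Fin d))} (hU : U ∈ 𝓝 c) (hUe : U ⊆ e.target) :
    ∃ ψ : ℝ → ConservativeDiffeo r g,
      ContMDiff (𝓘(ℝ, ℝ).prod (𝓡 d)) (𝓡 d) ∞ (fun p : ℝ × M => (ψ p.1).1 p.2) ∧
      (∀ z, (ψ 0).1 z = z) ∧ (∀ t, ∀ z ∉ e.symm '' U, (ψ t).1 z = z) ∧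
      (∀ t, ∀ z ∈ e.source, (ψ t).1 z ∈ e.source) ∧
      ∀ t, e ∘ (ψ t).1 ∘ e.symm =ᶠ[𝓝 c] fun u => c + conjRot hij S t (u - c) := by
  obtain ⟨R, hR, hRU⟩ := exists_twistSupport_subset S c hU
  have hsm := contDiff_twist S c i j R
  have hdet : ∀ t A, MeasurableSet A → volume (twist i j S c R t '' A) = volume A :=
    fun t A hA => volume_image_twist S c hij R t hA
  have hself : ∀ t, ∀ u ∉ twistSupport S c R, twist i j S c R t u = u :=
    fun t u hu => twist_eq_self S c hR hu
  have hmem : ∀ t u, u ∈ twistSupport S c R → twist i j S c R t u ∈ twistSupport S c R :=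
    fun t u hu => (twist_mem_twistSupport S c hij).2 hu
  have hadd : ∀ a b u, twist i j S c R a (twist i j S c R b u) = twist i j S c R (a + b) u :=
    fun a b u => twist_twist S c hij R a b u
  have hzero : ∀ u, twist i j S c R 0 u = u := twist_zero S c i j R
  have hev : ∀ t, twist i j S c R t =ᶠ[𝓝 c] fun u => c + conjRot hij S t (u - c) :=
    twist_eventuallyEq S c hij hR
  generalize twist i j S c R = T at *
  have hTe : ∀ t, MapsTo (T t) e.target e.target := by
    intro t u hu
    by_cases h : u ∈ twistSupport S c R
    · exact hUe (hRU (hmem t u h))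
    · rwa [hself t u h]
  have hjoint := contMDiff_chartExtend he (isCompact_twistSupport S c R) (hRU.trans hUe) hsm hself
    hTe
  have hsmooth : ∀ t, ContMDiff (𝓡 d) (𝓡 d) r (chartExtend e (T t)) := by
    intro t
    have h1 : ContMDiff (𝓡 d) (𝓘(ℝ, ℝ).prod (𝓡 d)) ∞ (fun z : M => (t, z)) :=
      contMDiff_const.prodMk contMDiff_id
    exact (hjoint.comp h1).of_le (by exact_mod_cast le_top)
  have hinv : ∀ a b, a + b = 0 → ∀ u, T a (T b u) = u := by
    intro a b hab u
    rw [hadd, hab, hzero]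
  have hinvM : ∀ a b, a + b = 0 → ∀ z, chartExtend e (T a) (chartExtend e (T b) z) = z := by
    intro a b hab z
    rw [chartExtend_chartExtend (hTe b)]
    exact chartExtend_eq_self (hinv a b hab) z
  let D : ℝ → M ≃ₘ^(r : WithTop ℕ∞)⟮𝓡 d, 𝓡 d⟯ M := fun t =>
    { toFun := chartExtend e (T t)
      invFun := chartExtend e (T (-t))
      left_inv := hinvM _ _ (by ring)
      right_inv := hinvM _ _ (by ring)
      contMDiff_toFun := hsmooth t
      contMDiff_invFun := hsmooth (-t) }
  have hD : ∀ t, ⇑(D t) = chartExtend e (T t) := fun _ => rfl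
  refine ⟨fun t => ⟨D t, measurePreserving_chartExtend hvol (hTe t) (hTe (-t))
    (hinv _ _ (by ring)) (hsmooth t).continuous (hdet t)⟩, hjoint, ?_, ?_, ?_, ?_⟩
  · exact chartExtend_eq_self hzero
  · intro t z hz
    exact chartExtend_eq_self_of_notMem (hself t) fun h => hz (image_mono hRU h)
  · exact fun t z hz => chartExtend_mem_source (hTe t) hz
  · intro t
    filter_upwards [hev t, e.open_target.mem_nhds (hUe (mem_of_mem_nhds hU))] with u hu hue
    simp only [comp_apply, hD]
    rw [apply_chartExtend (hTe t) (e.map_target hue), e.right_inv hue, hu]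

end TwistManifold

/-! ### Smooth families of diffeomorphisms are continuous in the `C^r` topology -/

section SmoothFamilies

open Filter Topology Function

set_option synthInstance.maxHeartbeats 200000 in
/-- The iterated derivatives of a smooth function with respect to some of its variables are smooth
in all variables. -/
lemma contDiffAt_iteratedFDeriv_param {E F P : Type*} [NormedAddCommGroup E] [NormedSpace ℝ E]
    [NormedAddCommGroup F] [NormedSpace ℝ F] [NormedAddCommGroup P] [NormedSpace ℝ P]
    {Φ : P → E → F} {p₀ : P} {u₀ : E} (k m : ℕ)
    (h : ContDiffAt ℝ ((m + k : ℕ) : WithTop ℕ∞) (uncurry Φ) (p₀, u₀)) :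
    ContDiffAt ℝ m (fun q : P × E => iteratedFDeriv ℝ k (Φ q.1) q.2) (p₀, u₀) := by
  induction k generalizing m with
  | zero =>
    simp only [iteratedFDeriv_zero_eq_comp]
    exact (continuousMultilinearCurryFin0 ℝ E F).symm.contDiff.contDiffAt.comp (p₀, u₀) h
  | succ k ih =>
    have h1 := ih (m + 1) (by rwa [show m + 1 + k = m + (k + 1) by ring])
    have h2 : ContDiffAt ℝ m (fun q : P × E => fderiv ℝ (iteratedFDeriv ℝ k (Φ q.1)) q.2)
        (p₀, u₀) := by
      refine ContDiffAt.fderiv (n := ((m + 1 : ℕ) : WithTop ℕ∞))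
        (f := fun q : P × E => iteratedFDeriv ℝ k (Φ q.1)) ?_ contDiffAt_snd (by simp)
      exact ContDiffAt.comp (g := fun q : P × E => iteratedFDeriv ℝ k (Φ q.1) q.2)
        (f := fun q : (P × E) × E => (q.1.1, q.2)) ((p₀, u₀), u₀) h1
        ((contDiff_fst.fst).prodMk contDiff_snd).contDiffAt
    simp only [iteratedFDeriv_succ_eq_comp_left]
    exact (continuousMultilinearCurryLeftEquiv ℝ (fun _ : Fin (k + 1) => E)
      F).symm.contDiff.contDiffAt.comp (p₀, u₀) h2

variable {d : ℕ} {M : Type*} [TopologicalSpace M] [ChartedSpace (EuclideanSpace ℝ (Fin d)) M]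
  [IsManifold (𝓡 d) ∞ M] [MeasurableSpace M] {r : ℕ∞} {g : SmoothRiemannianMetric d M}

/-- The composition `f ∘ h` of conservative diffeomorphisms. -/
def ConservativeDiffeo.comp (f h : ConservativeDiffeo r g) : ConservativeDiffeo r g :=
  ⟨h.1.trans f.1, f.2.comp h.2⟩

lemma ConservativeDiffeo.comp_apply (f h : ConservativeDiffeo r g) (z : M) :
    (f.comp h).1 z = f.1 (h.1 z) := rfl

lemma contDiffAt_chartExpr_family {f : M → M} (hf : ContMDiff (𝓡 d) (𝓡 d) r f) {ψ : ℝ → M → M}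
    (hψ : ContMDiff (𝓘(ℝ, ℝ).prod (𝓡 d)) (𝓡 d) ∞ fun p : ℝ × M => ψ p.1 p.2)
    {x y p : M} {t : ℝ} (hp : p ∈ (chartAt (EuclideanSpace ℝ (Fin d)) x).source)
    (hfp : f (ψ t p) ∈ (chartAt (EuclideanSpace ℝ (Fin d)) y).source) :
    ContDiffAt ℝ r (uncurry fun t => chartExpr x y (f ∘ ψ t))
      (t, chartAt (EuclideanSpace ℝ (Fin d)) x p) := by
  set e := chartAt (EuclideanSpace ℝ (Fin d)) x with he
  set e' := chartAt (EuclideanSpace ℝ (Fin d)) y with he'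
  have hr : (r : WithTop ℕ∞) ≤ ((⊤ : ℕ∞) : WithTop ℕ∞) := by exact_mod_cast le_top
  rw [← contMDiffAt_iff_contDiffAt]
  have h1 : ContMDiffAt 𝓘(ℝ, ℝ × EuclideanSpace ℝ (Fin d)) (𝓡 d) ∞
      (fun q : ℝ × EuclideanSpace ℝ (Fin d) => e.symm q.2) (t, e p) :=
    ContMDiffAt.comp (g := e.symm) (f := fun q : ℝ × EuclideanSpace ℝ (Fin d) => q.2) (t, e p)
      (contMDiffAt_symm_of_mem_maximalAtlas (chartAt_mem_maximalAtlas x) (e.map_source hp))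
      contDiff_snd.contMDiff.contMDiffAt
  have h2 : ContMDiffAt 𝓘(ℝ, ℝ × EuclideanSpace ℝ (Fin d)) (𝓘(ℝ, ℝ).prod (𝓡 d)) ∞
      (fun q : ℝ × EuclideanSpace ℝ (Fin d) => (q.1, e.symm q.2)) (t, e p) :=
    contDiff_fst.contMDiff.contMDiffAt.prodMk h1
  have h3 : ContMDiffAt 𝓘(ℝ, ℝ × EuclideanSpace ℝ (Fin d)) (𝓡 d) ∞
      (fun q : ℝ × EuclideanSpace ℝ (Fin d) => ψ q.1 (e.symm q.2)) (t, e p) :=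
    ContMDiffAt.comp (g := fun p : ℝ × M => ψ p.1 p.2)
      (f := fun q : ℝ × EuclideanSpace ℝ (Fin d) => (q.1, e.symm q.2)) (t, e p)
      hψ.contMDiffAt h2
  have h4 : ContMDiffAt 𝓘(ℝ, ℝ × EuclideanSpace ℝ (Fin d)) (𝓡 d) r
      (fun q : ℝ × EuclideanSpace ℝ (Fin d) => f (ψ q.1 (e.symm q.2))) (t, e p) :=
    ContMDiffAt.comp (g := f) (t, e p) hf.contMDiffAt (h3.of_le hr)
  refine ContMDiffAt.comp (g := e')
    (f := fun q : ℝ × EuclideanSpace ℝ (Fin d) => f (ψ q.1 (e.symm q.2))) (t, e p) ?_ h4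
  refine (contMDiffAt_of_mem_maximalAtlas (chartAt_mem_maximalAtlas y) ?_).of_le hr
  simpa only [e.left_inv hp] using hfp

/-- If `ψ t` is a smooth family of diffeomorphisms with `ψ 0 = id`, then `f ∘ ψ t` converges to `f`
in the `C^r` topology. -/
theorem tendsto_comp_family (f : ConservativeDiffeo r g) {ψ : ℝ → ConservativeDiffeo r g}
    (hψ : ContMDiff (𝓘(ℝ, ℝ).prod (𝓡 d)) (𝓡 d) ∞ fun p : ℝ × M => (ψ p.1).1 p.2)
    (hψ0 : ∀ z, (ψ 0).1 z = z) : Tendsto (fun t => f.comp (ψ t)) (𝓝 0) (𝓝 f) := by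
  refine TopologicalSpace.tendsto_nhds_generateFrom_iff.2 ?_
  rintro _ ⟨f₀, x, y, K, k, ε, hK, hKx, hf₀, hk, hε, rfl⟩ hf
  have hfψ : Continuous fun p : ℝ × M => f.1 ((ψ p.1).1 p.2) := f.1.continuous.comp hψ.continuous
  set e := chartAt (EuclideanSpace ℝ (Fin d)) x with he
  set e' := chartAt (EuclideanSpace ℝ (Fin d)) y with he'
  have key : ∀ p ∈ K, ∀ᶠ q : ℝ × M in 𝓝 (0, p), (f.1 ((ψ q.1).1 q.2) ∈ e'.source) ∧
      ∀ j ≤ k, ‖iteratedFDeriv ℝ j (chartExpr x y (f.comp (ψ q.1)).1) (e q.2) -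
        iteratedFDeriv ℝ j (chartExpr x y f₀.1) (e q.2)‖ < ε := by
    intro p hp
    have hpe := hKx hp
    have h0 : f.1 ((ψ 0).1 p) ∈ e'.source := by rw [hψ0]; exact hf.1 hp
    refine Eventually.and (hfψ.continuousAt.eventually (e'.open_source.mem_nhds h0)) ?_
    have hce : ContinuousAt (fun q : ℝ × M => (q.1, e q.2)) (0, p) :=
      continuousAt_fst.prodMk (ContinuousAt.comp (g := e) (f := fun q : ℝ × M => q.2) (x := (0, p))
        (e.continuousAt hpe) continuousAt_snd)
    have hj : ∀ j ∈ Finset.range (k + 1), ∀ᶠ q : ℝ × M in 𝓝 (0, p), ‖iteratedFDeriv ℝ j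
        (chartExpr x y (f.comp (ψ q.1)).1) (e q.2) -
        iteratedFDeriv ℝ j (chartExpr x y f₀.1) (e q.2)‖ < ε := by
      intro j hj
      have hjk : j ≤ k := Nat.lt_succ_iff.1 (Finset.mem_range.1 hj)
      have hjr : ((0 + j : ℕ) : WithTop ℕ∞) ≤ r := by
        rw [zero_add]
        exact_mod_cast (by exact_mod_cast hjk : (j : ℕ∞) ≤ k).trans hk
      have h1 : ContinuousAt (fun q : ℝ × M => iteratedFDeriv ℝ j
          (chartExpr x y (f.comp (ψ q.1)).1) (e q.2)) (0, p) := by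
        have h2 := (contDiffAt_iteratedFDeriv_param j 0 ((contDiffAt_chartExpr_family
          (ψ := fun t => (ψ t).1) f.1.contMDiff hψ (x := x) (y := y) hpe h0).of_le
          hjr)).continuousAt
        exact ContinuousAt.comp_of_eq (f := fun q : ℝ × M => (q.1, e q.2)) h2 hce rfl
      have h3 : ContinuousAt (fun q : ℝ × M => iteratedFDeriv ℝ j
          (chartExpr x y f₀.1) (e q.2)) (0, p) := by
        have h2 := (contDiffAt_iteratedFDeriv_param j 0 ((contDiffAt_chartExpr_family (t := 0)
          (ψ := fun _ => id) f₀.1.contMDiff contMDiff_snd (x := x) (y := y) hpe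
          (hf₀ hp)).of_le hjr)).continuousAt
        exact ContinuousAt.comp_of_eq (f := fun q : ℝ × M => (q.1, e q.2)) h2 hce rfl
      refine (h1.sub h3).norm.eventually_lt_const ?_
      have h6 : ⇑(f.comp (ψ 0)).1 = ⇑f.1 := funext fun z => by
        rw [ConservativeDiffeo.comp_apply, hψ0]
      have h5 := hf.2 p hp j hjk
      rw [← h6] at h5
      exact h5
    filter_upwards [(Filter.eventually_all_finset _).2 hj] with q hq j hjk
    exact hq j (Finset.mem_range.2 (Nat.lt_succ_iff.2 hjk))
  have hall := IsCompact.eventually_forall_of_forall_eventually (x₀ := (0 : ℝ)) (K := K)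
    (P := fun t p => (f.1 ((ψ t).1 p) ∈ e'.source) ∧
      ∀ j ≤ k, ‖iteratedFDeriv ℝ j (chartExpr x y (f.comp (ψ t)).1) (e p) -
        iteratedFDeriv ℝ j (chartExpr x y f₀.1) (e p)‖ < ε) hK key
  filter_upwards [hall] with t ht
  exact ⟨fun p hp => (ht p hp).1, fun p hp => (ht p hp).2⟩

end SmoothFamilies

/-! ### Density -/

section Density

open Filter Topology Function

variable {d : ℕ} {M : Type*} [TopologicalSpace M] [ChartedSpace (EuclideanSpace ℝ (Fin d)) M]
  [IsManifold (𝓡 d) ∞ M] {r : ℕ∞}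

lemma jac_congr (hr : 1 ≤ r) (P : FrameField d M) {f f' : M ≃ₘ^(r : WithTop ℕ∞)⟮𝓡 d, 𝓡 d⟯ M}
    {z : M} (h : ∀ᶠ w in 𝓝 z, f w = f' w) : jac hr P f z = jac hr P f' z := by
  have hz := mem_chart_source (EuclideanSpace ℝ (Fin d)) z
  have hfz := mem_chart_source (EuclideanSpace ℝ (Fin d)) (f z)
  have heq : f z = f' z := h.self_of_nhds
  set e := chartAt (EuclideanSpace ℝ (Fin d)) z with he
  have h1 : chartAt (EuclideanSpace ℝ (Fin d)) (f z) ∘ f ∘ e.symm =ᶠ[𝓝 (e z)]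
      chartAt (EuclideanSpace ℝ (Fin d)) (f z) ∘ f' ∘ e.symm := by
    have h2 := e.continuousAt_symm (e.map_source hz)
    rw [ContinuousAt, e.left_inv hz] at h2
    filter_upwards [h2.eventually h] with u hu
    simp only [comp_apply, hu]
  rw [jac_eq_chart hr P (chartAt_mem_maximalAtlas z) (chartAt_mem_maximalAtlas (f z)) f hz hfz,
    jac_eq_chart hr P (chartAt_mem_maximalAtlas z) (chartAt_mem_maximalAtlas (f z)) f' hz
      (heq ▸ hfz), ← heq, h1.fderiv_eq]

variable [MeasurableSpace M] {g : SmoothRiemannianMetric d M}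

/-- The cocycle identity. -/
lemma jac_comp (hr : 1 ≤ r) (P : FrameField d M) (f h : ConservativeDiffeo r g) (z : M) :
    jac hr P (f.comp h).1 z = jac hr P f.1 (h.1 z) ∘L jac hr P h.1 z := by
  have h1 : mfderiv (𝓡 d) (𝓡 d) (f.comp h).1 z =
      (mfderiv (𝓡 d) (𝓡 d) f.1 (h.1 z)).comp (mfderiv (𝓡 d) (𝓡 d) h.1 z) :=
    mfderiv_comp z (diffeo_mdifferentiableAt hr f.1 _) (diffeo_mdifferentiableAt hr h.1 z)
  refine ContinuousLinearMap.ext fun v => ?_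
  change P (f.1 (h.1 z)) (mfderiv (𝓡 d) (𝓡 d) (f.comp h).1 z ((P z).symm v)) =
    P (f.1 (h.1 z)) (mfderiv (𝓡 d) (𝓡 d) f.1 (h.1 z) ((P (h.1 z)).symm
      (P (h.1 z) (mfderiv (𝓡 d) (𝓡 d) h.1 z ((P z).symm v)))))
  rw [h1, ContinuousLinearEquiv.symm_apply_apply]
  rfl

variable [BorelSpace M]

lemma ae_of_ae_normalizedVolume (hfin : riemannianVolume g univ ≠ ⊤)
    {e : OpenPartialHomeomorph M (EuclideanSpace ℝ (Fin d))}
    (hvol : ∀ A ⊆ e.source, MeasurableSet A → riemannianVolume g A = volume (e '' A))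
    {p : M → Prop} (hp : ∀ᵐ z ∂normalizedVolume g, p z) :
    ∀ᵐ u, u ∈ e.target → p (e.symm u) := by
  have h1 : riemannianVolume g {z | ¬ p z} = 0 := by
    have h2 : (riemannianVolume g univ)⁻¹ * riemannianVolume g {z | ¬ p z} = 0 := hp
    exact (mul_eq_zero.1 h2).resolve_left (ENNReal.inv_ne_zero.2 hfin)
  set N := toMeasurable (riemannianVolume g) {z | ¬ p z} with hN
  have h3 : volume (e '' (N ∩ e.source)) = 0 := by
    rw [← hvol _ inter_subset_right
      ((measurableSet_toMeasurable _ _).inter e.open_source.measurableSet)]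
    exact measure_mono_null inter_subset_left ((measure_toMeasurable _).trans h1)
  refine measure_mono_null (fun u hu => ?_) h3
  simp only [mem_compl_iff, mem_ofPred_eq, Classical.not_imp] at hu
  exact ⟨e.symm u, ⟨subset_toMeasurable _ _ hu.2, e.map_target hu.1⟩, e.right_inv hu.1⟩

/-- At a point of approximate continuity, a measure that is fixed by almost all values of the
cocycle is fixed by its value at the point, although this value is taken on a null set only. -/
lemma fixesMeasure_of_ae_fixesMeasure (hr : 1 ≤ r) (P : FrameField d M)
    (hfin : riemannianVolume g univ ≠ ⊤)
    {e : OpenPartialHomeomorph M (EuclideanSpace ℝ (Fin d))}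
    (he : e ∈ IsManifold.maximalAtlas (𝓡 d) ∞ M)
    (hvol : ∀ A ⊆ e.source, MeasurableSet A → riemannianVolume g A = volume (e '' A))
    {c : EuclideanSpace ℝ (Fin d)} (hc : c ∈ e.target)
    (h ψ k : ConservativeDiffeo r g) (hψe : ∀ z ∈ e.source, ψ.1 z ∈ e.source)
    (L : EuclideanSpace ℝ (Fin d) ≃L[ℝ] EuclideanSpace ℝ (Fin d))
    (hψ : e ∘ ψ.1 ∘ e.symm =ᶠ[𝓝 c] fun u => c + L (u - c))
    (hk : ∀ᶠ z in 𝓝 (e.symm c), k.1 z = h.1 (ψ.1 z))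
    (hframe : Tendsto (fun u => frameAt P e (e.symm u)) (densityFilter c)
      (𝓝 (frameAt P e (e.symm c))))
    (hjac : Tendsto (fun u => jac hr P h.1 (e.symm u)) (densityFilter c)
      (𝓝 (jac hr P h.1 (e.symm c))))
    (B : EuclideanSpace ℝ (Fin d) ≃L[ℝ] EuclideanSpace ℝ (Fin d))
    (hB : (B : EuclideanSpace ℝ (Fin d) →L[ℝ] EuclideanSpace ℝ (Fin d)) =
      frameAt P e (e.symm c))
    (ν : ProbabilityMeasure (ℙ ℝ (EuclideanSpace ℝ (Fin d))))
    (hν : ∀ᵐ z ∂normalizedVolume g, FixesMeasure (jac hr P k.1 z)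
      (ν : Measure (ℙ ℝ (EuclideanSpace ℝ (Fin d))))) :
    FixesMeasure (jac hr P h.1 (e.symm c) ∘L
      (B : EuclideanSpace ℝ (Fin d) →L[ℝ] EuclideanSpace ℝ (Fin d)) ∘L
      (L : EuclideanSpace ℝ (Fin d) →L[ℝ] EuclideanSpace ℝ (Fin d)) ∘L
      (B.symm : EuclideanSpace ℝ (Fin d) →L[ℝ] EuclideanSpace ℝ (Fin d)))
      (ν : Measure (ℙ ℝ (EuclideanSpace ℝ (Fin d)))) := by
  set T : EuclideanSpace ℝ (Fin d) → EuclideanSpace ℝ (Fin d) := fun u => c + L (u - c) with hT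
  have hTT : Tendsto T (densityFilter c) (densityFilter c) := tendsto_densityFilter_affine L c
  have hesymm : Tendsto e.symm (𝓝 c) (𝓝 (e.symm c)) := e.continuousAt_symm hc
  -- all factors except the constant one are approximately continuous at `c`
  have hformula : ∀ᶠ u in 𝓝 c, jac hr P k.1 (e.symm u) = jac hr P h.1 (e.symm (T u)) ∘L
      frameAt P e (e.symm (T u)) ∘L
      (L : EuclideanSpace ℝ (Fin d) →L[ℝ] EuclideanSpace ℝ (Fin d)) ∘L
      (frameAt P e (e.symm u)).inverse := by
    filter_upwards [e.open_target.mem_nhds hc, hesymm.eventually (eventually_eventually_nhds.2 hk),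
      eventually_eventually_nhds.2 hψ] with u hu hku hψu
    have hz := e.map_target hu
    have hψz := hψe _ hz
    have h1 : jac hr P k.1 (e.symm u) = jac hr P (h.comp ψ).1 (e.symm u) := jac_congr hr P hku
    have h2 : ψ.1 (e.symm u) = e.symm (T u) := by
      rw [← hψu.self_of_nhds]
      exact (e.left_inv hψz).symm
    have h3 : fderiv ℝ (e ∘ ψ.1 ∘ e.symm) u =
        (L : EuclideanSpace ℝ (Fin d) →L[ℝ] EuclideanSpace ℝ (Fin d)) := by
      have h4 := (L.hasFDerivAt (x := u - c)).comp u ((hasFDerivAt_id u).sub_const c)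
      rw [ContinuousLinearMap.comp_id] at h4
      rw [EventuallyEq.fderiv_eq hψu]
      exact (h4.const_add c).fderiv
    rw [h1, jac_comp, jac_eq_chart hr P he he ψ.1 hz hψz, e.right_inv hu, h3, h2]
  have hinv : Tendsto (fun u => (frameAt P e (e.symm u)).inverse) (densityFilter c)
      (𝓝 (B.symm : EuclideanSpace ℝ (Fin d) →L[ℝ] EuclideanSpace ℝ (Fin d))) := by
    have h1 : ContinuousAt ContinuousLinearMap.inverse
        (B : EuclideanSpace ℝ (Fin d) →L[ℝ] EuclideanSpace ℝ (Fin d)) :=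
      (contDiffAt_map_inverse (n := 0) B).continuousAt
    rw [ContinuousAt, ContinuousLinearMap.inverse_equiv] at h1
    rw [← hB] at hframe
    exact h1.comp hframe
  have hlim := tendsto_clm_comp (hjac.comp hTT) (tendsto_clm_comp (hframe.comp hTT)
    (tendsto_clm_comp (tendsto_const_nhds
      (x := (L : EuclideanSpace ℝ (Fin d) →L[ℝ] EuclideanSpace ℝ (Fin d)))) hinv))
  have hlim' := hlim.congr' ((hformula.filter_mono densityFilter_le_nhds).mono fun u hu => hu.symm)
  rw [← hB] at hlim'
  let F : Set (EuclideanSpace ℝ (Fin d)) := {u | FixesMeasure (jac hr P k.1 (e.symm u))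
    (ν : Measure (ℙ ℝ (EuclideanSpace ℝ (Fin d))))}
  have hF : F ∈ densityFilter c := by
    filter_upwards [densityFilter_le_ae (ae_of_ae_normalizedVolume hfin hvol hν),
      densityFilter_le_nhds (e.open_target.mem_nhds hc)] with u hu hue
    exact hu hue
  have hne : (comap ((↑) : F → EuclideanSpace ℝ (Fin d)) (densityFilter c)).NeBot :=
    Filter.comap_coe_neBot_of_le_principal (le_principal_iff.2 hF)
  exact fixesMeasure_of_tendsto (l := comap ((↑) : F → EuclideanSpace ℝ (Fin d)) (densityFilter c))
    (((jac_injective hr P h.1 _).comp B.injective).comp (L.injective.comp B.symm.injective))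
    (hlim'.comp tendsto_comap) (tendsto_const_nhds (x := ν)) fun u : F => u.2

variable [T2Space M] [SecondCountableTopology M]

/-- A winning strategy in the game of small rotations yields a perturbation without invariant
product measure: every move of the strategy is realized by a localized rotation around a point of
approximate continuity, and the later moves are made in an open set that leaves a neighbourhood of
this point untouched. -/
theorem exists_mem_noProductInvariantMeasure_of_wins (hr : 1 ≤ r)
    (hfin : riemannianVolume g univ ≠ ⊤) {P : FrameField d M} (hP : P ∈ measurableFrames d M)
    {i j : Fin d} (hij : i ≠ j)
    {X : Set (ProbabilityMeasure (ℙ ℝ (EuclideanSpace ℝ (Fin d))))} (hX : Wins hij X)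
    (h : ConservativeDiffeo r g) {V : Set (ConservativeDiffeo r g)} (hV : IsOpen V) (hhV : h ∈ V)
    {O : Set M} (hO : IsOpen O) (hOne : O.Nonempty)
    (hinv : ∀ k : ConservativeDiffeo r g, (∀ z ∉ O, k.1 z = h.1 z) →
      ∀ ν : ProbabilityMeasure (ℙ ℝ (EuclideanSpace ℝ (Fin d))),
        (∀ᵐ z ∂normalizedVolume g, FixesMeasure (jac hr P k.1 z)
          (ν : Measure (ℙ ℝ (EuclideanSpace ℝ (Fin d))))) → ν ∈ X) :
    ∃ k ∈ V, k ∈ noProductInvariantMeasure hr g P := by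
  classical
  induction hX generalizing h O with
  | empty =>
    refine ⟨h, hhV, ?_⟩
    by_contra hcon
    obtain ⟨ν, hν⟩ := (notMem_noProductInvariantMeasure_iff hr hP h).1 hcon
    exact hinv h (fun _ _ => rfl) ν hν
  | step X Sfun tfun ht _ ih =>
    obtain ⟨z₀, hz₀⟩ := hOne
    obtain ⟨e, he, hz₀e, hvol⟩ := exists_volume_chart i g z₀
    set U := e.target ∩ e.symm ⁻¹' O with hU
    have hUo : IsOpen U := e.isOpen_inter_preimage_symm hO
    have hUne : U.Nonempty := ⟨e z₀, e.map_source hz₀e, by rwa [mem_preimage, e.left_inv hz₀e]⟩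
    -- a point `c` at which the frame and the cocycle are approximately continuous
    let s : EuclideanSpace ℝ (Fin d) → M := e.target.piecewise e.symm fun _ => z₀
    have hs : Measurable s :=
      e.continuousOn_symm.measurable_piecewise continuousOn_const e.open_target.measurableSet
    have hse : ∀ u ∈ e.target, s u = e.symm u := fun u hu => piecewise_eq_of_mem _ _ _ hu
    have hQ1 := ae_tendsto_densityFilter ((measurable_frameAt hP he).comp hs)
    have hQ2 := ae_tendsto_densityFilter ((measurable_jac hr hP h.1).comp hs)
    obtain ⟨c, hcU, hc1, hc2⟩ : ∃ c ∈ U, Tendsto (e.source.indicator (frameAt P e) ∘ s)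
        (densityFilter c) (𝓝 ((e.source.indicator (frameAt P e) ∘ s) c)) ∧
        Tendsto (jac hr P h.1 ∘ s) (densityFilter c) (𝓝 ((jac hr P h.1 ∘ s) c)) := by
      by_contra! hcon
      refine hUo.measure_ne_zero volume hUne (measure_mono_null (fun c hc => ?_)
        (ae_iff.1 (hQ1.and hQ2)))
      exact fun hh => hcon c hc hh.1 hh.2
    have hc := hcU.1
    have htarget : e.target ∈ densityFilter c :=
      densityFilter_le_nhds (e.open_target.mem_nhds hc)
    have hframe : Tendsto (fun u => frameAt P e (e.symm u)) (densityFilter c)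
        (𝓝 (frameAt P e (e.symm c))) := by
      rw [comp_apply, hse c hc, indicator_of_mem (e.map_target hc)] at hc1
      refine hc1.congr' ?_
      filter_upwards [htarget] with u hu
      rw [comp_apply, hse u hu, indicator_of_mem (e.map_target hu)]
    have hjac : Tendsto (fun u => jac hr P h.1 (e.symm u)) (densityFilter c)
        (𝓝 (jac hr P h.1 (e.symm c))) := by
      rw [comp_apply, hse c hc] at hc2
      refine hc2.congr' ?_
      filter_upwards [htarget] with u hu
      rw [comp_apply, hse u hu]
    -- the move of the strategy in answer to the value `G` of the cocycle at `c`, carried over from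
    -- the frame to the chart by `B`
    obtain ⟨B, hB⟩ := frameAt_isInvertible P he (e.map_target hc)
    set G := frameJacobian hr P h.1 (e.symm c) with hG
    obtain ⟨ψ, hψsm, hψ0, hψoff, hψe, hψc⟩ := exists_twist_family hij r he hvol
      ((Sfun G).trans B.symm) c (hUo.mem_nhds hcU) inter_subset_left
    have hVt := tendsto_comp_family h hψsm hψ0 (hV.mem_nhds hhV)
    obtain ⟨ε, hε, hball⟩ := Metric.mem_nhds_iff.1 hVt
    set t := tfun G ε with htdef
    have htV : h.comp (ψ t) ∈ V := hball (by simpa using ht G ε hε)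
    -- the open set that remains for the later moves
    have : Nonempty (Fin d) := ⟨i⟩
    obtain ⟨u', hu'U, hu'c⟩ : ∃ u' ∈ U, u' ≠ c :=
      Filter.nonempty_of_mem (f := 𝓝[≠] c)
        (inter_mem (mem_nhdsWithin_of_mem_nhds (hUo.mem_nhds hcU)) self_mem_nhdsWithin)
    obtain ⟨δ, hδ, hδU⟩ := Metric.nhds_basis_closedBall.mem_iff.1
      (inter_mem (hUo.mem_nhds hcU) (isOpen_compl_singleton.mem_nhds (Ne.symm hu'c)))
    set K := e.symm '' Metric.closedBall c δ with hK
    have hKclosed : IsClosed K := ((isCompact_closedBall c δ).image_of_continuousOn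
      (e.continuousOn_symm.mono fun u hu => (hδU hu).1.1)).isClosed
    have hKnhds : K ∈ 𝓝 (e.symm c) :=
      e.symm.image_mem_nhds hc (Metric.closedBall_mem_nhds c hδ)
    refine ih G ε hε (h.comp (ψ t)) htV (hO.sdiff hKclosed) ⟨e.symm u', hu'U.2, ?_⟩ ?_
    · rintro ⟨u, hu, huu⟩
      have : u = u' := e.symm.injOn (hδU hu).1.1 hu'U.1 huu
      exact (hδU hu).2 this
    · intro k hk ν hν
      refine ⟨hinv k (fun z hz => ?_) ν hν, ?_⟩
      · rw [hk z fun hz' => hz hz'.1, ConservativeDiffeo.comp_apply, hψoff]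
        rintro ⟨u, hu, rfl⟩
        exact hz hu.2
      · have hfix := fixesMeasure_of_ae_fixesMeasure hr P hfin he hvol hc h (ψ t) k (hψe t)
          (conjRot hij ((Sfun G).trans B.symm) t) (hψc t)
          (by filter_upwards [hKnhds] with z hz using hk z fun hz' => hz'.2 hz)
          hframe hjac B hB ν hν
        have hconj : (B : EuclideanSpace ℝ (Fin d) →L[ℝ] EuclideanSpace ℝ (Fin d)) ∘L
            (conjRot hij ((Sfun G).trans B.symm) t :
              EuclideanSpace ℝ (Fin d) →L[ℝ] EuclideanSpace ℝ (Fin d)) ∘L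
            (B.symm : EuclideanSpace ℝ (Fin d) →L[ℝ] EuclideanSpace ℝ (Fin d)) =
            (conjRot hij (Sfun G) t :
              EuclideanSpace ℝ (Fin d) →L[ℝ] EuclideanSpace ℝ (Fin d)) := by
          ext1 v
          simp [conjRot_apply]
        rw [hconj] at hfix
        exact hfix

/-- Any neighbourhood of `h` contains the outcome of a won game, all moves being made as small as
necessary. -/
theorem dense_noProductInvariantMeasure [Nonempty M] (hd : 2 ≤ d) (hr : 1 ≤ r)
    (hfin : riemannianVolume g univ ≠ ⊤) {P : FrameField d M} (hP : P ∈ measurableFrames d M) :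
    Dense (noProductInvariantMeasure hr g P) := by
  have hij : (⟨0, by omega⟩ : Fin d) ≠ ⟨1, by omega⟩ := by simp
  refine dense_iff_inter_open.2 fun V hV ⟨h, hhV⟩ => ?_
  obtain ⟨k, hkV, hk⟩ := exists_mem_noProductInvariantMeasure_of_wins hr hfin hP hij
    (wins_univ hij) h hV hhV isOpen_univ univ_nonempty fun _ _ _ _ => mem_univ _
  exact ⟨k, hkV, hk⟩

end Density

end

theorem mainTheorem4 (d : ℕ) (hd : 2 ≤ d) (r : ℕ∞) (hr : 1 ≤ r)
    (M : Type*) [TopologicalSpace M] [T2Space M] [SecondCountableTopology M] [Nonempty M]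
    [ChartedSpace (EuclideanSpace ℝ (Fin d)) M] [IsManifold (𝓡 d) ∞ M]
    [MeasurableSpace M] [BorelSpace M]
    (g : SmoothRiemannianMetric d M) (hvol : riemannianVolume g univ ≠ ⊤)
    (P : FrameField d M) (hP : P ∈ specialFrames g) :
    IsOpen (noProductInvariantMeasure hr g P) ∧ Dense (noProductInvariantMeasure hr g P) :=
  ⟨isOpen_noProductInvariantMeasure hr hP.1, dense_noProductInvariantMeasure hd hr hvol hP.1⟩
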